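/- **Theorem (Local existence).** Let $n\in\mathbb{N}$, put $n_*=\frac{n(n+1)}{2}$, and let $g_0$ be a positive definite symmetric $n\times n$ matrix. There exists $r>0$, depending only on $n$ and $g_0$, such that the following holds for every bounded open set $\Omega\subset\mathbb{R}^n$ with smooth boundary, every $\beta>0$, and every Riemannian metric $g=(g_{ij})$ of class $C^{\beta}(\overline{\Omega})$ with $\|g-g_0\|_{C^0}\le r$. There exist constants $\delta_0>0$ and $C>0$, depending only on $n,g_0,\Omega,\beta,g$, such that, whenever $u\in C^2(\overline{\Omega};\mathbb{R}^{n+1})$ and $\alpha\in\mathbb{R}$ satisfy $$\|u^\sharp e-g\|_{C^0}\le\delta_0^2\qquad\text{and}\qquad 0<\alpha<\min\Big\{\frac{1}{1+2n_*},\frac{\beta}{2}\Big\},$$ there exists a map $v\in C^{1,\alpha}(\overline{\Omega};\mathbb{R}^{n+1})$ with $$v^\sharp e=g\qquad\text{and}\qquad \|v-u\|_{C^1}\le C\,\|u^\sharp e-g\|_{C^0}^{1/2}.$$ Here $(u^\sharp e)_{ij}=\partial_iu\cdot\partial_ju$ is the pullback of the Euclidean metric, $\|f\|_{C^0}=\sup_{x\in\Omega}|f(x)|$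 (matrices carry their Euclidean norm), and $\|f\|_{C^1}=\sup_{x\in\Omega}\big(|f(x)|+\sum_{i}|\partial_if(x)|\big)$. For an integer $k\ge 0$ and $0\le\theta<1$, $C^{k,\theta}(\overline{\Omega})$ is the space of functions that are continuous on $\overline\Omega$ and $k$ times continuously differentiable in $\Omega$, whose derivatives of order at most $k$ extend continuously to $\overline{\Omega}$ and whose derivatives of order $k$ are Hölder continuous with exponent $\theta$ on $\Omega$ (for $\theta=0$ this is no further condition, and $C^{k,0}=C^k$); $C^\beta=C^{k,\theta}$ for $\beta=k+\theta$. -/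

import Mathlib

open Set
open scoped ContDiff ENNReal

-- Matrices carry the Euclidean (Hilbert-Schmidt) norm `|A| = (∑ A_ij ^ 2) ^ (1/2)`.
attribute [local instance] Matrix.frobeniusNormedAddCommGroup Matrix.frobeniusNormedSpace

/-- The boundary of `Ω` is smooth: near each of its boundary points, `Ω` is the sublevel set
`{ρ < 0}` of a smooth function `ρ` whose differential does not vanish at the point
(so that `Ω` lies locally on one side of a smooth hypersurface). -/
def HasSmoothBoundary {n : ℕ} (Ω : Set (EuclideanSpace ℝ (Fin n))) : Prop :=
  ∀ p ∈ frontier Ω, ∃ U : Set (EuclideanSpace ℝ (Fin n)), IsOpen U ∧ p ∈ U ∧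
    ∃ ρ : EuclideanSpace ℝ (Fin n) → ℝ,
      ContDiffOn ℝ ∞ ρ U ∧ fderiv ℝ ρ p ≠ 0 ∧ Ω ∩ U = {x ∈ U | ρ x < 0}

/-- The space `C^{k,θ}` of the closure of an open set `Ω`: `f` is of class `C^k` in `Ω`, `f` is
continuous on the closure, all derivatives of order at most `k` extend continuously from `Ω` to
the closure, and the derivatives of order `k` are Hölder continuous with exponent `θ` on `Ω`.
For `θ = 0` and bounded `Ω` the last condition is automatic, and this is `C^k` of the closure. -/
structure IsCkHolder {E F : Type*} [NormedAddCommGroup E] [NormedSpace ℝ E]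
    [NormedAddCommGroup F] [NormedSpace ℝ F] (k : ℕ) (θ : ℝ) (Ω : Set E) (f : E → F) : Prop where
  contDiffOn : ContDiffOn ℝ k f Ω
  continuousOn : ContinuousOn f (closure Ω)
  continuous_extension : ∀ m ≤ k, ∃ G : E → (E [×m]→L[ℝ] F),
    ContinuousOn G (closure Ω) ∧ EqOn G (iteratedFDeriv ℝ m f) Ω
  holder : ∃ H : ℝ, ∀ x ∈ Ω, ∀ y ∈ Ω,
    ‖iteratedFDeriv ℝ k f x - iteratedFDeriv ℝ k f y‖ ≤ H * ‖x - y‖ ^ θ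

/-- The space `C^β` of the closure of `Ω` for a real exponent `β > 0`, that is `C^{k,θ}` with
`β = k + θ`, `k` an integer and `0 ≤ θ < 1`. -/
def IsCHolder {E F : Type*} [NormedAddCommGroup E] [NormedSpace ℝ E]
    [NormedAddCommGroup F] [NormedSpace ℝ F] (β : ℝ) (Ω : Set E) (f : E → F) : Prop :=
  IsCkHolder ⌊β⌋₊ (β - ⌊β⌋₊) Ω f

/-- The `C^0` norm `sup_{x ∈ Ω} |f x|`, with values in `[0, ∞]`. -/
noncomputable def normC0 {E F : Type*} [NormedAddCommGroup F] (Ω : Set E) (f : E → F) : ℝ≥0∞ :=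
  ⨆ x ∈ Ω, ‖f x‖ₑ

/-- The partial derivative `∂_i f (x)`. -/
noncomputable def partialD {n : ℕ} {F : Type*} [NormedAddCommGroup F] [NormedSpace ℝ F]
    (i : Fin n) (f : EuclideanSpace ℝ (Fin n) → F) (x : EuclideanSpace ℝ (Fin n)) : F :=
  fderiv ℝ f x (EuclideanSpace.single i 1)

/-- The `C^1` norm `sup_{x ∈ Ω} (|f x| + ∑ i, |∂_i f x|)`, with values in `[0, ∞]`. -/
noncomputable def normC1 {n : ℕ} {F : Type*} [NormedAddCommGroup F] [NormedSpace ℝ F]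
    (Ω : Set (EuclideanSpace ℝ (Fin n))) (f : EuclideanSpace ℝ (Fin n) → F) : ℝ≥0∞ :=
  ⨆ x ∈ Ω, (‖f x‖ₑ + ∑ i : Fin n, ‖partialD i f x‖ₑ)

/-- The pullback `u^♯ e` of the Euclidean metric, `(u^♯ e)_ij = ∂_i u · ∂_j u`. -/
noncomputable def pullbackMetric {n m : ℕ}
    (u : EuclideanSpace ℝ (Fin n) → EuclideanSpace ℝ (Fin m)) (x : EuclideanSpace ℝ (Fin n)) :
    Matrix (Fin n) (Fin n) ℝ :=
  Matrix.of fun i j => inner ℝ (partialD i u x) (partialD j u x)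

/-!
The theorem is proved by convex integration. A map `u` whose metric `∇uᵀ∇u` is short of `g` by
about `δ ^ 2 * g₀` is corrected in stages, each of which replaces `δ` by `δ / k`.

A stage adds the missing metric one primitive metric at a time. A symmetric matrix close to `g₀`
is a combination of `N = n * (n + 1) / 2` fixed matrices `ν ⊗ ν` with positive coefficients
(`exists_primitive_decomposition`), and `δ² a² ν ⊗ ν` is added to the metric by a corrugation: a
normal oscillation of amplitude `δ a` and high frequency in the direction `ν`, together with a
tangential oscillation of twice the frequency, of size `δ²`, that removes the oscillating part of
the square of the first one (`colGram_add_rankOneMap`). The terms containing derivatives of the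
amplitudes are of order `δ η₀ / η` if the frequency rises from `η₀` to `η`, but, as the second
derivatives of `u` are of order `δ η₀`, they are to first order normal to the image and do not
change the metric (`abs_inner_fderiv_smul_unitNormal_le`), so that the error of a corrugation is
`δ² η₀ / η + δ⁴` (`exists_corrugation_step`, `exists_corrugation_iterate`). Derivatives are lost
on the way; they are recovered by mollifying at the scale `1 / freq` beforehand, which affects the
metric only quadratically in the oscillation of `∇u`
(`exists_norm_iteratedFDeriv_mollify_bilin_sub_le`). Frequency factors proportional to `k²` make
the error a small part of `(δ / k)²`, so a stage raises the frequency by a factor `A k ^ (2 N +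
1)` (`exists_stage`). Since the `C^1` increments decay like `k ^ (-q)` and the second derivatives
grow like `A ^ q k ^ (2 N q)`, interpolation gives a limit in `C^{1,α}` for all `α < 1 / (1 + 2
N)`, once `k` is large depending on `α`; the mollification of `g` requires `α < β / 2`
(`exists_ratios`, `exists_holder_limit`). The term `δ⁴` forces `k δ` to be small, while the
threshold for the initial `δ` must not depend on `α`: finitely many stages with a fixed ratio,
whose frequencies are irrelevant, come first (`exists_isometric_of_isApprox`).

To start, `u` is multiplied by `1 - θ`, where `θ` is proportional to the `C^0` norm of its metric
defect, so that its metric becomes short by about `2 θ g₀` (`norm_metric_defect_le`). In order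
that the change is controlled by `∇u`, which is bounded in terms of `g`, and not by the size of
`u`, the map is shrunk towards locally constant values (`HasSmoothBoundary.exists_reference`). It
is then approximated by a map that is smooth near the closure of `Ω`, with the help of a vector
field pointing into `Ω` (`HasSmoothBoundary.exists_transversal_field`,
`HasSmoothBoundary.exists_smooth_approx`), and `g` is extended to a Hölder continuous function on
the whole space (`exists_holder_extension_matrix`). If the defect vanishes, `u` itself is the
solution.
-/

/-! ### Functions oscillating at a given frequency -/

section Symbols

variable {E F G H : Type*} [NormedAddCommGroup E] [NormedSpace ℝ E]
  [NormedAddCommGroup F] [NormedSpace ℝ F] [NormedAddCommGroup G] [NormedSpace ℝ G]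
  [NormedAddCommGroup H] [NormedSpace ℝ H]

/-- `f` is smooth on `U`, and there its derivatives of order `k ≤ m` are bounded by `C * η ^ k`:
it has size `C` and oscillates at frequency at most `η`. -/
structure SymbolOn (U : Set E) (m : ℕ) (C η : ℝ) (f : E → F) : Prop where
  contDiffOn : ContDiffOn ℝ ∞ f U
  bound : ∀ k ≤ m, ∀ x ∈ U, ‖iteratedFDeriv ℝ k f x‖ ≤ C * η ^ k

namespace SymbolOn

variable {U : Set E} {m : ℕ} {C C' η η' : ℝ} {f g : E → F}

theorem norm_le (h : SymbolOn U m C η f) {x : E} (hx : x ∈ U) : ‖f x‖ ≤ C := by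
  simpa using h.bound 0 (Nat.zero_le _) x hx

theorem norm_fderiv_le (h : SymbolOn U m C η f) (hm : 1 ≤ m) {x : E} (hx : x ∈ U) :
    ‖fderiv ℝ f x‖ ≤ C * η := by
  simpa [norm_iteratedFDeriv_one] using h.bound 1 hm x hx

theorem mono (h : SymbolOn U m C η f) {m' : ℕ} (hm : m' ≤ m) (hC : C ≤ C') (hC' : 0 ≤ C')
    (hη : 0 ≤ η) (hηη' : η ≤ η') : SymbolOn U m' C' η' f :=
  ⟨h.contDiffOn, fun k hk x hx => (h.bound k (hk.trans hm) x hx).trans (by gcongr)⟩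

theorem mono_const (h : SymbolOn U m C η f) (hC : C ≤ C') (hη : 0 ≤ η) :
    SymbolOn U m C' η f :=
  ⟨h.contDiffOn, fun k hk x hx => (h.bound k hk x hx).trans (by gcongr)⟩

theorem congr (hU : IsOpen U) (h : SymbolOn U m C η f) (hfg : EqOn g f U) :
    SymbolOn U m C η g := by
  refine ⟨h.contDiffOn.congr hfg, fun k hk x hx => ?_⟩
  have : g =ᶠ[nhds x] f := Filter.eventuallyEq_of_mem (hU.mem_nhds hx) hfg
  rw [(Filter.EventuallyEq.iteratedFDeriv ℝ this k).eq_of_nhds]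
  exact h.bound k hk x hx

theorem contDiffAt (hU : IsOpen U) (h : SymbolOn U m C η f) {x : E} (hx : x ∈ U) :
    ContDiffAt ℝ ∞ f x :=
  h.contDiffOn.contDiffAt (hU.mem_nhds hx)

theorem differentiableAt (hU : IsOpen U) (h : SymbolOn U m C η f) {x : E} (hx : x ∈ U) :
    DifferentiableAt ℝ f x :=
  (h.contDiffAt hU hx).differentiableAt (by simp)

theorem add (hU : IsOpen U) (hf : SymbolOn U m C η f) (hg : SymbolOn U m C' η g) :
    SymbolOn U m (C + C') η (fun x => f x + g x) := by
  refine ⟨hf.contDiffOn.add hg.contDiffOn, fun k hk x hx => ?_⟩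
  have h1 : ContDiffAt ℝ k f x := (hf.contDiffAt hU hx).of_le (by exact_mod_cast le_top)
  have h2 : ContDiffAt ℝ k g x := (hg.contDiffAt hU hx).of_le (by exact_mod_cast le_top)
  rw [show (fun x => f x + g x) = f + g from rfl, iteratedFDeriv_add_apply h1 h2, add_mul]
  exact (norm_add_le _ _).trans (add_le_add (hf.bound k hk x hx) (hg.bound k hk x hx))

theorem const_smul (hU : IsOpen U) (hf : SymbolOn U m C η f) (c : ℝ) :
    SymbolOn U m (|c| * C) η (fun x => c • f x) := by
  refine ⟨hf.contDiffOn.const_smul c, fun k hk x hx => ?_⟩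
  have h1 : ContDiffAt ℝ k f x := (hf.contDiffAt hU hx).of_le (by exact_mod_cast le_top)
  rw [show (fun x => c • f x) = c • f from rfl, iteratedFDeriv_const_smul_apply h1, norm_smul,
    Real.norm_eq_abs, mul_assoc]
  exact mul_le_mul_of_nonneg_left (hf.bound k hk x hx) (abs_nonneg c)

theorem sub (hU : IsOpen U) (hf : SymbolOn U m C η f) (hg : SymbolOn U m C' η g) :
    SymbolOn U m (C + C') η (fun x => f x - g x) := by
  have := hf.add hU (hg.const_smul hU (-1))
  simpa [sub_eq_add_neg] using this

theorem bilin (hU : IsOpen U) (hη : 0 ≤ η) (hC : 0 ≤ C) (B : F →L[ℝ] G →L[ℝ] H) {g : E → G}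
    (hf : SymbolOn U m C η f) (hg : SymbolOn U m C' η g) :
    SymbolOn U m (‖B‖ * 2 ^ m * C * C') η (fun x => B (f x) (g x)) := by
  refine ⟨(B.isBoundedBilinearMap.contDiff.comp_contDiffOn
    (hf.contDiffOn.prodMk hg.contDiffOn)), fun k hk x hx => ?_⟩
  have hC' : 0 ≤ C' := (norm_nonneg _).trans (hg.norm_le hx)
  have h := B.norm_iteratedFDerivWithin_le_of_bilinear (n := k) hf.contDiffOn hg.contDiffOn
    hU.uniqueDiffOn hx (by exact_mod_cast le_top)
  simp only [iteratedFDerivWithin_of_isOpen _ hU hx] at h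
  refine h.trans ?_
  have : ∑ i ∈ Finset.range (k + 1), (k.choose i : ℝ) * ‖iteratedFDeriv ℝ i f x‖ *
      ‖iteratedFDeriv ℝ (k - i) g x‖ ≤
      ∑ i ∈ Finset.range (k + 1), (k.choose i : ℝ) * (C * C' * η ^ k) := by
    refine Finset.sum_le_sum fun i hi => ?_
    have hi' : i ≤ k := Nat.lt_succ_iff.1 (Finset.mem_range.1 hi)
    have e : C * C' * η ^ k = (C * η ^ i) * (C' * η ^ (k - i)) := by
      rw [← Nat.add_sub_cancel' hi', pow_add]; simp; ring
    rw [e, mul_assoc]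
    have b1 := hf.bound i (hi'.trans hk) x hx
    have b2 := hg.bound (k - i) ((Nat.sub_le _ _).trans hk) x hx
    gcongr
  rw [← Finset.sum_mul] at this
  have h2 : ∑ i ∈ Finset.range (k + 1), (k.choose i : ℝ) = 2 ^ k := by
    exact_mod_cast Nat.sum_range_choose k
  rw [h2] at this
  calc _ ≤ ‖B‖ * (2 ^ k * (C * C' * η ^ k)) := by gcongr
    _ ≤ ‖B‖ * (2 ^ m * (C * C' * η ^ k)) := by gcongr; norm_num
    _ = _ := by ring

theorem smul (hU : IsOpen U) (hη : 0 ≤ η) (hC : 0 ≤ C) {a : E → ℝ}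
    (ha : SymbolOn U m C η a) (hf : SymbolOn U m C' η f) :
    SymbolOn U m (2 ^ m * C * C') η (fun x => a x • f x) := by
  have h := bilin hU hη hC (ContinuousLinearMap.lsmul ℝ ℝ : ℝ →L[ℝ] F →L[ℝ] F) ha hf
  refine ⟨h.contDiffOn, fun k hk x hx => (h.bound k hk x hx).trans ?_⟩
  have hC' : 0 ≤ C' := (norm_nonneg _).trans (hf.norm_le hx)
  have : ‖(ContinuousLinearMap.lsmul ℝ ℝ : ℝ →L[ℝ] F →L[ℝ] F)‖ ≤ 1 :=
    ContinuousLinearMap.opNorm_lsmul_le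
  gcongr
  exact mul_le_of_le_one_left (by positivity) this

theorem fderiv (hU : IsOpen U) (hf : SymbolOn U (m + 1) C η f) :
    SymbolOn U m (C * η) η (fderiv ℝ f) := by
  refine ⟨hf.contDiffOn.fderiv_of_isOpen hU (by simp), fun k hk x hx => ?_⟩
  rw [norm_iteratedFDeriv_fderiv]
  have := hf.bound (k + 1) (by omega) x hx
  rw [pow_succ'] at this
  linarith

/-- Composition with a smooth map which has bounded derivatives on the range. -/
theorem comp (hU : IsOpen U) {V : Set F} (hV : IsOpen V) {Φ : F → G} (hΦ : ContDiffOn ℝ ∞ Φ V)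
    (hf : SymbolOn U m C η f) (hη : 0 ≤ η) (hfV : MapsTo f U V) {B : ℝ}
    (hB : ∀ k ≤ m, ∀ x ∈ U, ‖iteratedFDeriv ℝ k Φ (f x)‖ ≤ B) :
    SymbolOn U m (m.factorial * B * (max C 1) ^ m) η (fun x => Φ (f x)) := by
  refine ⟨hΦ.comp hf.contDiffOn hfV, fun k hk x hx => ?_⟩
  have hB0 : 0 ≤ B := (norm_nonneg _).trans (hB 0 (Nat.zero_le _) x hx)
  have h := norm_iteratedFDerivWithin_comp_le (n := k) (C := B) (D := max C 1 * η)
    hΦ hf.contDiffOn (by exact_mod_cast le_top) hV.uniqueDiffOn hU.uniqueDiffOn hfV hx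
    (fun i hi => by
      rw [iteratedFDerivWithin_of_isOpen _ hV (hfV hx)]
      exact hB i (hi.trans hk) x hx)
    (fun i hi hik => by
      rw [iteratedFDerivWithin_of_isOpen _ hU hx, mul_pow]
      refine (hf.bound i (hik.trans hk) x hx).trans ?_
      gcongr
      calc C ≤ max C 1 := le_max_left _ _
        _ ≤ (max C 1) ^ i := le_self_pow₀ (le_max_right _ _) (by omega))
  rw [iteratedFDerivWithin_of_isOpen _ hU hx] at h
  refine h.trans ?_
  rw [mul_pow, ← mul_assoc]
  gcongr
  exact le_max_right _ _

end SymbolOn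

/-- A smooth function of symbols with values in a fixed compact set is a symbol, with a constant
that depends on the compact set only. -/
theorem SymbolOn.exists_comp {V K : Set F} (hV : IsOpen V) (hK : IsCompact K) (hKV : K ⊆ V)
    {Φ : F → G} (hΦ : ContDiffOn ℝ ∞ Φ V) (m : ℕ) (C : ℝ) :
    ∃ C' : ℝ, 1 ≤ C' ∧ ∀ (U : Set E) (η : ℝ) (f : E → F), IsOpen U → 0 ≤ η →
      SymbolOn U m C η f → MapsTo f U K → SymbolOn U m C' η (fun x => Φ (f x)) := by
  have hb : ∀ k : ℕ, ∃ B : ℝ, ∀ y ∈ K, ‖iteratedFDeriv ℝ k Φ y‖ ≤ B := by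
    intro k
    have hc : ContinuousOn (iteratedFDeriv ℝ k Φ) V :=
      (hΦ.continuousOn_iteratedFDerivWithin (m := k) (by exact_mod_cast le_top)
        hV.uniqueDiffOn).congr fun y hy => (iteratedFDerivWithin_of_isOpen k hV hy).symm
    exact hK.exists_bound_of_continuousOn (hc.mono hKV)
  choose B hB using hb
  set B' := ∑ k ∈ Finset.range (m + 1), |B k|
  refine ⟨max 1 (m.factorial * B' * (max C 1) ^ m), le_max_left _ _,
    fun U η f hU hη hf hfK => ?_⟩
  refine (SymbolOn.comp hU hV hΦ hf hη (fun x hx => hKV (hfK hx)) (B := B') ?_).mono_const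
    (le_max_right _ _) hη
  intro k hk x hx
  refine (hB k (f x) (hfK hx)).trans ((le_abs_self _).trans ?_)
  exact Finset.single_le_sum (f := fun k => |B k|) (fun i _ => abs_nonneg _)
    (Finset.mem_range.2 (by omega))

theorem norm_iteratedFDeriv_sin_le (k : ℕ) (t : ℝ) : ‖iteratedFDeriv ℝ k Real.sin t‖ ≤ 1 := by
  rw [norm_iteratedFDeriv_eq_norm_iteratedDeriv]
  exact Real.abs_iteratedDeriv_sin_le_one k t

theorem symbolOn_sin (U : Set E) (m : ℕ) (ℓ : E →L[ℝ] ℝ) {η : ℝ} (hη : 0 ≤ η) :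
    SymbolOn U m (m.factorial * (max ‖ℓ‖ 1) ^ m) η (fun x => Real.sin (η * ℓ x)) := by
  refine ⟨(Real.contDiff_sin.comp (contDiff_const.mul ℓ.contDiff)).contDiffOn,
    fun k hk x hx => ?_⟩
  have h := norm_iteratedFDeriv_comp_le (n := k) (x := x) (C := 1) (D := max ‖ℓ‖ 1 * η)
    (Real.contDiff_sin (n := ∞)) (ℓ.contDiff.const_smul η : ContDiff ℝ ∞ fun x => η • ℓ x)
    (by exact_mod_cast le_top) (fun i _ => norm_iteratedFDeriv_sin_le i _) (fun i hi _ => by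
      have e : (fun x => η • ℓ x) = ⇑(η • ℓ) := by ext; simp
      rw [e]
      obtain rfl | hi2 := hi.eq_or_lt
      · rw [norm_iteratedFDeriv_one, ContinuousLinearMap.fderiv, norm_smul, Real.norm_eq_abs,
          abs_of_nonneg hη, pow_one, mul_comm]
        gcongr
        exact le_max_left _ _
      · obtain ⟨j, rfl⟩ : ∃ j, i = j + 1 := ⟨i - 1, by omega⟩
        rw [← norm_iteratedFDeriv_fderiv]
        have : _root_.fderiv ℝ (⇑(η • ℓ)) = fun _ => η • ℓ := by
          ext1 y; exact ContinuousLinearMap.fderiv _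
        rw [this, iteratedFDeriv_const_of_ne (by omega)]
        simp only [Pi.zero_apply, norm_zero]
        positivity)
  refine (le_of_eq ?_).trans (h.trans ?_)
  · rfl
  rw [mul_pow, mul_one, ← mul_assoc]
  gcongr
  exact le_max_right _ _

end Symbols

/-! ### Mollification -/

section Mollify

open MeasureTheory Metric

section Convolution

variable {E : Type} [NormedAddCommGroup E] [InnerProductSpace ℝ E] [FiniteDimensional ℝ E]
  [MeasurableSpace E] [BorelSpace E]

/-- The derivatives of a convolution with a fixed smooth kernel supported in the unit ball are
controlled by the size of the function on unit balls. -/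
theorem exists_norm_iteratedFDeriv_convolution_le {F : Type} [NormedAddCommGroup F]
    [NormedSpace ℝ F] (k : ℕ) :
    ∀ {W G : Type} [NormedAddCommGroup W] [NormedSpace ℝ W] [NormedAddCommGroup G]
      [NormedSpace ℝ G] (L : W →L[ℝ] F →L[ℝ] G) (ψ : E → W), ContDiff ℝ ∞ ψ →
      tsupport ψ ⊆ closedBall 0 1 → ∃ C : ℝ, 0 ≤ C ∧ ∀ (f : E → F) (x : E) (A : ℝ),
        Continuous f → (∀ y ∈ closedBall x 1, ‖f y‖ ≤ A) →
        ‖iteratedFDeriv ℝ k (convolution ψ f L volume) x‖ ≤ C * A := by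
  induction k with
  | zero =>
    intro W G _ _ _ _ L ψ hψ hsupp
    have hcs : HasCompactSupport ψ :=
      HasCompactSupport.of_support_subset_isCompact (isCompact_closedBall 0 1)
        ((subset_tsupport ψ).trans hsupp)
    have hint : Integrable (fun t => ‖ψ t‖) :=
      (hψ.continuous.norm).integrable_of_hasCompactSupport hcs.norm
    refine ⟨‖L‖ * ∫ t, ‖ψ t‖, by positivity, fun f x A hf hA => ?_⟩
    rw [norm_iteratedFDeriv_zero, convolution]
    have h := norm_integral_le_of_norm_le (f := fun t => L (ψ t) (f (x - t)))
      ((hint.const_mul ‖L‖).mul_const A) (Filter.Eventually.of_forall fun t => by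
        by_cases ht : ψ t = 0
        · simp [ht]
        · have h1 : t ∈ closedBall (0 : E) 1 := hsupp (subset_tsupport ψ ht)
          have h2 : ‖f (x - t)‖ ≤ A := hA _ (by
            simpa [dist_eq_norm] using h1)
          exact (L.le_opNorm₂ _ _).trans (by gcongr))
    rw [integral_mul_const, integral_const_mul] at h
    exact h
  | succ k ih =>
    intro W G _ _ _ _ L ψ hψ hsupp
    have hcs : HasCompactSupport ψ :=
      HasCompactSupport.of_support_subset_isCompact (isCompact_closedBall 0 1)
        ((subset_tsupport ψ).trans hsupp)
    obtain ⟨C, hC, h⟩ := ih (L.precompL E) (fderiv ℝ ψ) (hψ.fderiv_right (by simp))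
      ((tsupport_fderiv_subset ℝ).trans hsupp)
    refine ⟨C, hC, fun f x A hf hA => ?_⟩
    rw [← norm_iteratedFDeriv_fderiv]
    have e : fderiv ℝ (convolution ψ f L volume) =
        convolution (fderiv ℝ ψ) f (L.precompL E) volume := by
      ext1 z
      exact (hcs.hasFDerivAt_convolution_left L (hψ.of_le (by simp))
        hf.locallyIntegrable z).fderiv
    rw [e]
    exact h f x A hf hA

end Convolution

variable {E : Type} [NormedAddCommGroup E] [InnerProductSpace ℝ E] [FiniteDimensional ℝ E]
  [MeasurableSpace E] [BorelSpace E]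

variable (E) in
/-- The bump function, supported in the unit ball, that serves as mollification kernel. -/
noncomputable def mollifierBump : ContDiffBump (0 : E) := ⟨1 / 2, 1, by norm_num, by norm_num⟩

variable (E) in
/-- The mollification kernel: a smooth probability density supported in the unit ball. -/
noncomputable def mollifier : E → ℝ := (mollifierBump E).normed volume

theorem contDiff_mollifier : ContDiff ℝ ∞ (mollifier E) := (mollifierBump E).contDiff_normed

theorem mollifier_nonneg (x : E) : 0 ≤ mollifier E x := (mollifierBump E).nonneg_normed x

theorem tsupport_mollifier : tsupport (mollifier E) ⊆ closedBall 0 1 := by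
  rw [mollifier, ContDiffBump.tsupport_normed_eq]; rfl

theorem norm_le_of_mollifier_ne_zero {y : E} (h : mollifier E y ≠ 0) : ‖y‖ ≤ 1 := by
  simpa using tsupport_mollifier (subset_tsupport _ h)

theorem hasCompactSupport_mollifier : HasCompactSupport (mollifier E) :=
  (mollifierBump E).hasCompactSupport_normed

theorem integral_mollifier : ∫ x, mollifier E x = 1 := (mollifierBump E).integral_normed

theorem integrable_mollifier : Integrable (mollifier E) := (mollifierBump E).integrable_normed

variable {F G : Type} [NormedAddCommGroup F] [NormedSpace ℝ F]
  [NormedAddCommGroup G] [NormedSpace ℝ G]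

/-- The mollification of `f` at length scale `ℓ`. -/
noncomputable def mollify (ℓ : ℝ) (f : E → F) (x : E) : F :=
  ∫ y, mollifier E y • f (x - ℓ • y)

variable {ℓ : ℝ} {f g : E → F}

theorem integrable_mollifier_smul (hf : Continuous f) (x : E) :
    Integrable fun y => mollifier E y • f (x - ℓ • y) := by
  apply Continuous.integrable_of_hasCompactSupport
  · exact contDiff_mollifier.continuous.smul (hf.comp (by fun_prop))
  · exact hasCompactSupport_mollifier.smul_right

theorem mollify_sub (hf : Continuous f) (hg : Continuous g) (x : E) :
    mollify ℓ (fun y => f y - g y) x = mollify ℓ f x - mollify ℓ g x := by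
  simp only [mollify, smul_sub]
  exact integral_sub (integrable_mollifier_smul hf x) (integrable_mollifier_smul hg x)

theorem mollify_add (hf : Continuous f) (hg : Continuous g) (x : E) :
    mollify ℓ (fun y => f y + g y) x = mollify ℓ f x + mollify ℓ g x := by
  simp only [mollify, smul_add]
  exact integral_add (integrable_mollifier_smul hf x) (integrable_mollifier_smul hg x)

theorem mollify_const [CompleteSpace F] (c : F) (x : E) :
    mollify ℓ (fun _ => c) x = c := by
  simp [mollify, integral_smul_const, integral_mollifier]

theorem mollify_clm [CompleteSpace F] [CompleteSpace G] (L : F →L[ℝ] G) (hf : Continuous f)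
    (x : E) : mollify ℓ (fun y => L (f y)) x = L (mollify ℓ f x) := by
  simp only [mollify]
  rw [← L.integral_comp_comm (integrable_mollifier_smul hf x)]
  simp

theorem norm_mollify_le (hℓ : 0 ≤ ℓ) {x : E} {A : ℝ} (hA : ∀ y ∈ closedBall x ℓ, ‖f y‖ ≤ A) :
    ‖mollify ℓ f x‖ ≤ A := by
  have h := norm_integral_le_of_norm_le (f := fun y => mollifier E y • f (x - ℓ • y))
    (integrable_mollifier.mul_const A) (Filter.Eventually.of_forall fun y => by
      by_cases hy : mollifier E y = 0
      · simp [hy]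
      · rw [norm_smul, Real.norm_of_nonneg (mollifier_nonneg y)]
        refine mul_le_mul_of_nonneg_left (hA _ ?_) (mollifier_nonneg y)
        have := norm_le_of_mollifier_ne_zero hy
        simp only [mem_closedBall, dist_eq_norm, sub_sub_cancel_left, norm_neg, norm_smul,
          Real.norm_of_nonneg hℓ]
        exact mul_le_of_le_one_right hℓ this)
  rwa [integral_mul_const, integral_mollifier, one_mul] at h

theorem norm_mollify_sub_le [CompleteSpace F] (hℓ : 0 ≤ ℓ) (hf : Continuous f) {x : E} {A : ℝ}
    {c : F} (hA : ∀ y ∈ closedBall x ℓ, ‖f y - c‖ ≤ A) : ‖mollify ℓ f x - c‖ ≤ A := by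
  have := mollify_sub (ℓ := ℓ) hf (continuous_const (y := c)) x
  rw [mollify_const] at this
  rw [← this]
  exact norm_mollify_le hℓ hA

theorem mollify_eq_convolution (hℓ : ℓ ≠ 0) :
    mollify ℓ f = fun x => convolution (mollifier E) (fun y => f (ℓ • y))
      (ContinuousLinearMap.lsmul ℝ ℝ) volume (ℓ⁻¹ • x) := by
  ext1 x
  simp [mollify, convolution, smul_sub, smul_smul, hℓ]

theorem contDiff_mollify (hℓ : ℓ ≠ 0) (hf : Continuous f) : ContDiff ℝ ∞ (mollify ℓ f) := by
  rw [mollify_eq_convolution hℓ]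
  have h : ContDiff ℝ ((⊤ : ℕ∞) : ℕ∞ω) (convolution (mollifier E) (fun y => f (ℓ • y))
      (ContinuousLinearMap.lsmul ℝ ℝ) volume) :=
    hasCompactSupport_mollifier.contDiff_convolution_left _ contDiff_mollifier
      (hf.comp (by fun_prop)).locallyIntegrable
  exact h.comp (contDiff_const_smul _)

variable (E F) in
theorem exists_norm_iteratedFDeriv_mollify_le (k : ℕ) :
    ∃ C : ℝ, 1 ≤ C ∧ ∀ (ℓ : ℝ) (f : E → F) (x : E) (A : ℝ), 0 < ℓ → Continuous f →
      (∀ y ∈ closedBall x ℓ, ‖f y‖ ≤ A) →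
      ‖iteratedFDeriv ℝ k (mollify ℓ f) x‖ ≤ C * A * ℓ⁻¹ ^ k := by
  obtain ⟨C, hC, h⟩ := exists_norm_iteratedFDeriv_convolution_le (F := F) k
    (ContinuousLinearMap.lsmul ℝ ℝ : ℝ →L[ℝ] F →L[ℝ] F) (mollifier E) contDiff_mollifier
    tsupport_mollifier
  refine ⟨max C 1, le_max_right _ _, fun ℓ f x A hℓ hf hA => ?_⟩
  have hA0 : 0 ≤ A := (norm_nonneg _).trans (hA x (mem_closedBall_self hℓ.le))
  have hc : ContDiff ℝ ((⊤ : ℕ∞) : ℕ∞ω) (convolution (mollifier E) (fun y => f (ℓ • y))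
      (ContinuousLinearMap.lsmul ℝ ℝ) volume) :=
    hasCompactSupport_mollifier.contDiff_convolution_left _ contDiff_mollifier
      (hf.comp (by fun_prop)).locallyIntegrable
  rw [mollify_eq_convolution hℓ.ne', iteratedFDeriv_comp_const_smul (i := k) ℓ⁻¹
    (hc.of_le (by exact_mod_cast le_top))]
  have h2 := h (fun y => f (ℓ • y)) (ℓ⁻¹ • x) A (hf.comp (by fun_prop)) (fun y hy => hA _ (by
    rw [mem_closedBall, dist_eq_norm] at hy ⊢
    have : ℓ • y - x = ℓ • (y - ℓ⁻¹ • x) := by simp [smul_sub, smul_smul, hℓ.ne']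
    rw [this, norm_smul, Real.norm_of_nonneg hℓ.le]
    exact mul_le_of_le_one_right hℓ.le hy))
  rw [norm_smul, norm_pow, Real.norm_of_nonneg (by positivity), mul_comm]
  gcongr
  exact h2.trans (by gcongr; exact le_max_left _ _)

theorem hasFDerivAt_mollify (hf : ContDiff ℝ 1 f) (x : E) :
    HasFDerivAt (mollify ℓ f) (mollify ℓ (fderiv ℝ f) x) x := by
  have hf' : Continuous (fderiv ℝ f) := hf.continuous_fderiv (by simp)
  obtain ⟨M, hM⟩ := (isCompact_closedBall x (1 + |ℓ|)).exists_bound_of_continuousOn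
    hf'.continuousOn
  refine hasFDerivAt_integral_of_dominated_of_fderiv_le (s := ball x 1)
    (F := fun x y => mollifier E y • f (x - ℓ • y))
    (F' := fun x y => mollifier E y • fderiv ℝ f (x - ℓ • y))
    (bound := fun y => mollifier E y * M) (ball_mem_nhds x one_pos) ?_ ?_ ?_ ?_ ?_ ?_
  · exact Filter.Eventually.of_forall fun z =>
      (integrable_mollifier_smul hf.continuous z).aestronglyMeasurable
  · exact integrable_mollifier_smul hf.continuous x
  · exact (integrable_mollifier_smul hf' x).aestronglyMeasurable
  · refine Filter.Eventually.of_forall fun y z hz => ?_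
    by_cases hy : mollifier E y = 0
    · simp [hy]
    · rw [norm_smul, Real.norm_of_nonneg (mollifier_nonneg y)]
      refine mul_le_mul_of_nonneg_left (hM _ ?_) (mollifier_nonneg y)
      have h1 := norm_le_of_mollifier_ne_zero hy
      rw [mem_ball, dist_eq_norm] at hz
      rw [mem_closedBall, dist_eq_norm]
      have : z - ℓ • y - x = (z - x) - ℓ • y := by abel
      rw [this]
      refine (norm_sub_le _ _).trans (add_le_add hz.le ?_)
      rw [norm_smul]
      exact mul_le_of_le_one_right (abs_nonneg _) h1
  · exact integrable_mollifier.mul_const M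
  · refine Filter.Eventually.of_forall fun y z _ => ?_
    have h1 : HasFDerivAt f (fderiv ℝ f (z - ℓ • y)) (z - ℓ • y) :=
      (hf.differentiable (by simp) _).hasFDerivAt
    have h2 : HasFDerivAt (fun z => z - ℓ • y) (ContinuousLinearMap.id ℝ E) z :=
      (hasFDerivAt_id z).sub_const _
    have h3 := (h1.comp z h2).const_smul (mollifier E y)
    rw [ContinuousLinearMap.comp_id] at h3
    exact h3

theorem fderiv_mollify (hf : ContDiff ℝ 1 f) :
    fderiv ℝ (mollify ℓ f) = mollify ℓ (fderiv ℝ f) :=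
  funext fun x => (hasFDerivAt_mollify hf x).fderiv

end Mollify

/-! ### Decomposition of metrics into primitive metrics -/

section Primitive

open Matrix

theorem Matrix.PosDef.exists_isUnit_eq_mul_transpose {n : ℕ} {A : Matrix (Fin n) (Fin n) ℝ}
    (hA : A.PosDef) : ∃ B : Matrix (Fin n) (Fin n) ℝ, IsUnit B ∧ A = B * Bᵀ := by
  open scoped MatrixOrder Matrix.Norms.L2Operator in
  obtain ⟨b, hb, h⟩ := CStarAlgebra.isStrictlyPositive_iff_eq_mul_star_self.mp
    hA.isStrictlyPositive
  exact ⟨b, hb, h⟩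

/-- The pairs `i ≤ j`, which number the primitive metrics of the standard decomposition. -/
abbrev UpperPairs (n : ℕ) : Type := {p : Fin n × Fin n // p.1 ≤ p.2}

theorem card_upperPairs (n : ℕ) : Fintype.card (UpperPairs n) = n * (n + 1) / 2 := by
  rw [← Fintype.card_congr (Sym2.sortEquiv (α := Fin n)), Sym2.card, Fintype.card_fin,
    Nat.choose_two_right, Nat.add_sub_cancel, mul_comm]

/-- The directions `e_i` and `e_i + e_j`, `i < j`. -/
def stdDirection {n : ℕ} (p : UpperPairs n) : Fin n → ℝ :=
  if p.1.1 = p.1.2 then Pi.single p.1.1 1 else Pi.single p.1.1 1 + Pi.single p.1.2 1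

/-- The coefficients of a symmetric matrix with respect to the primitive metrics given by
`stdDirection`. -/
noncomputable def stdCoeff {n : ℕ} (p : UpperPairs n) : Matrix (Fin n) (Fin n) ℝ →ₗ[ℝ] ℝ :=
  if p.1.1 = p.1.2 then
    2 • Matrix.entryLinearMap ℝ ℝ p.1.1 p.1.1 - ∑ k, Matrix.entryLinearMap ℝ ℝ p.1.1 k
  else Matrix.entryLinearMap ℝ ℝ p.1.1 p.1.2

/-- The entries of the decomposition of a symmetric matrix `H` along `e_x ⊗ e_x` and `(e_x + e_y)
⊗ (e_x + e_y)`, `x < y`. The coefficient of `e_x ⊗ e_x` is `H x x` minus the off-diagonal part of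
the row `x`, which compensates for the diagonal terms of the mixed directions. -/
theorem apply_eq_sum_upper {n : ℕ} (H : Matrix (Fin n) (Fin n) ℝ) (hH : H.IsSymm) (a b : Fin n) :
    H a b = ∑ x, ∑ y, if x ≤ y then (if x = y then (2 * H x x - ∑ k, H x k) *
          ((if a = x then 1 else 0) * (if b = x then 1 else 0))
        else H x y * (((if a = x then 1 else 0) + (if a = y then 1 else 0)) *
          ((if b = x then 1 else 0) + (if b = y then 1 else 0)))) else 0 := by
  have e : ∀ x y, (if x ≤ y then (if x = y then (2 * H x x - ∑ k, H x k) *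
          ((if a = x then 1 else 0) * (if b = x then 1 else 0))
        else H x y * (((if a = x then 1 else 0) + (if a = y then 1 else 0)) *
          ((if b = x then 1 else 0) + (if b = y then 1 else 0)))) else 0) =
      (if y = x then (if a = x then (if b = x then (2 * H x x - ∑ k, H x k) else 0) else 0) else 0)
      + (if a = x then (if b = x then (if x < y then H x y else 0) else 0) else 0)
      + (if a = x then (if b = y then (if x < y then H x y else 0) else 0) else 0)
      + (if a = y then (if b = x then (if x < y then H x y else 0) else 0) else 0)
      + (if a = y then (if b = y then (if x < y then H x y else 0) else 0) else 0) := by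
    intro x y
    rcases lt_trichotomy x y with h | h | h
    · simp only [h.le, h.ne, h.ne', h, if_true, if_false]
      split_ifs <;> ring
    · subst h
      simp only [le_refl, lt_irrefl, if_true, if_false, ite_self, add_zero]
      split_ifs <;> simp
    · simp [not_le.2 h, h.ne, not_lt.2 h.le]
  simp only [e, Finset.sum_add_distrib]
  have sw : ∀ f : Fin n → Fin n → ℝ, ∑ x, ∑ y, (if a = y then f x y else 0) = ∑ x, f x a := by
    intro f; simp
  rw [sw, sw]
  have e2 : ∑ x, ∑ y, (if a = x then if b = x then if x < y then H x y else 0 else 0 else 0) =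
    if a = b then ∑ y, if a < y then H a y else 0 else 0 := by
    rw [Finset.sum_comm]
    simp only [Finset.sum_ite_eq, Finset.mem_univ, if_true]
    by_cases h : a = b
    · simp [h]
    · simp [h, Ne.symm h]
  have e3 : ∑ x, ∑ y, (if a = x then if b = y then if x < y then H x y else 0 else 0 else 0) =
    if a < b then H a b else 0 := by
    rw [Finset.sum_comm]
    simp only [Finset.sum_ite_eq, Finset.mem_univ, if_true]
  rw [e2, e3]
  simp only [Finset.sum_ite_eq, Finset.sum_ite_eq', Finset.mem_univ, if_true]
  by_cases h : a = b
  · subst h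
    simp only [if_true, lt_irrefl, if_false]
    have : ∑ k, H a k = (∑ y, if a < y then H a y else 0) +
        (∑ x, if x < a then H x a else 0) + H a a := by
      rw [← Finset.sum_add_distrib]
      have : H a a = ∑ k, if a = k then H a k else 0 := by simp
      conv_rhs => rw [this]
      rw [← Finset.sum_add_distrib]
      refine Finset.sum_congr rfl fun k _ => ?_
      rcases lt_trichotomy a k with h | h | h
      · simp [h, not_lt.2 h.le, h.ne]
      · subst h; simp
      · simp [h, not_lt.2 h.le, h.ne', hH.apply k a]
    rw [this]; ring
  · have : ∀ x y : ℝ, x + (if a = b then y else 0) = x := by intros; simp [h]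
    simp only [h, Ne.symm h, if_false, zero_add, add_zero, Finset.sum_const_zero]
    rcases lt_or_gt_of_ne h with h | h
    · simp [h, not_lt.2 h.le]
    · simp [h, not_lt.2 h.le, hH.apply b a]

theorem sum_stdCoeff_smul {n : ℕ} (H : Matrix (Fin n) (Fin n) ℝ) (hH : H.IsSymm) :
    H = ∑ p, stdCoeff p H • vecMulVec (stdDirection p) (stdDirection p) := by
  ext a b
  rw [Matrix.sum_apply]
  obtain ⟨f, hf⟩ : ∃ f : Fin n → Fin n → ℝ, ∀ x y, f x y =
      if x = y then (2 * H x x - ∑ k, H x k) *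
          ((if a = x then 1 else 0) * (if b = x then 1 else 0))
        else H x y * (((if a = x then 1 else 0) + (if a = y then 1 else 0)) *
          ((if b = x then 1 else 0) + (if b = y then 1 else 0))) :=
    ⟨_, fun _ _ => rfl⟩
  have h1 : ∀ p : UpperPairs n,
      (stdCoeff p H • vecMulVec (stdDirection p) (stdDirection p)) a b =
      Function.uncurry f p.1 := by
    rintro ⟨⟨x, y⟩, hxy⟩
    rw [Function.uncurry_apply_pair, hf]
    by_cases h : x = y <;>
      simp [stdCoeff, stdDirection, h, vecMulVec_apply, Pi.single_apply]
  rw [Finset.sum_congr rfl fun p _ => h1 p,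
    ← Finset.sum_subtype (Finset.univ.filter fun q : Fin n × Fin n => q.1 ≤ q.2) (by simp)
      (Function.uncurry f),
    Finset.sum_filter, Fintype.sum_prod_type]
  simp only [Function.uncurry_apply_pair, hf]
  exact apply_eq_sum_upper H hH a b

/-- A positive definite matrix has a neighbourhood of symmetric matrices that are combinations of
`n * (n + 1) / 2` fixed primitive metrics with positive coefficients: the coefficients `L i` are
linear, and positive at `g₀`. -/
theorem exists_primitive_decomposition {n : ℕ} {g₀ : Matrix (Fin n) (Fin n) ℝ}
    (hg₀ : g₀.PosDef) :
    ∃ (ν : Fin (n * (n + 1) / 2) → Fin n → ℝ)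
      (L : Fin (n * (n + 1) / 2) → Matrix (Fin n) (Fin n) ℝ →ₗ[ℝ] ℝ),
      (∀ i, 0 < L i g₀) ∧ ∀ H : Matrix (Fin n) (Fin n) ℝ, H.IsSymm →
        H = ∑ i, L i H • vecMulVec (ν i) (ν i) := by
  -- All standard coefficients of `S = (n + 1) • 1 + 𝟙 ⊗ 𝟙` are positive: the diagonal ones are
  -- `2 * (n + 2) - (n + 1 + n) = 3`. A congruence carries `g₀` to `S`.
  set S : Matrix (Fin n) (Fin n) ℝ :=
    ((n : ℝ) + 1) • (1 : Matrix (Fin n) (Fin n) ℝ) + vecMulVec 1 1 with hS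
  have hSpos : S.PosDef := by
    refine PosDef.add_posSemidef (PosDef.one.smul (by positivity)) ?_
    simpa using posSemidef_vecMulVec_self_star (1 : Fin n → ℝ)
  have hSc : ∀ p, 0 < stdCoeff p S := by
    intro p
    by_cases h : p.1.1 = p.1.2
    · simp [stdCoeff, h, hS, Matrix.one_apply, Finset.sum_add_distrib]
      linarith
    · simp [stdCoeff, h, hS]
  obtain ⟨b, hb, hgb⟩ := hg₀.exists_isUnit_eq_mul_transpose
  obtain ⟨c, hc, hSc'⟩ := hSpos.exists_isUnit_eq_mul_transpose
  have hb' : IsUnit b.det := (Matrix.isUnit_iff_isUnit_det b).1 hb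
  have hc' : IsUnit c.det := (Matrix.isUnit_iff_isUnit_det c).1 hc
  obtain ⟨M, hM⟩ : ∃ M, M = b * c⁻¹ := ⟨_, rfl⟩
  obtain ⟨W, hW⟩ : ∃ W, W = c * b⁻¹ := ⟨_, rfl⟩
  have hMW : M * W = 1 := by
    rw [hM, hW]
    rw [Matrix.mul_assoc, ← Matrix.mul_assoc c⁻¹, Matrix.nonsing_inv_mul _ hc', Matrix.one_mul,
      Matrix.mul_nonsing_inv _ hb']
  have hWg : W * g₀ * Wᵀ = S := by
    have e1 : W * b = c := by
      rw [hW]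
      rw [Matrix.mul_assoc, Matrix.nonsing_inv_mul _ hb', Matrix.mul_one]
    calc W * g₀ * Wᵀ = (W * b) * (W * b)ᵀ := by
          rw [hgb, Matrix.transpose_mul]; simp only [Matrix.mul_assoc]
      _ = S := by rw [e1, ← hSc']
  let e : UpperPairs n ≃ Fin (n * (n + 1) / 2) := Fintype.equivFinOfCardEq (card_upperPairs n)
  let T : Matrix (Fin n) (Fin n) ℝ →ₗ[ℝ] Matrix (Fin n) (Fin n) ℝ :=
    (LinearMap.mulRight ℝ Wᵀ).comp (LinearMap.mulLeft ℝ W)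
  have hT : ∀ H, T H = W * H * Wᵀ := fun H => rfl
  refine ⟨fun i => M *ᵥ stdDirection (e.symm i), fun i => (stdCoeff (e.symm i)).comp T,
    fun i => ?_, fun H hH => ?_⟩
  · rw [LinearMap.comp_apply, hT, hWg]
    exact hSc _
  · have hs : (T H).IsSymm := by
      rw [hT, Matrix.IsSymm, Matrix.transpose_mul, Matrix.transpose_mul, Matrix.transpose_transpose,
        hH.eq, Matrix.mul_assoc]
    have h1 : M * T H * Mᵀ = H := by
      have h2 : Wᵀ * Mᵀ = 1 := by rw [← Matrix.transpose_mul, hMW, Matrix.transpose_one]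
      rw [hT]
      calc M * (W * H * Wᵀ) * Mᵀ = (M * W) * H * (Wᵀ * Mᵀ) := by
            simp only [Matrix.mul_assoc]
        _ = H := by rw [hMW, h2, Matrix.one_mul, Matrix.mul_one]
    conv_lhs => rw [← h1, sum_stdCoeff_smul _ hs]
    rw [Matrix.mul_sum, Matrix.sum_mul, ← e.symm.sum_comp]
    refine Finset.sum_congr rfl fun i _ => ?_
    rw [Matrix.mul_smul, Matrix.smul_mul, LinearMap.comp_apply]
    congr 1
    rw [Matrix.mul_vecMulVec, Matrix.vecMulVec_mul, Matrix.vecMul_transpose]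

end Primitive

/-! ### Gram matrices and normal fields of immersions -/

section Gram

open Matrix

variable {n m : ℕ}

local notation "𝔼" => EuclideanSpace ℝ (Fin n)

theorem frobenius_norm_le_of_entries {A : Matrix (Fin n) (Fin n) ℝ} {c : ℝ}
    (h : ∀ i j, |A i j| ≤ c) : ‖A‖ ≤ n * c := by
  rcases Nat.eq_zero_or_pos n with rfl | hn
  · have : A = 0 := Subsingleton.elim _ _
    simp [this]
  have hc : 0 ≤ c := (abs_nonneg _).trans (h ⟨0, hn⟩ ⟨0, hn⟩)
  rw [Matrix.frobenius_norm_def, ← Real.sqrt_eq_rpow]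
  apply Real.sqrt_le_iff.2 ⟨by positivity, ?_⟩
  calc ∑ i, ∑ j, ‖A i j‖ ^ (2 : ℝ) ≤ ∑ _i : Fin n, ∑ _j : Fin n, c ^ 2 := by
        gcongr with i _ j _
        rw [Real.rpow_two]
        have := h i j
        rw [Real.norm_eq_abs]
        gcongr
    _ = (n * c) ^ 2 := by simp; ring

theorem abs_entry_le_frobenius_norm (A : Matrix (Fin n) (Fin n) ℝ) (i j : Fin n) :
    |A i j| ≤ ‖A‖ := by
  rw [Matrix.frobenius_norm_def, ← Real.sqrt_eq_rpow]
  apply Real.le_sqrt_of_sq_le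
  rw [← Real.norm_eq_abs, ← Real.rpow_two]
  refine (Finset.single_le_sum (f := fun j => ‖A i j‖ ^ (2 : ℝ)) (fun _ _ => by positivity)
    (Finset.mem_univ j)).trans ?_
  exact Finset.single_le_sum (f := fun i => ∑ j, ‖A i j‖ ^ (2 : ℝ))
    (fun _ _ => Finset.sum_nonneg fun _ _ => by positivity) (Finset.mem_univ i)

/-- The matrix of the inner products of the columns of `P` with the columns of `Q`. -/
noncomputable def colGram (P Q : 𝔼 →L[ℝ] EuclideanSpace ℝ (Fin m)) : Matrix (Fin n) (Fin n) ℝ :=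
  Matrix.of fun i j => inner ℝ (P (EuclideanSpace.single i 1)) (Q (EuclideanSpace.single j 1))

theorem pullbackMetric_eq_gram (u : 𝔼 → EuclideanSpace ℝ (Fin m)) (x : 𝔼) :
    pullbackMetric u x = colGram (fderiv ℝ u x) (fderiv ℝ u x) := rfl

theorem norm_apply_single_le (P : 𝔼 →L[ℝ] EuclideanSpace ℝ (Fin m)) (i : Fin n) :
    ‖P (EuclideanSpace.single i 1)‖ ≤ ‖P‖ := by
  simpa using P.le_opNorm (EuclideanSpace.single i (1 : ℝ))

theorem norm_gram_le (P Q : 𝔼 →L[ℝ] EuclideanSpace ℝ (Fin m)) :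
    ‖colGram P Q‖ ≤ n * (‖P‖ * ‖Q‖) := by
  refine frobenius_norm_le_of_entries fun i j => ?_
  refine (abs_real_inner_le_norm (P (EuclideanSpace.single i 1))
    (Q (EuclideanSpace.single j 1))).trans ?_
  gcongr <;> exact norm_apply_single_le _ _

variable (n m) in
/-- `colGram` as a continuous bilinear map. -/
noncomputable def gramL : (𝔼 →L[ℝ] EuclideanSpace ℝ (Fin m)) →L[ℝ]
    (𝔼 →L[ℝ] EuclideanSpace ℝ (Fin m)) →L[ℝ] Matrix (Fin n) (Fin n) ℝ :=
  (LinearMap.mk₂ ℝ colGram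
    (fun P P' Q => by ext i j; simp [colGram, inner_add_left])
    (fun c P Q => by ext i j; simp [colGram, inner_smul_left])
    (fun P Q Q' => by ext i j; simp [colGram, inner_add_right])
    (fun c P Q => by ext i j; simp [colGram, inner_smul_right])).mkContinuous₂ n
    (fun P Q => by simpa [mul_assoc] using norm_gram_le P Q)

@[simp]
theorem gramL_apply (P Q : 𝔼 →L[ℝ] EuclideanSpace ℝ (Fin m)) : gramL n m P Q = colGram P Q := rfl

theorem gram_transpose (P : 𝔼 →L[ℝ] EuclideanSpace ℝ (Fin m)) : (colGram P P).IsSymm := by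
  ext i j
  simp [colGram, real_inner_comm]

theorem norm_gram_sub_gram_le (P Q : 𝔼 →L[ℝ] EuclideanSpace ℝ (Fin m)) :
    ‖colGram P P - colGram Q Q‖ ≤ n * ((‖P‖ + ‖Q‖) * ‖P - Q‖) := by
  have e : colGram P P - colGram Q Q = gramL n m P (P - Q) + gramL n m (P - Q) Q := by
    simp only [map_sub, gramL_apply, _root_.sub_apply]
    abel
  rw [e]
  refine (norm_add_le _ _).trans ((add_le_add (norm_gram_le _ _) (norm_gram_le _ _)).trans ?_)
  apply le_of_eq; ring

theorem continuous_gram_self :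
    Continuous fun P : 𝔼 →L[ℝ] EuclideanSpace ℝ (Fin m) => colGram P P := by
  simp only [← gramL_apply]
  fun_prop

/-- A linear map is bounded in terms of its Gram matrix; thus bounds on the metric of a map bound
its derivative. -/
theorem norm_le_of_gram (P : 𝔼 →L[ℝ] EuclideanSpace ℝ (Fin m)) :
    ‖P‖ ≤ n * Real.sqrt ‖colGram P P‖ := by
  refine P.opNorm_le_bound (by positivity) fun x => ?_
  have hx : x = ∑ i, x i • EuclideanSpace.single i (1 : ℝ) := by
    ext j; simp [Finset.sum_apply, Pi.single_apply]
  have h1 : ∀ i, ‖P (EuclideanSpace.single i 1)‖ ≤ Real.sqrt ‖colGram P P‖ := fun i => by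
    apply Real.le_sqrt_of_sq_le
    rw [← real_inner_self_eq_norm_sq]
    exact (le_abs_self _).trans (abs_entry_le_frobenius_norm (colGram P P) i i)
  calc ‖P x‖ = ‖∑ i, x i • P (EuclideanSpace.single i 1)‖ := by
        conv_lhs => rw [hx, map_sum]
        simp
    _ ≤ ∑ i, ‖x i • P (EuclideanSpace.single i 1)‖ := norm_sum_le _ _
    _ ≤ ∑ _i : Fin n, ‖x‖ * Real.sqrt ‖colGram P P‖ := by
        gcongr with i
        rw [norm_smul]
        gcongr
        · exact PiLp.norm_apply_le x i
        · exact h1 i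
    _ = _ := by simp; ring

variable (n m) in
/-- The injective linear maps, described by the invertibility of their Gram matrix. -/
def immersions : Set (𝔼 →L[ℝ] EuclideanSpace ℝ (Fin m)) := {P | (colGram P P).det ≠ 0}

theorem isOpen_immersions : IsOpen (immersions n m) := by
  have : Continuous fun P : 𝔼 →L[ℝ] EuclideanSpace ℝ (Fin m) => (colGram P P).det :=
    continuous_gram_self.matrix_det
  exact isOpen_ne.preimage this

theorem injective_of_mem_immersions {P : 𝔼 →L[ℝ] EuclideanSpace ℝ (Fin m)}
    (hP : P ∈ immersions n m) : Function.Injective P := by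
  rw [injective_iff_map_eq_zero]
  intro x hx
  have h : colGram P P *ᵥ (x : Fin n → ℝ) = 0 := by
    ext i
    have hx' : P x = ∑ j, x j • P (EuclideanSpace.single j 1) := by
      have hx0 : x = ∑ i, x i • EuclideanSpace.single i (1 : ℝ) := by
        ext j; simp [Finset.sum_apply, Pi.single_apply]
      conv_lhs => rw [hx0, map_sum]
      simp
    have : (colGram P P *ᵥ (x : Fin n → ℝ)) i = inner ℝ (P (EuclideanSpace.single i 1)) (P x) := by
      rw [hx', inner_sum]
      simp [mulVec, dotProduct, colGram, inner_smul_right, mul_comm]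
    rw [this, hx]; simp
  have := Matrix.eq_zero_of_mulVec_eq_zero hP h
  ext i; exact congrFun this i

/-- The linear maps whose Gram matrix is at distance at most `ρ` from `g₀` form a compact set. -/
theorem isCompact_gram_le (g₀ : Matrix (Fin n) (Fin n) ℝ) (ρ : ℝ) :
    IsCompact {P : 𝔼 →L[ℝ] EuclideanSpace ℝ (Fin m) | ‖colGram P P - g₀‖ ≤ ρ} := by
  have hb : Bornology.IsBounded
      {P : 𝔼 →L[ℝ] EuclideanSpace ℝ (Fin m) | ‖colGram P P - g₀‖ ≤ ρ} := by
    refine (Metric.isBounded_closedBall (x := 0) (r := n * Real.sqrt (‖g₀‖ + ρ))).subset ?_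
    intro P hP
    rw [mem_closedBall_zero_iff]
    refine (norm_le_of_gram P).trans ?_
    gcongr
    have h1 : ‖colGram P P‖ ≤ ‖colGram P P - g₀‖ + ‖g₀‖ := by
      simpa using norm_add_le (colGram P P - g₀) g₀
    have h2 : ‖colGram P P - g₀‖ ≤ ρ := hP
    linarith
  refine Metric.isCompact_of_isClosed_isBounded ?_ hb
  exact isClosed_le ((continuous_gram_self.sub continuous_const).norm) continuous_const

theorem exists_det_ne_zero_of_norm_sub_le {g₀ : Matrix (Fin n) (Fin n) ℝ} (hg₀ : g₀.PosDef) :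
    ∃ ρ : ℝ, 0 < ρ ∧ ∀ A : Matrix (Fin n) (Fin n) ℝ, ‖A - g₀‖ ≤ ρ → A.det ≠ 0 := by
  have hc : Continuous fun A : Matrix (Fin n) (Fin n) ℝ => A.det := continuous_id.matrix_det
  have ho : IsOpen {A : Matrix (Fin n) (Fin n) ℝ | A.det ≠ 0} := isOpen_ne.preimage hc
  obtain ⟨ε, hε, h⟩ := Metric.isOpen_iff.1 ho g₀ hg₀.det_pos.ne'
  refine ⟨ε / 2, by positivity, fun A hA => h ?_⟩
  rw [Metric.mem_ball, dist_eq_norm]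
  linarith

/-- The generalised cross product of the columns of `P`: its inner product with `w` is the
determinant of the matrix with columns `w, P e₁, …, P eₙ`. -/
noncomputable def crossNormal (P : 𝔼 →L[ℝ] EuclideanSpace ℝ (Fin (n + 1))) :
    EuclideanSpace ℝ (Fin (n + 1)) :=
  WithLp.toLp 2 fun i => (-1) ^ (i : ℕ) *
    (Matrix.of fun a b : Fin n => P (EuclideanSpace.single b 1) (i.succAbove a)).det

theorem inner_crossNormal (P : 𝔼 →L[ℝ] EuclideanSpace ℝ (Fin (n + 1)))
    (w : EuclideanSpace ℝ (Fin (n + 1))) :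
    inner ℝ (crossNormal P) w = (Matrix.of fun a b : Fin (n + 1) =>
      (Fin.cons w (fun b' => P (EuclideanSpace.single b' 1)) :
        Fin (n + 1) → EuclideanSpace ℝ (Fin (n + 1))) b a).det := by
  rw [Matrix.det_succ_column_zero, PiLp.inner_apply]
  refine Finset.sum_congr rfl fun i _ => ?_
  simp only [crossNormal, of_apply, Fin.cons_zero, RCLike.inner_apply, conj_trivial]
  rw [mul_comm, mul_right_comm]
  rfl

theorem inner_crossNormal_apply (P : 𝔼 →L[ℝ] EuclideanSpace ℝ (Fin (n + 1))) (x : 𝔼) :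
    inner ℝ (crossNormal P) (P x) = 0 := by
  have hx0 : x = ∑ i, x i • EuclideanSpace.single i (1 : ℝ) := by
    ext j; simp [Finset.sum_apply, Pi.single_apply]
  rw [hx0, map_sum, inner_sum]
  refine Finset.sum_eq_zero fun i _ => ?_
  rw [map_smul, inner_smul_right, inner_crossNormal]
  rw [Matrix.det_zero_of_column_eq (i := 0) (j := i.succ) (Fin.succ_ne_zero i).symm, mul_zero]
  intro k
  simp

theorem crossNormal_ne_zero {P : 𝔼 →L[ℝ] EuclideanSpace ℝ (Fin (n + 1))}
    (hP : P ∈ immersions n (n + 1)) : crossNormal P ≠ 0 := by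
  have hinj := injective_of_mem_immersions hP
  have hli : LinearIndependent ℝ fun b : Fin n => P (EuclideanSpace.single b 1) := by
    have h1 := (EuclideanSpace.basisFun (Fin n) ℝ).toBasis.linearIndependent
    have h2 := h1.map' (P : 𝔼 →ₗ[ℝ] EuclideanSpace ℝ (Fin (n + 1)))
      (LinearMap.ker_eq_bot.2 hinj)
    have e : (P : 𝔼 →ₗ[ℝ] EuclideanSpace ℝ (Fin (n + 1))) ∘
        (EuclideanSpace.basisFun (Fin n) ℝ).toBasis =
        fun b : Fin n => P (EuclideanSpace.single b 1) := by
      ext1 b; simp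
    rwa [e] at h2
  obtain ⟨w, hw⟩ : ∃ w, w ∉ Submodule.span ℝ
      (range fun b : Fin n => P (EuclideanSpace.single b 1)) := by
    by_contra! hcon
    have htop : Submodule.span ℝ (range fun b : Fin n => P (EuclideanSpace.single b 1)) = ⊤ :=
      eq_top_iff.2 fun w _ => hcon w
    have := finrank_range_le_card (R := ℝ) (fun b : Fin n => P (EuclideanSpace.single b 1))
    rw [Set.finrank, htop, finrank_top, finrank_euclideanSpace] at this
    simp at this
  have hli2 := linearIndependent_finCons.2 ⟨hli, hw⟩
  intro h0
  have hdet := inner_crossNormal P w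
  rw [h0, inner_zero_left] at hdet
  have hli3 := hli2.map' (WithLp.linearEquiv 2 ℝ (Fin (n + 1) → ℝ)).toLinearMap
    (LinearEquiv.ker _)
  have hu := Matrix.linearIndependent_cols_iff_isUnit (A := Matrix.of fun a b : Fin (n + 1) =>
      (Fin.cons w (fun b' => P (EuclideanSpace.single b' 1)) :
        Fin (n + 1) → EuclideanSpace ℝ (Fin (n + 1))) b a) |>.1 hli3
  exact (((Matrix.isUnit_iff_isUnit_det _).1 hu).ne_zero) hdet.symm

theorem contDiff_crossNormal :
    ContDiff ℝ ∞ (crossNormal : (𝔼 →L[ℝ] EuclideanSpace ℝ (Fin (n + 1))) → _) := by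
  rw [contDiff_euclidean]
  intro i
  simp only [crossNormal, Matrix.det_apply, of_apply]
  refine contDiff_const.mul (ContDiff.sum fun σ _ => ContDiff.const_smul _ (contDiff_prod
    fun b _ => ?_))
  exact ((EuclideanSpace.proj (𝕜 := ℝ) (i.succAbove (σ b))).comp
    (ContinuousLinearMap.apply ℝ (EuclideanSpace ℝ (Fin (n + 1)))
      (EuclideanSpace.single b (1 : ℝ)))).contDiff

/-- The unit normal of the image of `P`. -/
noncomputable def unitNormal (P : 𝔼 →L[ℝ] EuclideanSpace ℝ (Fin (n + 1))) :
    EuclideanSpace ℝ (Fin (n + 1)) :=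
  ‖crossNormal P‖⁻¹ • crossNormal P

theorem norm_unitNormal {P : 𝔼 →L[ℝ] EuclideanSpace ℝ (Fin (n + 1))}
    (hP : P ∈ immersions n (n + 1)) : ‖unitNormal P‖ = 1 :=
  norm_smul_inv_norm (𝕜 := ℝ) (crossNormal_ne_zero hP)

theorem inner_unitNormal_apply (P : 𝔼 →L[ℝ] EuclideanSpace ℝ (Fin (n + 1))) (x : 𝔼) :
    inner ℝ (unitNormal P) (P x) = 0 := by
  rw [unitNormal, inner_smul_left, inner_crossNormal_apply, mul_zero]

theorem contDiffOn_unitNormal :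
    ContDiffOn ℝ ∞ (unitNormal : (𝔼 →L[ℝ] EuclideanSpace ℝ (Fin (n + 1))) → _)
      (immersions n (n + 1)) := by
  intro P hP
  have h := contDiff_crossNormal.contDiffAt (x := P)
  have h0 := crossNormal_ne_zero hP
  exact (((h.norm ℝ h0).inv (norm_ne_zero_iff.2 h0)).smul h).contDiffWithinAt

/-- The tangent vector `ξ` to the image of `P` with `⟨ξ, P x⟩ = ⟨ν, x⟩`. -/
noncomputable def liftCovector (ν : 𝔼) (P : 𝔼 →L[ℝ] EuclideanSpace ℝ (Fin m)) :
    EuclideanSpace ℝ (Fin m) :=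
  P ((ContinuousLinearMap.adjoint P ∘L P).inverse ν)

theorem exists_equiv_adjoint_comp {P : 𝔼 →L[ℝ] EuclideanSpace ℝ (Fin m)}
    (hP : P ∈ immersions n m) :
    ∃ e : 𝔼 ≃L[ℝ] 𝔼, (e : 𝔼 →L[ℝ] 𝔼) = ContinuousLinearMap.adjoint P ∘L P := by
  have hinj := injective_of_mem_immersions hP
  have h : Function.Injective ((ContinuousLinearMap.adjoint P ∘L P : 𝔼 →L[ℝ] 𝔼) : 𝔼 →ₗ[ℝ] 𝔼) := by
    rw [injective_iff_map_eq_zero]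
    intro x hx
    have h1 : inner ℝ (P x) (P x) = 0 := by
      rw [← ContinuousLinearMap.adjoint_inner_right]
      have : (ContinuousLinearMap.adjoint P) (P x) = 0 := hx
      rw [this, inner_zero_right]
    exact hinj (by rw [inner_self_eq_zero.1 h1, map_zero])
  exact ⟨(LinearEquiv.ofInjectiveEndo _ h).toContinuousLinearEquiv, by ext1 x; rfl⟩

theorem inner_liftCovector {P : 𝔼 →L[ℝ] EuclideanSpace ℝ (Fin m)} (hP : P ∈ immersions n m)
    (ν x : 𝔼) : inner ℝ (liftCovector ν P) (P x) = inner ℝ ν x := by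
  obtain ⟨e, he⟩ := exists_equiv_adjoint_comp hP
  rw [liftCovector, ← he, ContinuousLinearMap.inverse_equiv,
    ← ContinuousLinearMap.adjoint_inner_left]
  have : (ContinuousLinearMap.adjoint P) (P (e.symm ν)) = e (e.symm ν) := by
    rw [show e (e.symm ν) = (e : 𝔼 →L[ℝ] 𝔼) (e.symm ν) from rfl, he]; rfl
  simp [this]

theorem contDiffOn_liftCovector (ν : 𝔼) :
    ContDiffOn ℝ ∞ (liftCovector ν : (𝔼 →L[ℝ] EuclideanSpace ℝ (Fin m)) → _)
      (immersions n m) := by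
  intro P hP
  obtain ⟨e, he⟩ := exists_equiv_adjoint_comp hP
  have h1 : ContDiff ℝ ∞ fun P : 𝔼 →L[ℝ] EuclideanSpace ℝ (Fin m) =>
      ContinuousLinearMap.adjoint P ∘L P :=
    ContDiff.clm_comp ((ContinuousLinearMap.adjoint (𝕜 := ℝ) (E := 𝔼)
      (F := EuclideanSpace ℝ (Fin m))).contDiff) contDiff_id
  have h2 := contDiffAt_map_inverse (n := ∞) e
  rw [he] at h2
  have h3 := ContDiffAt.comp (f := fun P : 𝔼 →L[ℝ] EuclideanSpace ℝ (Fin m) =>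
    ContinuousLinearMap.adjoint P ∘L P) P h2 h1.contDiffAt
  have h4 : ContDiffAt ℝ ∞ (fun P : 𝔼 →L[ℝ] EuclideanSpace ℝ (Fin m) =>
      P ((ContinuousLinearMap.adjoint P ∘L P).inverse ν)) P :=
    contDiffAt_id.clm_apply (h3.clm_apply contDiffAt_const)
  exact h4.contDiffWithinAt

end Gram

/-! ### Corrugations: adding one primitive metric -/

section Corrugation

open Matrix

variable {n m : ℕ}

local notation "𝔼" => EuclideanSpace ℝ (Fin n)
local notation "𝔽" => EuclideanSpace ℝ (Fin (n + 1))

/-- The covector `ν` tensored with the vector `τ`. -/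
noncomputable def rankOneMap (ν : 𝔼) (τ : 𝔽) : 𝔼 →L[ℝ] 𝔽 := (innerSL ℝ ν).smulRight τ

theorem rankOneMap_apply (ν : 𝔼) (τ : 𝔽) (x : 𝔼) : rankOneMap ν τ x = inner ℝ ν x • τ := rfl

theorem norm_rankOneMap_le (ν : 𝔼) (τ : 𝔽) : ‖rankOneMap ν τ‖ ≤ ‖ν‖ * ‖τ‖ := by
  rw [rankOneMap, ContinuousLinearMap.norm_smulRight_apply, innerSL_apply_norm]

theorem inner_unitNormal_liftCovector (ν : 𝔼) (P : 𝔼 →L[ℝ] 𝔽) :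
    inner ℝ (unitNormal P) (liftCovector ν P) = 0 :=
  inner_unitNormal_apply P _

/-- The polynomial corrugation identity: a rank one perturbation of `P` in the direction `ν`
changes the Gram matrix by a multiple of `ν ⊗ ν`. -/
theorem colGram_add_rankOneMap {P : 𝔼 →L[ℝ] 𝔽} (hP : P ∈ immersions n (n + 1)) (ν : 𝔼)
    (s t : ℝ) {T : 𝔼 →L[ℝ] 𝔽}
    (hT : T = rankOneMap ν (s • unitNormal P - t • liftCovector ν P)) :
    colGram (P + T) (P + T) = colGram P P +
      (s ^ 2 - 2 * t + t ^ 2 * ‖liftCovector ν P‖ ^ 2) • vecMulVec (ν : Fin n → ℝ) ν := by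
  set ζ := unitNormal P
  set ξ := liftCovector ν P
  have h1 : ∀ i : Fin n, inner ℝ (s • ζ - t • ξ) (P (EuclideanSpace.single i 1)) = - t * ν i := by
    intro i
    rw [inner_sub_left, inner_smul_left, inner_smul_left, inner_unitNormal_apply,
      inner_liftCovector hP, EuclideanSpace.inner_single_right]
    simp
  have hζξ : inner ℝ ζ ξ = 0 := inner_unitNormal_liftCovector ν P
  have h2 : inner ℝ (s • ζ - t • ξ) (s • ζ - t • ξ) = s ^ 2 + t ^ 2 * ‖ξ‖ ^ 2 := by
    have hζ : inner ℝ ζ ζ = 1 := by rw [real_inner_self_eq_norm_sq, norm_unitNormal hP]; norm_num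
    rw [inner_sub_sub_self]
    have hξζ : inner ℝ ξ ζ = 0 := by rw [real_inner_comm, hζξ]
    simp only [inner_smul_left, inner_smul_right, hζ, hζξ, hξζ, real_inner_self_eq_norm_sq ξ,
      conj_trivial]
    ring
  generalize s • ζ - t • ξ = τ at *
  have h1' : ∀ i : Fin n, inner ℝ (P (EuclideanSpace.single i 1)) τ = - t * ν i := fun i => by
    rw [real_inner_comm, h1]
  ext i j
  have hTi : ∀ i : Fin n, T (EuclideanSpace.single i 1) = ν i • τ := by
    intro i
    rw [hT, rankOneMap_apply, EuclideanSpace.inner_single_right]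
    simp
  simp only [colGram, of_apply, Matrix.add_apply, Matrix.smul_apply, vecMulVec_apply, smul_eq_mul,
    _root_.add_apply, hTi, inner_add_left, inner_add_right, inner_smul_left, inner_smul_right, h1,
    h1', h2, conj_trivial]
  ring

/-- The effect on the Gram matrix of a perturbation `R` of `P + T`. The inner products of the
columns of `R` with those of `P` are bounded separately, as they are much smaller than `‖P‖ * ‖R‖`
for the remainder of a corrugation. -/
theorem norm_colGram_add_sub_le (P T R : 𝔼 →L[ℝ] EuclideanSpace ℝ (Fin m)) {b : ℝ}
    (hb : ∀ i j : Fin n, |inner ℝ (P (EuclideanSpace.single i 1))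
      (R (EuclideanSpace.single j 1))| ≤ b) :
    ‖colGram (P + T + R) (P + T + R) - colGram (P + T) (P + T)‖ ≤
      n * (2 * b + 2 * (‖T‖ * ‖R‖) + ‖R‖ ^ 2) := by
  refine frobenius_norm_le_of_entries fun i j => ?_
  have e : (colGram (P + T + R) (P + T + R) - colGram (P + T) (P + T)) i j =
      inner ℝ (P (EuclideanSpace.single i 1)) (R (EuclideanSpace.single j 1)) +
      inner ℝ (P (EuclideanSpace.single j 1)) (R (EuclideanSpace.single i 1)) +
      inner ℝ (T (EuclideanSpace.single i 1)) (R (EuclideanSpace.single j 1)) +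
      inner ℝ (T (EuclideanSpace.single j 1)) (R (EuclideanSpace.single i 1)) +
      inner ℝ (R (EuclideanSpace.single i 1)) (R (EuclideanSpace.single j 1)) := by
    simp only [colGram, of_apply, Matrix.sub_apply, _root_.add_apply, inner_add_left,
      inner_add_right]
    rw [real_inner_comm (R (EuclideanSpace.single i 1)) (P (EuclideanSpace.single j 1)),
      real_inner_comm (R (EuclideanSpace.single i 1)) (T (EuclideanSpace.single j 1))]
    ring
  have hi : ∀ (Q S : 𝔼 →L[ℝ] EuclideanSpace ℝ (Fin m)) (i j : Fin n),
      |inner ℝ (Q (EuclideanSpace.single i 1)) (S (EuclideanSpace.single j 1))| ≤ ‖Q‖ * ‖S‖ := by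
    intro Q S i j
    refine (abs_real_inner_le_norm _ _).trans ?_
    gcongr <;> exact norm_apply_single_le _ _
  rw [e]
  refine (abs_add_le _ _).trans ?_
  have a1 := abs_add_le (inner ℝ (P (EuclideanSpace.single i 1)) (R (EuclideanSpace.single j 1)) +
      inner ℝ (P (EuclideanSpace.single j 1)) (R (EuclideanSpace.single i 1)) +
      inner ℝ (T (EuclideanSpace.single i 1)) (R (EuclideanSpace.single j 1)))
      (inner ℝ (T (EuclideanSpace.single j 1)) (R (EuclideanSpace.single i 1)))
  have a2 := abs_add_le (inner ℝ (P (EuclideanSpace.single i 1)) (R (EuclideanSpace.single j 1)) +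
      inner ℝ (P (EuclideanSpace.single j 1)) (R (EuclideanSpace.single i 1)))
      (inner ℝ (T (EuclideanSpace.single i 1)) (R (EuclideanSpace.single j 1)))
  have a3 := abs_add_le (inner ℝ (P (EuclideanSpace.single i 1)) (R (EuclideanSpace.single j 1)))
      (inner ℝ (P (EuclideanSpace.single j 1)) (R (EuclideanSpace.single i 1)))
  have b1 := hb i j
  have b2 := hb j i
  have b3 := hi T R i j
  have b4 := hi T R j i
  have b5 := hi R R i j
  rw [← sq] at b5
  linarith

theorem hasFDerivAt_sin_smul {Y : 𝔼 → 𝔽} {Y' : 𝔼 →L[ℝ] 𝔽} {x : 𝔼} (hY : HasFDerivAt Y Y' x)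
    (ν : 𝔼) (η : ℝ) :
    HasFDerivAt (fun x => Real.sin (η * inner ℝ ν x) • Y x)
      (Real.sin (η * inner ℝ ν x) • Y' +
        (η * Real.cos (η * inner ℝ ν x)) • rankOneMap ν (Y x)) x := by
  have h1 : HasFDerivAt (fun x : 𝔼 => η * inner ℝ ν x) (η • innerSL ℝ ν) x :=
    (innerSL ℝ ν).hasFDerivAt.const_mul η
  have h2 := h1.sin.smul hY
  refine h2.congr_fderiv ?_
  ext1 y
  simp only [rankOneMap, _root_.add_apply, _root_.smul_apply, ContinuousLinearMap.smulRight_apply,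
    smul_smul, smul_eq_mul]
  congr 2
  ring

/-- The corrugation of amplitude `δ * a` and frequency `η` in the direction `ν` of a map with
differential `P`: a normal oscillation, corrected by a tangential one of twice the frequency. -/
noncomputable def corrugation (δ η : ℝ) (ν : 𝔼) (a : 𝔼 → ℝ) (P : 𝔼 → 𝔼 →L[ℝ] 𝔽) (x : 𝔼) : 𝔽 :=
  (δ / η) • (√2 • Real.sin (η * inner ℝ ν x) • a x • unitNormal (P x) -
    (δ / 4) • Real.sin (2 * η * inner ℝ ν x) • a x • a x • liftCovector ν (P x))

/-- The principal part of the derivative of a corrugation is the rank one perturbation in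
`colGram_add_rankOneMap` with `s = √2 δ a cos θ` and `t = δ² a² cos (2θ) / 2`, so that `s² - 2t =
δ² a²`; the derivatives of the amplitudes carry the small factor `δ / η`. -/
theorem hasFDerivAt_corrugation {δ η : ℝ} (hη : η ≠ 0) (ν : 𝔼) {a : 𝔼 → ℝ}
    {P : 𝔼 → 𝔼 →L[ℝ] 𝔽} {x : 𝔼} {Y' V' : 𝔼 →L[ℝ] 𝔽}
    (hY : HasFDerivAt (fun x => a x • unitNormal (P x)) Y' x)
    (hV : HasFDerivAt (fun x => a x • a x • liftCovector ν (P x)) V' x) :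
    HasFDerivAt (corrugation δ η ν a P)
      (rankOneMap ν ((√2 * δ * a x * Real.cos (η * inner ℝ ν x)) • unitNormal (P x) -
        (δ ^ 2 * a x ^ 2 / 2 * Real.cos (2 * (η * inner ℝ ν x))) • liftCovector ν (P x)) +
      (δ / η) • ((√2 * Real.sin (η * inner ℝ ν x)) • Y' -
        (δ / 4 * Real.sin (2 * η * inner ℝ ν x)) • V')) x := by
  have h := (((hasFDerivAt_sin_smul hY ν η).const_smul √2).sub
    ((hasFDerivAt_sin_smul hV ν (2 * η)).const_smul (δ / 4))).const_smul (δ / η)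
  refine h.congr_fderiv ?_
  ext1 y
  simp only [rankOneMap_apply, _root_.add_apply, _root_.sub_apply, _root_.smul_apply, mul_assoc 2 η]
  match_scalars <;> field_simp <;> ring

end Corrugation

/-! ### The error made by a corrugation -/

section CorrugationStep

open Matrix

variable {n : ℕ}

local notation "𝔼" => EuclideanSpace ℝ (Fin n)
local notation "𝔽" => EuclideanSpace ℝ (Fin (n + 1))

/-- The error made by a corrugation. The remainder `R` is of size `δ η₀ / η`, but its normal part
is invisible to the differential `P`, so that it enters quadratically. -/
theorem norm_colGram_corrugation_sub_le {P : 𝔼 →L[ℝ] 𝔽} (hP : P ∈ immersions n (n + 1)) (ν : 𝔼)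
    {δ q a θ B S₁ S₂ : ℝ} {R : 𝔼 →L[ℝ] 𝔽} (hB : 1 ≤ B) (hδ : 0 < δ) (hδ1 : δ ≤ 1) (hq : 0 ≤ q)
    (hq1 : q ≤ 1) (hν : ‖ν‖ ≤ B) (ha : |a| ≤ B) (hξ : ‖liftCovector ν P‖ ≤ B)
    (hR : ‖R‖ ≤ S₁ * (δ * q)) (hPR : ∀ i j : Fin n, |inner ℝ (P (EuclideanSpace.single i 1))
      (R (EuclideanSpace.single j 1))| ≤ S₂ * (δ ^ 2 * q)) {T : 𝔼 →L[ℝ] 𝔽}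
    (hT : T = rankOneMap ν ((√2 * δ * a * Real.cos θ) • unitNormal P -
        (δ ^ 2 * a ^ 2 / 2 * Real.cos (2 * θ)) • liftCovector ν P)) :
    ‖colGram (P + T + R) (P + T + R) - colGram P P -
      (δ ^ 2 * a ^ 2) • vecMulVec (ν : Fin n → ℝ) ν‖ ≤
      n * (2 * S₂ + 6 * B ^ 4 * S₁ + S₁ ^ 2) * (δ ^ 2 * q) + n * B ^ 8 * δ ^ 4 := by
  have hS₁ : 0 ≤ S₁ * (δ * q) := (norm_nonneg _).trans hR
  have h1 := norm_colGram_add_sub_le P T R hPR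
  have h2 := colGram_add_rankOneMap hP ν (√2 * δ * a * Real.cos θ)
    (δ ^ 2 * a ^ 2 / 2 * Real.cos (2 * θ)) hT
  have hc2 : |Real.cos (2 * θ)| ≤ 1 := Real.abs_cos_le_one _
  have hsq2 : √2 ≤ 2 := by
    rw [Real.sqrt_le_left (by norm_num)]; norm_num
  have ht : |δ ^ 2 * a ^ 2 / 2 * Real.cos (2 * θ)| ≤ δ ^ 2 * B ^ 2 := by
    rw [abs_mul, abs_div, abs_mul, abs_pow, abs_pow, abs_of_pos hδ]
    calc δ ^ 2 * |a| ^ 2 / |2| * |Real.cos (2 * θ)| ≤ δ ^ 2 * B ^ 2 / |2| * 1 := by gcongr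
      _ ≤ δ ^ 2 * B ^ 2 := by
        rw [mul_one, abs_of_pos two_pos]
        have : 0 ≤ δ ^ 2 * B ^ 2 := by positivity
        linarith
  have hs : |√2 * δ * a * Real.cos θ| ≤ 2 * δ * B := by
    rw [abs_mul, abs_mul, abs_mul, abs_of_pos hδ, abs_of_nonneg (Real.sqrt_nonneg 2)]
    calc √2 * δ * |a| * |Real.cos θ| ≤ 2 * δ * B * 1 := by
          gcongr; exact Real.abs_cos_le_one _
      _ = _ := mul_one _
  have hTn : ‖T‖ ≤ 3 * B ^ 4 * δ := by
    rw [hT]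
    refine (norm_rankOneMap_le _ _).trans ?_
    have h3 : ‖(√2 * δ * a * Real.cos θ) • unitNormal P -
        (δ ^ 2 * a ^ 2 / 2 * Real.cos (2 * θ)) • liftCovector ν P‖ ≤
        2 * δ * B * 1 + δ ^ 2 * B ^ 2 * B := by
      refine (norm_sub_le _ _).trans ?_
      rw [norm_smul, norm_smul, norm_unitNormal hP, Real.norm_eq_abs, Real.norm_eq_abs]
      gcongr
    have h4 : δ ^ 2 ≤ δ := by nlinarith
    calc ‖ν‖ * _ ≤ B * (2 * δ * B * 1 + δ ^ 2 * B ^ 2 * B) := by gcongr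
      _ ≤ B * (2 * δ * B * 1 + δ * B ^ 2 * B) := by gcongr
      _ = 2 * B ^ 2 * δ + B ^ 4 * δ := by ring
      _ ≤ 2 * B ^ 4 * δ + B ^ 4 * δ := by (gcongr; norm_num)
      _ = _ := by ring
  have hmain : (√2 * δ * a * Real.cos θ) ^ 2 - 2 * (δ ^ 2 * a ^ 2 / 2 * Real.cos (2 * θ)) =
      δ ^ 2 * a ^ 2 := by
    rw [Real.cos_two_mul]
    have := Real.sq_sqrt (show (0 : ℝ) ≤ 2 by norm_num)
    simp only [mul_pow, this]
    ring
  have hνν : ‖vecMulVec (ν : Fin n → ℝ) ν‖ ≤ n * B ^ 2 := by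
    refine frobenius_norm_le_of_entries fun i j => ?_
    rw [vecMulVec_apply, abs_mul, sq]
    have := fun i => (PiLp.norm_apply_le ν i).trans hν
    gcongr <;> exact this _
  have e : colGram (P + T + R) (P + T + R) - colGram P P -
      (δ ^ 2 * a ^ 2) • vecMulVec (ν : Fin n → ℝ) ν =
      (colGram (P + T + R) (P + T + R) - colGram (P + T) (P + T)) +
      ((δ ^ 2 * a ^ 2 / 2 * Real.cos (2 * θ)) ^ 2 * ‖liftCovector ν P‖ ^ 2) •
        vecMulVec (ν : Fin n → ℝ) ν := by
    rw [h2, hmain, add_smul]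
    abel
  rw [e]
  refine (norm_add_le _ _).trans (add_le_add (h1.trans ?_) ?_)
  · have h5 : ‖T‖ * ‖R‖ ≤ 3 * B ^ 4 * δ * (S₁ * (δ * q)) := by gcongr
    have h6 : ‖R‖ ^ 2 ≤ (S₁ * (δ * q)) ^ 2 := by gcongr
    have h7 : (S₁ * (δ * q)) ^ 2 ≤ S₁ ^ 2 * (δ ^ 2 * q) := by
      have : q ^ 2 ≤ q := by nlinarith
      calc (S₁ * (δ * q)) ^ 2 = S₁ ^ 2 * δ ^ 2 * q ^ 2 := by ring
        _ ≤ S₁ ^ 2 * δ ^ 2 * q := by gcongr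
        _ = _ := by ring
    rw [mul_assoc]
    refine mul_le_mul_of_nonneg_left ?_ (Nat.cast_nonneg n)
    nlinarith
  · rw [norm_smul, Real.norm_eq_abs, abs_mul, abs_pow, abs_of_nonneg (sq_nonneg ‖_‖)]
    calc _ ≤ (δ ^ 2 * B ^ 2) ^ 2 * B ^ 2 * (n * B ^ 2) := by gcongr
      _ = _ := by ring

/-- The two bounds on the remainder of a corrugation: its size, and its smaller inner products
with the columns of `P`. Here `Y` and `V` are the derivatives of the normal and the tangential
amplitude. -/
theorem norm_remainder_le {P Y V : 𝔼 →L[ℝ] 𝔽} {δ η₀ η c₁ c₂ A CY CV D : ℝ} (hδ : 0 < δ)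
    (hδ1 : δ ≤ 1) (hη : 0 < η) (hc₁ : |c₁| ≤ 2) (hc₂ : |c₂| ≤ δ) (hP : ‖P‖ ≤ A)
    (hY : ‖Y‖ ≤ CY * η₀) (hV : ‖V‖ ≤ CV * η₀)
    (hPY : ∀ i j : Fin n, |inner ℝ (P (EuclideanSpace.single i 1))
      (Y (EuclideanSpace.single j 1))| ≤ D * (δ * η₀)) :
    ‖(δ / η) • (c₁ • Y - c₂ • V)‖ ≤ (2 * CY + CV) * (δ * (η₀ / η)) ∧
    ∀ i j : Fin n, |inner ℝ (P (EuclideanSpace.single i 1))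
      (((δ / η) • (c₁ • Y - c₂ • V)) (EuclideanSpace.single j 1))| ≤
      (2 * D + A * CV) * (δ ^ 2 * (η₀ / η)) := by
  have hδη : 0 < δ / η := by positivity
  constructor
  · rw [norm_smul, Real.norm_eq_abs, abs_of_pos hδη]
    have h1 : ‖c₁ • Y - c₂ • V‖ ≤ 2 * (CY * η₀) + 1 * (CV * η₀) := by
      refine (norm_sub_le _ _).trans ?_
      rw [norm_smul, norm_smul, Real.norm_eq_abs, Real.norm_eq_abs]
      have := hc₂.trans hδ1
      gcongr
    calc δ / η * _ ≤ δ / η * (2 * (CY * η₀) + 1 * (CV * η₀)) := by gcongr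
      _ = _ := by ring
  · intro i j
    have hPV : |inner ℝ (P (EuclideanSpace.single i 1)) (V (EuclideanSpace.single j 1))| ≤
        A * (CV * η₀) := by
      refine (abs_real_inner_le_norm (P (EuclideanSpace.single i 1))
        (V (EuclideanSpace.single j 1))).trans ?_
      have h1 := (norm_apply_single_le P i).trans hP
      have h2 := (norm_apply_single_le V j).trans hV
      gcongr
      exact (norm_nonneg _).trans hP
    have hPY' := hPY i j
    rw [_root_.smul_apply, _root_.sub_apply, _root_.smul_apply, _root_.smul_apply,
      inner_smul_right, inner_sub_right, inner_smul_right, inner_smul_right, abs_mul,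
      abs_of_pos hδη]
    generalize inner ℝ (P (EuclideanSpace.single i 1)) (Y (EuclideanSpace.single j 1)) = y at *
    generalize inner ℝ (P (EuclideanSpace.single i 1)) (V (EuclideanSpace.single j 1)) = z at *
    have h1 := abs_sub (c₁ * y) (c₂ * z)
    rw [abs_mul c₁, abs_mul c₂] at h1
    calc δ / η * |c₁ * y - c₂ * z| ≤
        δ / η * (2 * (D * (δ * η₀)) + δ * (A * (CV * η₀))) := by
          refine mul_le_mul_of_nonneg_left (h1.trans ?_) hδη.le
          gcongr
      _ = _ := by ring

/-- The derivative of `a • unitNormal` is tangential up to second derivatives of the immersion: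
the derivative of the amplitude contributes to the normal direction only. -/
theorem abs_inner_fderiv_smul_unitNormal_le {P : 𝔼 → 𝔼 →L[ℝ] 𝔽} {a : 𝔼 → ℝ} {x : 𝔼}
    (hPx : P x ∈ immersions n (n + 1)) (ha : DifferentiableAt ℝ a x)
    (hP : DifferentiableAt ℝ P x) {A Bz s : ℝ} (hPn : ‖P x‖ ≤ A) (han : |a x| ≤ A)
    (hBz : ‖fderiv ℝ (unitNormal (n := n)) (P x)‖ ≤ Bz) (hDP : ‖fderiv ℝ P x‖ ≤ A * s)
    (i j : Fin n) :
    |inner ℝ (P x (EuclideanSpace.single i 1))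
      (fderiv ℝ (fun x => a x • unitNormal (P x)) x (EuclideanSpace.single j 1))| ≤
      A * (A * (Bz * A)) * s := by
  have hA : 0 ≤ A := (norm_nonneg _).trans hPn
  have hB : 0 ≤ Bz := (norm_nonneg (fderiv ℝ (unitNormal (n := n)) (P x))).trans hBz
  have h1 : HasFDerivAt (unitNormal (n := n)) (fderiv ℝ unitNormal (P x)) (P x) :=
    ((contDiffOn_unitNormal.contDiffAt (isOpen_immersions.mem_nhds hPx)).differentiableAt
      (by simp)).hasFDerivAt
  have hZd : HasFDerivAt (fun x => unitNormal (P x))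
      (fderiv ℝ unitNormal (P x) ∘L fderiv ℝ P x) x := h1.comp x hP.hasFDerivAt
  have h2 : fderiv ℝ (fun x => a x • unitNormal (P x)) x =
      a x • (fderiv ℝ unitNormal (P x) ∘L fderiv ℝ P x) +
      (fderiv ℝ a x).smulRight (unitNormal (P x)) := (ha.hasFDerivAt.smul hZd).fderiv
  have h4 : inner ℝ (P x (EuclideanSpace.single i 1)) (unitNormal (P x)) = 0 := by
    rw [real_inner_comm, inner_unitNormal_apply]
  rw [h2, _root_.add_apply, inner_add_right, _root_.smul_apply,
    ContinuousLinearMap.smulRight_apply, inner_smul_right, inner_smul_right, h4, mul_zero,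
    add_zero, abs_mul]
  have h3 : ‖(fderiv ℝ unitNormal (P x) ∘L fderiv ℝ P x) (EuclideanSpace.single j 1)‖ ≤
      Bz * (A * s) := by
    refine (norm_apply_single_le _ _).trans ((ContinuousLinearMap.opNorm_comp_le _ _).trans ?_)
    gcongr
  have h5 : |inner ℝ (P x (EuclideanSpace.single i 1))
      ((fderiv ℝ unitNormal (P x) ∘L fderiv ℝ P x) (EuclideanSpace.single j 1))| ≤
      A * (Bz * (A * s)) := by
    refine (abs_real_inner_le_norm (P x (EuclideanSpace.single i 1)) _).trans ?_
    have := (norm_apply_single_le (P x) i).trans hPn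
    gcongr
  calc _ ≤ A * (A * (Bz * (A * s))) := by gcongr
    _ = _ := by ring

/-- One corrugation adds the primitive metric `δ² a² ν ⊗ ν` to the metric of `u`, up to the error
`δ² η₀ / η + δ⁴`. One derivative is lost: the `m + 1` derivatives of `fderiv ℝ u` controlled at
the frequency `η₀` yield `m` derivatives of `fderiv ℝ v` at the frequency `η`. The constant
depends on `u` only through the compact set `K` of immersions in which its differential takes its
values. -/
theorem exists_corrugation_step {K : Set (𝔼 →L[ℝ] 𝔽)} (hK : IsCompact K)
    (hKi : K ⊆ immersions n (n + 1)) {A : ℝ} (hA : 1 ≤ A) (ν : 𝔼) {m : ℕ} (hm : 1 ≤ m) :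
    ∃ C : ℝ, 1 ≤ C ∧ ∀ (U : Set 𝔼) (u : 𝔼 → 𝔽) (a : 𝔼 → ℝ) (δ η₀ η : ℝ), IsOpen U →
      ContDiffOn ℝ ∞ u U → SymbolOn U (m + 1) A η₀ (fderiv ℝ u) → MapsTo (fderiv ℝ u) U K →
      (∀ x ∈ U, ‖fderiv ℝ (fderiv ℝ u) x‖ ≤ A * (δ * η₀)) → SymbolOn U (m + 1) A η₀ a →
      0 < δ → δ ≤ 1 → 1 ≤ η₀ → η₀ ≤ η →
      ∃ v : 𝔼 → 𝔽, ContDiffOn ℝ ∞ v U ∧ SymbolOn U m C η (fderiv ℝ v) ∧ ∀ x ∈ U,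
        ‖v x - u x‖ ≤ C * δ ∧ ‖fderiv ℝ v x - fderiv ℝ u x‖ ≤ C * δ ∧
        ‖fderiv ℝ (fderiv ℝ v) x‖ ≤ C * (δ * η) ∧
        ‖colGram (fderiv ℝ v x) (fderiv ℝ v x) - colGram (fderiv ℝ u x) (fderiv ℝ u x) -
          (δ ^ 2 * a x ^ 2) • vecMulVec (ν : Fin n → ℝ) ν‖ ≤
          C * (δ ^ 2 * (η₀ / η) + δ ^ 4) := by
  obtain ⟨CZ, hCZ1, hCZ⟩ := SymbolOn.exists_comp (E := 𝔼) isOpen_immersions hK hKi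
    contDiffOn_unitNormal (m + 1) A
  obtain ⟨CX, hCX1, hCX⟩ := SymbolOn.exists_comp (E := 𝔼) isOpen_immersions hK hKi
    (contDiffOn_liftCovector ν) (m + 1) A
  obtain ⟨Bz, hBz⟩ : ∃ Bz, ∀ P ∈ K, ‖fderiv ℝ (unitNormal (n := n)) P‖ ≤ Bz :=
    hK.exists_bound_of_continuousOn ((contDiffOn_unitNormal.continuousOn_fderiv_of_isOpen
      isOpen_immersions (by simp)).mono hKi)
  set CY := 2 ^ (m + 1) * A * CZ
  set CV := 2 ^ (m + 1) * A * (2 ^ (m + 1) * A * CX)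
  set S₁ : ℝ := (m + 1).factorial * (max ‖innerSL ℝ ν‖ 1) ^ (m + 1)
  set S₂ : ℝ := (m + 1).factorial * (max ‖innerSL ℝ ((2 : ℝ) • ν)‖ 1) ^ (m + 1)
  set CW := |√2| * (2 ^ (m + 1) * S₁ * CY) + 1 * (2 ^ (m + 1) * S₂ * CV)
  set B := A + ‖ν‖ + CX
  set R₁ := 2 * CY + CV
  set R₂ := 2 * (A * (A * (|Bz| * A))) + A * CV
  have hCY : 0 ≤ CY := by positivity
  have hCV : 0 ≤ CV := by positivity
  have hS₁ : 0 ≤ S₁ := by positivity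
  have hS₂ : 0 ≤ S₂ := by positivity
  have hCW : 0 ≤ CW := by positivity
  have hR₁ : 0 ≤ R₁ := by positivity
  have hR₂ : 0 ≤ R₂ := by positivity
  have hB : 1 ≤ B := by
    have := norm_nonneg ν
    simp only [B]; linarith
  set C₁ := n * (2 * R₂ + 6 * B ^ 4 * R₁ + R₁ ^ 2)
  set C₂ := n * B ^ 8
  have hC₁ : 0 ≤ C₁ := by positivity
  have hC₂ : 0 ≤ C₂ := by positivity
  refine ⟨A + CW + C₁ + C₂, by linarith, ?_⟩
  intro U u a δ η₀ η hU hu hDu hKu hDDu ha hδ hδ1 hη₀ hη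
  have hη₀0 : 0 < η₀ := by linarith
  have hη0 : 0 < η := by linarith
  have hZ := hCZ U η₀ (fderiv ℝ u) hU hη₀0.le hDu hKu
  have hX := hCX U η₀ (fderiv ℝ u) hU hη₀0.le hDu hKu
  have hY := SymbolOn.smul hU hη₀0.le (by linarith) ha hZ
  have hV := SymbolOn.smul hU hη₀0.le (by linarith) ha
    (SymbolOn.smul hU hη₀0.le (by linarith) ha hX)
  have hYη := hY.mono le_rfl le_rfl hCY hη₀0.le hη
  have hVη := hV.mono le_rfl le_rfl hCV hη₀0.le hη
  have hs1 : SymbolOn U (m + 1) S₁ η (fun x => Real.sin (η * inner ℝ ν x)) :=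
    symbolOn_sin U (m + 1) (innerSL ℝ ν) hη0.le
  have hs2 : SymbolOn U (m + 1) S₂ η (fun x => Real.sin (2 * η * inner ℝ ν x)) := by
    refine (symbolOn_sin U (m + 1) (innerSL ℝ ((2 : ℝ) • ν)) hη0.le).congr hU fun x _ => ?_
    simp only [innerSL_apply_apply, inner_smul_left]
    simp only [conj_trivial]
    ring_nf
  set w := corrugation δ η ν a (fderiv ℝ u)
  have hw : SymbolOn U (m + 1) (|δ / η| * CW) η w := by
    refine SymbolOn.const_smul hU ?_ (δ / η)
    have h1 := (SymbolOn.smul hU hη0.le hS₁ hs1 hYη).const_smul hU √2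
    have h2 := (SymbolOn.smul hU hη0.le hS₂ hs2 hVη).const_smul hU (δ / 4)
    refine (h1.sub hU h2).mono_const ?_ hη0.le
    have : |δ / 4| ≤ 1 := by rw [abs_of_pos (by positivity)]; linarith
    exact add_le_add le_rfl (mul_le_mul_of_nonneg_right this (by positivity))
  have hcoef : |δ / η| * CW * η = CW * δ := by
    rw [abs_of_pos (by positivity)]; field_simp
  have hDw := hw.fderiv hU
  rw [hcoef] at hDw
  have hDu' : ∀ x ∈ U, DifferentiableAt ℝ u x := fun x hx =>
    (hu.contDiffAt (hU.mem_nhds hx)).differentiableAt (by simp)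
  have hDv : EqOn (fderiv ℝ fun x => u x + w x) (fun x => fderiv ℝ u x + fderiv ℝ w x) U :=
    fun x hx => fderiv_fun_add (hDu' x hx) (hw.differentiableAt hU hx)
  have hδη : δ ≤ δ * η := le_mul_of_one_le_right hδ.le (by linarith)
  refine ⟨fun x => u x + w x, hu.add hw.contDiffOn, ?_, fun x hx => ⟨?_, ?_, ?_, ?_⟩⟩
  · have h1 := (hDu.mono (Nat.le_succ m) le_rfl (by linarith) hη₀0.le hη).add hU hDw
    refine (h1.congr hU hDv).mono_const ?_ hη0.le
    have : CW * δ ≤ CW := mul_le_of_le_one_right hCW hδ1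
    linarith
  · rw [add_sub_cancel_left]
    refine (hw.norm_le hx).trans ?_
    have h1 : |δ / η| ≤ δ := by
      rw [abs_of_pos (by positivity)]; exact div_le_self hδ.le (by linarith)
    calc |δ / η| * CW ≤ δ * CW := by gcongr
      _ ≤ (A + CW + C₁ + C₂) * δ := by rw [mul_comm]; gcongr; linarith
  · rw [hDv hx, add_sub_cancel_left]
    refine (hDw.norm_le hx).trans ?_
    gcongr; linarith
  · have h1 : fderiv ℝ (fderiv ℝ fun x => u x + w x) x =
        fderiv ℝ (fderiv ℝ u) x + fderiv ℝ (fderiv ℝ w) x := by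
      rw [(Filter.eventuallyEq_of_mem (hU.mem_nhds hx) hDv).fderiv_eq]
      exact fderiv_fun_add (hDu.differentiableAt hU hx) (hDw.differentiableAt hU hx)
    rw [h1]
    have h2 := hDw.norm_fderiv_le hm hx
    have h3 := hDDu x hx
    refine (norm_add_le (fderiv ℝ (fderiv ℝ u) x) (fderiv ℝ (fderiv ℝ w) x)).trans ?_
    have h4 : A * (δ * η₀) ≤ A * (δ * η) := by gcongr
    have h5 : 0 ≤ (C₁ + C₂) * (δ * η) := by positivity
    linarith
  · have hPx : fderiv ℝ u x ∈ immersions n (n + 1) := hKi (hKu hx)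
    have hYx := (hY.differentiableAt hU hx).hasFDerivAt
    have hVx := (hV.differentiableAt hU hx).hasFDerivAt
    have hwx := (hasFDerivAt_corrugation (δ := δ) hη0.ne' ν hYx hVx).fderiv
    rw [hDv hx]
    simp only [w]
    rw [hwx, ← add_assoc]
    set Y' := fderiv ℝ (fun x => a x • unitNormal (fderiv ℝ u x)) x with hY'
    set V' := fderiv ℝ (fun x => a x • a x • liftCovector ν (fderiv ℝ u x)) x
    have hY'n : ‖Y'‖ ≤ CY * η₀ := hY.norm_fderiv_le (by omega) hx
    have hV'n : ‖V'‖ ≤ CV * η₀ := hV.norm_fderiv_le (by omega) hx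
    have hsq2 : √2 ≤ 2 := by
      rw [Real.sqrt_le_left (by norm_num)]; norm_num
    have hc1 : |√2 * Real.sin (η * inner ℝ ν x)| ≤ 2 := by
      rw [abs_mul, abs_of_nonneg (Real.sqrt_nonneg 2)]
      have := mul_le_mul hsq2 (Real.abs_sin_le_one (η * inner ℝ ν x)) (abs_nonneg _) two_pos.le
      linarith
    have hc2 : |δ / 4 * Real.sin (2 * η * inner ℝ ν x)| ≤ δ := by
      rw [abs_mul, abs_of_pos (by positivity)]
      have := mul_le_mul_of_nonneg_left (Real.abs_sin_le_one (2 * η * inner ℝ ν x))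
        (show 0 ≤ δ / 4 by positivity)
      linarith
    have hPn : ‖fderiv ℝ u x‖ ≤ A := hDu.norm_le hx
    have han : |a x| ≤ A := ha.norm_le hx
    have hPY : ∀ i j : Fin n, |inner ℝ (fderiv ℝ u x (EuclideanSpace.single i 1))
        (Y' (EuclideanSpace.single j 1))| ≤ A * (A * (|Bz| * A)) * (δ * η₀) := by
      intro i j
      rw [hY']
      exact abs_inner_fderiv_smul_unitNormal_le hPx (ha.differentiableAt hU hx)
        (hDu.differentiableAt hU hx) hPn han ((hBz _ (hKu hx)).trans (le_abs_self _)) (hDDu x hx)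
        i j
    have hrem := norm_remainder_le hδ hδ1 hη0 hc1 hc2 hPn hY'n hV'n hPY
    refine (norm_colGram_corrugation_sub_le hPx ν (B := B) (S₁ := R₁) (S₂ := R₂)
      (q := η₀ / η) (θ := η * inner ℝ ν x) hB hδ hδ1 (by positivity)
      ((div_le_one hη0).2 hη) ?_ ?_ ?_ ?_ ?_ rfl).trans ?_
    · simp only [B]; linarith
    · simp only [B]; linarith [norm_nonneg ν]
    · have := hX.norm_le hx
      simp only [B]; linarith [norm_nonneg ν]
    · exact hrem.1
    · exact hrem.2
    · have h1 : 0 ≤ δ ^ 2 * (η₀ / η) := by positivity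
      have h2 : 0 ≤ δ ^ 4 := by positivity
      have h3 : C₁ ≤ A + CW + C₁ + C₂ := by linarith
      have h4 : C₂ ≤ A + CW + C₁ + C₂ := by linarith
      exact (add_le_add (mul_le_mul_of_nonneg_right h3 h1)
        (mul_le_mul_of_nonneg_right h4 h2)).trans (mul_add _ _ _).ge

end CorrugationStep

/-! ### Successive corrugations -/

section Iterate

open Matrix

variable {n : ℕ}

local notation "𝔼" => EuclideanSpace ℝ (Fin n)
local notation "𝔽" => EuclideanSpace ℝ (Fin (n + 1))

theorem norm_vecMulVec_self_le (ν : 𝔼) : ‖vecMulVec (ν : Fin n → ℝ) ν‖ ≤ n * ‖ν‖ ^ 2 := by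
  refine frobenius_norm_le_of_entries fun i j => ?_
  rw [vecMulVec_apply, abs_mul, sq]
  gcongr <;> exact PiLp.norm_apply_le ν _

/-- Corrugating successively in the directions `ν 0, ν 1, …`, with the frequency growing by the
factor `K` each time, and one derivative less under control each time. The smallness of `δ` keeps
the differentials within the compact set of immersions whose Gram matrix is `ρ`-close to `g₀`. -/
theorem exists_corrugation_iterate {g₀ : Matrix (Fin n) (Fin n) ℝ} {ρ : ℝ} (hρ : 0 < ρ)
    (hdet : ∀ A : Matrix (Fin n) (Fin n) ℝ, ‖A - g₀‖ ≤ ρ → A.det ≠ 0) {A : ℝ} (hA : 1 ≤ A)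
    (ν : ℕ → 𝔼) (N i : ℕ) (hi : i ≤ N) :
    ∃ C δ₁ : ℝ, 1 ≤ C ∧ 0 < δ₁ ∧ δ₁ ≤ 1 ∧ ∀ (U : Set 𝔼) (u : 𝔼 → 𝔽) (a : ℕ → 𝔼 → ℝ)
      (δ η₀ K : ℝ), IsOpen U → ContDiffOn ℝ ∞ u U → SymbolOn U (N + 1) A η₀ (fderiv ℝ u) →
      (∀ x ∈ U, ‖colGram (fderiv ℝ u x) (fderiv ℝ u x) - g₀‖ ≤ ρ / 2) →
      (∀ x ∈ U, ‖fderiv ℝ (fderiv ℝ u) x‖ ≤ A * (δ * η₀)) →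
      (∀ j < N, SymbolOn U (N + 1) A η₀ (a j)) →
      0 < δ → δ ≤ δ₁ → 1 ≤ η₀ → 1 ≤ K →
      ∃ v : 𝔼 → 𝔽, ContDiffOn ℝ ∞ v U ∧ SymbolOn U (N + 1 - i) C (η₀ * K ^ i) (fderiv ℝ v) ∧
        ∀ x ∈ U, ‖v x - u x‖ ≤ C * δ ∧ ‖fderiv ℝ v x - fderiv ℝ u x‖ ≤ C * δ ∧
        ‖fderiv ℝ (fderiv ℝ v) x‖ ≤ C * (δ * (η₀ * K ^ i)) ∧
        ‖colGram (fderiv ℝ v x) (fderiv ℝ v x) - colGram (fderiv ℝ u x) (fderiv ℝ u x) -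
          ∑ j ∈ Finset.range i, (δ ^ 2 * a j x ^ 2) • vecMulVec (ν j : Fin n → ℝ) (ν j)‖ ≤
          C * (δ ^ 2 / K + δ ^ 4) := by
  induction i with
  | zero =>
    refine ⟨A, 1, hA, one_pos, le_rfl, ?_⟩
    intro U u a δ η₀ K hU hu hDu hG hDDu ha hδ hδ1 hη₀ hK
    refine ⟨u, hu, by simpa using hDu, fun x hx => ⟨?_, ?_, by simpa using hDDu x hx, ?_⟩⟩
    · simp; positivity
    · simp; positivity
    · simp; positivity
  | succ i ih =>
    obtain ⟨C, δ₁, hC, hδ₁, hδ₁1, h⟩ := ih (by omega)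
    set A' := max A C
    have hA' : 1 ≤ A' := hA.trans (le_max_left _ _)
    have hKi : {P : 𝔼 →L[ℝ] 𝔽 | ‖colGram P P - g₀‖ ≤ ρ} ⊆ immersions n (n + 1) :=
      fun P hP => hdet _ hP
    obtain ⟨C₂, hC₂, h₂⟩ := exists_corrugation_step (isCompact_gram_le g₀ ρ) hKi hA' (ν i)
      (m := N - i) (by omega)
    set S := ∑ j ∈ Finset.range i, A ^ 2 * (n * ‖ν j‖ ^ 2)
    have hS : 0 ≤ S := by positivity
    set δ₂ := min δ₁ (min 1 (ρ / 2 / (S + 2 * C)))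
    have hδ₂ : 0 < δ₂ := by
      have : 0 < ρ / 2 / (S + 2 * C) := by positivity
      simp only [δ₂]; positivity
    refine ⟨C + C₂, δ₂, by linarith, hδ₂, (min_le_left _ _).trans hδ₁1, ?_⟩
    intro U u a δ η₀ K hU hu hDu hG hDDu ha hδ hδ1 hη₀ hK
    have hδδ₁ : δ ≤ δ₁ := hδ1.trans (min_le_left _ _)
    have hδ11 : δ ≤ 1 := hδ1.trans ((min_le_right _ _).trans (min_le_left _ _))
    have hδρ : δ * (S + 2 * C) ≤ ρ / 2 := by
      rw [← le_div_iff₀ (by positivity)]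
      exact hδ1.trans ((min_le_right _ _).trans (min_le_right _ _))
    obtain ⟨v, hv, hDv, hvx⟩ := h U u a δ η₀ K hU hu hDu hG hDDu ha hδ hδδ₁ hη₀ hK
    have hKp : 1 ≤ K ^ i := one_le_pow₀ hK
    have hη₀0 : 0 < η₀ := by linarith
    have hfreq : η₀ * K ^ i ≤ η₀ * K ^ (i + 1) := by
      rw [pow_succ]; gcongr; nlinarith
    have hη₀i : η₀ ≤ η₀ * K ^ i := le_mul_of_one_le_right hη₀0.le hKp
    have hmaps : MapsTo (fderiv ℝ v) U {P : 𝔼 →L[ℝ] 𝔽 | ‖colGram P P - g₀‖ ≤ ρ} := by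
      intro x hx
      have h1 := (hvx x hx).2.2.2
      have h2 := hG x hx
      have h3 : ‖∑ j ∈ Finset.range i, (δ ^ 2 * a j x ^ 2) •
          vecMulVec (ν j : Fin n → ℝ) (ν j)‖ ≤ δ ^ 2 * S := by
        rw [Finset.mul_sum]
        refine norm_sum_le_of_le _ fun j hj => ?_
        have hjN : j < N := by have := Finset.mem_range.1 hj; omega
        have haj := (ha j hjN).norm_le hx
        rw [norm_smul, norm_mul, norm_pow, norm_pow, Real.norm_of_nonneg hδ.le, mul_assoc]
        gcongr
        exact norm_vecMulVec_self_le _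
      have h4 : C * (δ ^ 2 / K + δ ^ 4) ≤ 2 * C * δ ^ 2 := by
        have e1 : δ ^ 2 / K ≤ δ ^ 2 := div_le_self (by positivity) hK
        have e2 : δ ^ 4 ≤ δ ^ 2 := pow_le_pow_of_le_one hδ.le hδ11 (by norm_num)
        nlinarith
      have h5 : δ ^ 2 * (S + 2 * C) ≤ ρ / 2 := by
        have : δ ^ 2 ≤ δ := by nlinarith
        exact (mul_le_mul_of_nonneg_right this (by positivity)).trans hδρ
      generalize (∑ j ∈ Finset.range i, (δ ^ 2 * a j x ^ 2) •
          vecMulVec (ν j : Fin n → ℝ) (ν j)) = Q at *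
      have e : colGram (fderiv ℝ v x) (fderiv ℝ v x) - g₀ =
        (colGram (fderiv ℝ v x) (fderiv ℝ v x) - colGram (fderiv ℝ u x) (fderiv ℝ u x) - Q) +
        Q + (colGram (fderiv ℝ u x) (fderiv ℝ u x) - g₀) := by abel
      rw [mem_ofPred_eq, e]
      have := norm_add₃_le (a := colGram (fderiv ℝ v x) (fderiv ℝ v x) -
        colGram (fderiv ℝ u x) (fderiv ℝ u x) - Q) (b := Q)
        (c := colGram (fderiv ℝ u x) (fderiv ℝ u x) - g₀)
      linarith
    obtain ⟨w, hw, hDw, hwx⟩ := h₂ U v (a i) δ (η₀ * K ^ i) (η₀ * K ^ (i + 1)) hU hv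
      (hDv.mono (by omega) (le_max_right _ _) (by linarith) (by positivity) le_rfl) hmaps
      (fun x hx => ((hvx x hx).2.2.1).trans (by gcongr; exact le_max_right _ _))
      ((ha i (by omega)).mono (by omega) (le_max_left _ _) (by linarith) (by positivity) hη₀i)
      hδ hδ11 (hη₀.trans hη₀i) hfreq
    refine ⟨w, hw, ?_, fun x hx => ?_⟩
    · have e : N + 1 - (i + 1) = N - i := by omega
      rw [e]
      exact hDw.mono_const (by linarith) (by positivity)
    obtain ⟨p1, p2, p3, p4⟩ := hvx x hx
    obtain ⟨q1, q2, q3, q4⟩ := hwx x hx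
    refine ⟨?_, ?_, ?_, ?_⟩
    · have := norm_add_le (w x - v x) (v x - u x)
      rw [sub_add_sub_cancel] at this
      linarith
    · have := norm_add_le (fderiv ℝ w x - fderiv ℝ v x) (fderiv ℝ v x - fderiv ℝ u x)
      rw [sub_add_sub_cancel] at this
      linarith
    · have : 0 ≤ C * (δ * (η₀ * K ^ (i + 1))) := by positivity
      linarith
    · have hratio : η₀ * K ^ i / (η₀ * K ^ (i + 1)) = 1 / K := by
        rw [pow_succ]; field_simp
      rw [hratio, mul_one_div] at q4
      rw [Finset.sum_range_succ]
      generalize (∑ j ∈ Finset.range i, (δ ^ 2 * a j x ^ 2) •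
          vecMulVec (ν j : Fin n → ℝ) (ν j)) = Q at *
      generalize (δ ^ 2 * a i x ^ 2) • vecMulVec (ν i : Fin n → ℝ) (ν i) = τ at *
      have e : colGram (fderiv ℝ w x) (fderiv ℝ w x) - colGram (fderiv ℝ u x) (fderiv ℝ u x) -
          (Q + τ) = (colGram (fderiv ℝ v x) (fderiv ℝ v x) -
            colGram (fderiv ℝ u x) (fderiv ℝ u x) - Q) +
          (colGram (fderiv ℝ w x) (fderiv ℝ w x) -
            colGram (fderiv ℝ v x) (fderiv ℝ v x) - τ) := by abel
      rw [e, add_mul]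
      exact (norm_add_le _ _).trans (add_le_add p4 q4)

end Iterate

/-! ### Cut-off and quadratic mollification estimates -/

section Cutoff

open Metric MeasureTheory

/-- A function of class `C^k` on a neighbourhood of a compact set agrees on that compact set with
a globally defined compactly supported one. -/
theorem exists_contDiff_hasCompactSupport_eqOn {E F : Type*} [NormedAddCommGroup E]
    [NormedSpace ℝ E] [FiniteDimensional ℝ E] [NormedAddCommGroup F] [NormedSpace ℝ F]
    {k : ℕ∞} {K U : Set E} (hK : IsCompact K) (hU : IsOpen U) (hKU : K ⊆ U) {f : E → F}
    (hf : ContDiffOn ℝ k f U) :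
    ∃ g : E → F, ContDiff ℝ k g ∧ HasCompactSupport g ∧ EqOn g f K := by
  obtain ⟨V, hV, hKV, hVU, hVc⟩ := exists_open_between_and_isCompact_closure hK hU hKU
  obtain ⟨χ, hχ, -, hsupp, h1⟩ := exists_contMDiff_support_eq_eq_one_iff
    (modelWithCornersSelf ℝ E) (n := k) hV hK.isClosed hKV
  have hχ' : ContDiff ℝ k χ := hχ.contDiff
  have hts : tsupport χ = closure V := by rw [tsupport, hsupp]
  refine ⟨fun x => χ x • f x, ?_, ?_, fun x hx => ?_⟩
  · rw [contDiff_iff_contDiffAt]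
    intro x
    by_cases hx : x ∈ tsupport χ
    · exact hχ'.contDiffAt.smul (hf.contDiffAt (hU.mem_nhds (hVU (hts ▸ hx))))
    · have : (fun x => χ x • f x) =ᶠ[nhds x] fun _ => 0 := by
        filter_upwards [(isClosed_tsupport χ).isOpen_compl.mem_nhds hx] with y hy
        rw [image_eq_zero_of_notMem_tsupport hy, zero_smul]
      exact contDiffAt_const.congr_of_eventuallyEq this
  · exact HasCompactSupport.smul_right (hts ▸ hVc : IsCompact (tsupport χ))
  · simp [(h1 x).1 hx]

variable {E : Type} [NormedAddCommGroup E] [InnerProductSpace ℝ E] [FiniteDimensional ℝ E]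
  [MeasurableSpace E] [BorelSpace E] {F G : Type} [NormedAddCommGroup F] [NormedSpace ℝ F]
  [NormedAddCommGroup G] [NormedSpace ℝ G]

variable (E F) in
theorem exists_norm_iteratedFDeriv_mollify_le_of_le (m : ℕ) :
    ∃ C : ℝ, 1 ≤ C ∧ ∀ (ℓ : ℝ) (f : E → F) (x : E) (A : ℝ), 0 < ℓ → Continuous f →
      (∀ y ∈ closedBall x ℓ, ‖f y‖ ≤ A) → ∀ k ≤ m,
      ‖iteratedFDeriv ℝ k (mollify ℓ f) x‖ ≤ C * A * ℓ⁻¹ ^ k := by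
  choose C hC1 hC using exists_norm_iteratedFDeriv_mollify_le E F
  have h0 : ∀ k, 0 ≤ C k := fun k => zero_le_one.trans (hC1 k)
  refine ⟨∑ k ∈ Finset.range (m + 1), C k, ?_, fun ℓ f x A hℓ hf hA k hk => ?_⟩
  · exact (hC1 0).trans (Finset.single_le_sum (f := C) (fun i _ => h0 i) (by simp))
  · have hA0 : 0 ≤ A := (norm_nonneg _).trans (hA x (mem_closedBall_self hℓ.le))
    refine (hC k ℓ f x A hℓ hf hA).trans ?_
    gcongr
    exact Finset.single_le_sum (f := C) (fun i _ => h0 i) (Finset.mem_range.2 (by omega))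

/-- Mollification commutes with a quadratic map up to an error which is quadratic in the
oscillation of the function at the scale of mollification. Freezing the value of the function at
a point changes neither side, so that only the oscillation enters. -/
theorem exists_norm_iteratedFDeriv_mollify_bilin_sub_le [CompleteSpace F] [CompleteSpace G]
    (B : F →L[ℝ] F →L[ℝ] G) (m : ℕ) :
    ∃ C : ℝ, 1 ≤ C ∧ ∀ (ℓ : ℝ) (w : E → F) (x : E) (b : ℝ), 0 < ℓ → Continuous w →
      (∀ y ∈ closedBall x ℓ, ‖w y - w x‖ ≤ b) → ∀ k ≤ m,
      ‖iteratedFDeriv ℝ k (fun z => mollify ℓ (fun y => B (w y) (w y)) z -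
        B (mollify ℓ w z) (mollify ℓ w z)) x‖ ≤ C * b ^ 2 * ℓ⁻¹ ^ k := by
  obtain ⟨C₁, hC₁, h₁⟩ := exists_norm_iteratedFDeriv_mollify_le_of_le E F m
  obtain ⟨C₂, hC₂, h₂⟩ := exists_norm_iteratedFDeriv_mollify_le_of_le E G m
  refine ⟨max 1 (C₂ * ‖B‖ + ‖B‖ * (2 ^ m * C₁ ^ 2)), le_max_left _ _,
    fun ℓ w x b hℓ hw hb k hk => ?_⟩
  have hb0 : 0 ≤ b := (norm_nonneg _).trans (hb x (mem_closedBall_self hℓ.le))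
  set w' : E → F := fun y => w y - w x with hw'
  have hw'c : Continuous w' := hw.sub continuous_const
  have hBc : Continuous fun y => B (w' y) (w' y) :=
    B.isBoundedBilinearMap.continuous.comp (hw'c.prodMk hw'c)
  have hm : ∀ z, mollify ℓ w z = mollify ℓ w' z + w x := fun z => by
    rw [hw', mollify_sub hw continuous_const, mollify_const]; abel
  have e : (fun z => mollify ℓ (fun y => B (w y) (w y)) z -
      B (mollify ℓ w z) (mollify ℓ w z)) = mollify ℓ (fun y => B (w' y) (w' y)) -
      fun z => B (mollify ℓ w' z) (mollify ℓ w' z) := by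
    ext1 z
    have e1 : (fun y => B (w y) (w y)) = fun y => B (w' y) (w' y) +
        ((B.flip (w x) + B (w x)) (w' y) + B (w x) (w x)) := by
      ext1 y
      simp only [hw', map_sub, _root_.sub_apply, _root_.add_apply,
        ContinuousLinearMap.flip_apply]
      abel
    have e2 : Continuous fun y => (B.flip (w x) + B (w x)) (w' y) :=
      (ContinuousLinearMap.continuous _).comp hw'c
    have e3 : Continuous fun y => (B.flip (w x) + B (w x)) (w' y) + B (w x) (w x) :=
      e2.add continuous_const
    rw [e1, mollify_add hBc e3, mollify_add e2 continuous_const,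
      mollify_const, mollify_clm _ hw'c, hm]
    simp only [map_add, _root_.add_apply, ContinuousLinearMap.flip_apply, Pi.sub_apply]
    abel
  have hs1 := contDiff_mollify hℓ.ne' hBc
  have hs2 := contDiff_mollify hℓ.ne' hw'c
  have hs3 : ContDiff ℝ ∞ fun z => B (mollify ℓ w' z) (mollify ℓ w' z) :=
    B.isBoundedBilinearMap.contDiff.comp (hs2.prodMk hs2)
  rw [e, iteratedFDeriv_sub_apply (hs1.contDiffAt.of_le (by exact_mod_cast le_top))
    (hs3.contDiffAt.of_le (by exact_mod_cast le_top))]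
  have b1 := h₂ ℓ (fun y => B (w' y) (w' y)) x (‖B‖ * b ^ 2) hℓ hBc (fun y hy => by
    refine (B.le_opNorm₂ _ _).trans ?_
    rw [mul_assoc, sq]
    have := hb y hy
    gcongr) k hk
  have b2 : ∀ i ≤ m, ‖iteratedFDeriv ℝ i (mollify ℓ w') x‖ ≤ C₁ * b * ℓ⁻¹ ^ i := fun i hi =>
    h₁ ℓ w' x b hℓ hw'c hb i hi
  have b3 := B.norm_iteratedFDeriv_le_of_bilinear (n := k) hs2 hs2 x (by exact_mod_cast le_top)
  have b4 : ∑ i ∈ Finset.range (k + 1), (k.choose i : ℝ) * ‖iteratedFDeriv ℝ i (mollify ℓ w') x‖ *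
      ‖iteratedFDeriv ℝ (k - i) (mollify ℓ w') x‖ ≤
      ∑ i ∈ Finset.range (k + 1), (k.choose i : ℝ) * (C₁ ^ 2 * b ^ 2 * ℓ⁻¹ ^ k) := by
    refine Finset.sum_le_sum fun i hi => ?_
    have hi' : i ≤ k := Nat.lt_succ_iff.1 (Finset.mem_range.1 hi)
    have e : C₁ ^ 2 * b ^ 2 * ℓ⁻¹ ^ k = (C₁ * b * ℓ⁻¹ ^ i) * (C₁ * b * ℓ⁻¹ ^ (k - i)) := by
      rw [← Nat.add_sub_cancel' hi', pow_add]; simp; ring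
    rw [e, mul_assoc]
    have p1 := b2 i (hi'.trans hk)
    have p2 := b2 (k - i) ((Nat.sub_le _ _).trans hk)
    gcongr
  rw [← Finset.sum_mul] at b4
  have hch : ∑ i ∈ Finset.range (k + 1), (k.choose i : ℝ) = 2 ^ k := by
    exact_mod_cast Nat.sum_range_choose k
  rw [hch] at b4
  have b5 : (2 : ℝ) ^ k ≤ 2 ^ m := pow_le_pow_right₀ (by norm_num) hk
  have hℓk : 0 ≤ ℓ⁻¹ ^ k := by positivity
  calc _ ≤ C₂ * (‖B‖ * b ^ 2) * ℓ⁻¹ ^ k + ‖B‖ * (2 ^ k * (C₁ ^ 2 * b ^ 2 * ℓ⁻¹ ^ k)) := by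
        refine (norm_sub_le _ _).trans (add_le_add b1 (b3.trans ?_))
        gcongr
    _ ≤ C₂ * (‖B‖ * b ^ 2) * ℓ⁻¹ ^ k + ‖B‖ * (2 ^ m * (C₁ ^ 2 * b ^ 2 * ℓ⁻¹ ^ k)) := by gcongr
    _ = (C₂ * ‖B‖ + ‖B‖ * (2 ^ m * C₁ ^ 2)) * b ^ 2 * ℓ⁻¹ ^ k := by ring
    _ ≤ _ := by gcongr; exact le_max_right _ _

end Cutoff

/-! ### One stage of the iteration -/

section Stage

open Matrix Metric

variable {n : ℕ}

local notation "𝔼" => EuclideanSpace ℝ (Fin n)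
local notation "𝔽" => EuclideanSpace ℝ (Fin (n + 1))

/-- The decomposition into primitive metrics with the index in `ℕ`, for use in an induction; the
directions and coefficients with index at least `n * (n + 1) / 2` are zero. -/
theorem exists_decomposition_sum_range {g₀ : Matrix (Fin n) (Fin n) ℝ} (hg₀ : g₀.PosDef) :
    ∃ (ν : ℕ → 𝔼) (L : ℕ → Matrix (Fin n) (Fin n) ℝ →L[ℝ] ℝ),
      (∀ j < n * (n + 1) / 2, 0 < L j g₀) ∧ ∀ H : Matrix (Fin n) (Fin n) ℝ, H.IsSymm →
        ∑ j ∈ Finset.range (n * (n + 1) / 2), L j H • vecMulVec (ν j : Fin n → ℝ) (ν j) = H := by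
  obtain ⟨ν, L, hL, hH⟩ := exists_primitive_decomposition hg₀
  refine ⟨fun j => if h : j < n * (n + 1) / 2 then WithLp.toLp 2 (ν ⟨j, h⟩) else 0,
    fun j => if h : j < n * (n + 1) / 2 then (L ⟨j, h⟩).toContinuousLinearMap else 0,
    fun j hj => ?_, fun H hs => ?_⟩
  · simp only [hj, dif_pos]; exact hL _
  · rw [Finset.sum_range]
    conv_rhs => rw [hH H hs]
    refine Finset.sum_congr rfl fun i _ => ?_
    simp

/-- Near `g₀` the amplitudes of the primitive metrics are smooth functions of the metric. -/
theorem exists_symbolOn_amplitude {g₀ : Matrix (Fin n) (Fin n) ℝ} (N : ℕ)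
    (L : ℕ → Matrix (Fin n) (Fin n) ℝ →L[ℝ] ℝ) (hL : ∀ j < N, 0 < L j g₀) :
    ∃ r₁ : ℝ, 0 < r₁ ∧ r₁ ≤ 1 ∧ ∀ (m : ℕ) (C : ℝ), ∃ A : ℝ, 1 ≤ A ∧ ∀ j < N,
      ∀ (U : Set 𝔼) (η : ℝ) (H : 𝔼 → Matrix (Fin n) (Fin n) ℝ), IsOpen U → 0 ≤ η →
      SymbolOn U m C η H → (∀ x ∈ U, ‖H x - g₀‖ ≤ 2 * r₁) →
      SymbolOn U m A η (fun x => √(L j (H x))) ∧ ∀ x ∈ U, 0 ≤ L j (H x) := by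
  have hV : ∀ j, IsOpen {H : Matrix (Fin n) (Fin n) ℝ | 0 < L j H} := fun j =>
    isOpen_lt continuous_const (L j).continuous
  have ho : IsOpen (⋂ j ∈ Finset.range N, {H : Matrix (Fin n) (Fin n) ℝ | 0 < L j H}) :=
    isOpen_biInter_finset fun j _ => hV j
  obtain ⟨ε, hε, hball⟩ := Metric.isOpen_iff.1 ho g₀ (by simpa using hL)
  set r₁ := min 1 (ε / 4)
  have hr₁ : 0 < r₁ := by positivity
  have hsub : ∀ j < N, closedBall g₀ (2 * r₁) ⊆ {H : Matrix (Fin n) (Fin n) ℝ | 0 < L j H} := by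
    intro j hj H hH
    have h1 : H ∈ ball g₀ ε := by
      rw [mem_ball]
      have h2 : dist H g₀ ≤ 2 * r₁ := hH
      have h3 : r₁ ≤ ε / 4 := min_le_right _ _
      linarith
    have h2 := hball h1
    simp only [mem_iInter] at h2
    exact h2 j (Finset.mem_range.2 hj)
  refine ⟨r₁, hr₁, min_le_left _ _, fun m C => ?_⟩
  have hex : ∀ j, ∃ A : ℝ, 1 ≤ A ∧ (j < N → ∀ (U : Set 𝔼) (η : ℝ)
      (H : 𝔼 → Matrix (Fin n) (Fin n) ℝ), IsOpen U → 0 ≤ η → SymbolOn U m C η H →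
      MapsTo H U (closedBall g₀ (2 * r₁)) → SymbolOn U m A η (fun x => √(L j (H x)))) := by
    intro j
    by_cases hj : j < N
    · have hs : ContDiffOn ℝ ∞ (fun H => √(L j H))
          {H : Matrix (Fin n) (Fin n) ℝ | 0 < L j H} :=
        (L j).contDiff.contDiffOn.sqrt fun H hH => ne_of_gt hH
      obtain ⟨A, hA, h⟩ := SymbolOn.exists_comp (E := 𝔼) (hV j)
        (isCompact_closedBall g₀ (2 * r₁)) (hsub j hj) hs m C
      exact ⟨A, hA, fun _ => h⟩
    · exact ⟨1, le_rfl, fun h => absurd h hj⟩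
  choose A hA hA' using hex
  have h0 : ∀ j, 0 ≤ A j := fun j => zero_le_one.trans (hA j)
  refine ⟨1 + ∑ j ∈ Finset.range N, A j, ?_, ?_⟩
  · have : 0 ≤ ∑ j ∈ Finset.range N, A j := Finset.sum_nonneg fun j _ => h0 j
    linarith
  · intro j hj U η H hU hη hH hHg
    have hm : MapsTo H U (closedBall g₀ (2 * r₁)) := fun x hx => by
      rw [mem_closedBall, dist_eq_norm]; exact hHg x hx
    refine ⟨(hA' j hj U η H hU hη hH hm).mono_const ?_ hη, fun x hx => ?_⟩
    · have := Finset.single_le_sum (f := A) (fun i _ => h0 i) (Finset.mem_range.2 hj)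
      linarith
    · exact le_of_lt (hsub j hj (hm hx))

theorem symbolOn_const {E F : Type*} [NormedAddCommGroup E] [NormedSpace ℝ E]
    [NormedAddCommGroup F] [NormedSpace ℝ F] (U : Set E) (m : ℕ) (c : F) {η : ℝ} (hη : 0 ≤ η) :
    SymbolOn U m ‖c‖ η (fun _ => c) := by
  refine ⟨contDiffOn_const, fun k _ x _ => ?_⟩
  cases k with
  | zero => simp
  | succ k =>
    rw [iteratedFDeriv_const_of_ne (by omega)]
    simp only [Pi.zero_apply, norm_zero]
    positivity

/-- The approximate solutions of the iteration: on the `d`-neighbourhood of `Ω`, the smooth map `u`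
is short by `δ ^ 2 * g₀`, up to the error `r₁ * δ ^ 2`, and `u` oscillates at frequency `freq` with
amplitude `δ`. The map is smooth on the whole space so that it can be mollified; the estimates only
concern the neighbourhood, which shrinks from one stage to the next. -/
structure IsApprox (Ω : Set 𝔼) (g : 𝔼 → Matrix (Fin n) (Fin n) ℝ) (g₀ : Matrix (Fin n) (Fin n) ℝ)
    (r₁ κ : ℝ) (u : 𝔼 → 𝔽) (δ freq d : ℝ) : Prop where
  contDiff : ContDiff ℝ ∞ u
  metric : ∀ x ∈ thickening d Ω,
    ‖g x - colGram (fderiv ℝ u x) (fderiv ℝ u x) - δ ^ 2 • g₀‖ ≤ r₁ * δ ^ 2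
  second : ∀ x ∈ thickening d Ω, ‖fderiv ℝ (fderiv ℝ u) x‖ ≤ κ * (δ * freq)

theorem closedBall_subset_thickening {E : Type*} [NormedAddCommGroup E] [NormedSpace ℝ E]
    {Ω : Set E} {d ℓ : ℝ} {x : E} (hx : x ∈ thickening (d - ℓ) Ω) :
    closedBall x ℓ ⊆ thickening d Ω := by
  obtain ⟨z, hz, hxz⟩ := mem_thickening_iff.1 hx
  intro y hy
  refine mem_thickening_iff.2 ⟨z, hz, ?_⟩
  have := dist_triangle y x z
  rw [mem_closedBall] at hy
  linarith

theorem isSymm_mollify {g : 𝔼 → Matrix (Fin n) (Fin n) ℝ} (hg : Continuous g)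
    (hs : ∀ x, (g x).IsSymm) (ℓ : ℝ) (x : 𝔼) : (mollify ℓ g x).IsSymm := by
  obtain ⟨T, hT⟩ : ∃ T : Matrix (Fin n) (Fin n) ℝ →L[ℝ] Matrix (Fin n) (Fin n) ℝ, ∀ A, T A = Aᵀ :=
    ⟨(Matrix.transposeLinearEquiv (Fin n) (Fin n) ℝ ℝ).toLinearMap.toContinuousLinearMap,
      fun A => rfl⟩
  have h := mollify_clm (ℓ := ℓ) T hg x
  have e : (fun y => T (g y)) = g := by
    ext1 y; rw [hT]; exact hs y
  have h' : T (mollify ℓ g x) = mollify ℓ g x :=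
    h.symm.trans (congrArg (fun f => mollify ℓ f x) e)
  rwa [hT] at h'

set_option maxHeartbeats 1000000 in
/-- Mollifying an approximate solution at the scale `ℓ = 1 / freq`. The defect of the metric of the
mollified map is controlled, together with its derivatives, by `δ ^ 2`. -/
theorem exists_mollified_approx (g₀ : Matrix (Fin n) (Fin n) ℝ) (m : ℕ) (M : ℝ) :
    ∃ C₁ C₃ : ℝ, 1 ≤ C₁ ∧ 1 ≤ C₃ ∧ ∀ (Ω : Set 𝔼) (g : 𝔼 → Matrix (Fin n) (Fin n) ℝ)
      (r₁ κ d δ ℓ k : ℝ) (u : 𝔼 → 𝔽), Continuous g → IsApprox Ω g g₀ r₁ κ u δ ℓ⁻¹ d →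
      0 ≤ r₁ → r₁ ≤ 1 → 0 < κ → κ ≤ 1 → 0 < δ → 0 < ℓ → 1 ≤ k →
      (∀ x ∈ thickening d Ω, ‖fderiv ℝ u x‖ ≤ M) →
      SymbolOn (thickening (d - ℓ) Ω) m C₁ ℓ⁻¹ (fderiv ℝ (mollify ℓ u)) ∧
      SymbolOn (thickening (d - ℓ) Ω) m C₁ ℓ⁻¹ (fun x => (δ ^ 2)⁻¹ • (mollify ℓ g x -
        (δ / k) ^ 2 • g₀ -
        colGram (fderiv ℝ (mollify ℓ u) x) (fderiv ℝ (mollify ℓ u) x))) ∧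
      ∀ x ∈ thickening (d - ℓ) Ω,
        ‖mollify ℓ u x - u x‖ ≤ M * ℓ ∧ ‖fderiv ℝ (mollify ℓ u) x - fderiv ℝ u x‖ ≤ κ * δ ∧
        ‖fderiv ℝ (mollify ℓ u) x‖ ≤ M ∧
        ‖fderiv ℝ (fderiv ℝ (mollify ℓ u)) x‖ ≤ κ * (δ * ℓ⁻¹) ∧
        ‖(δ ^ 2)⁻¹ • (mollify ℓ g x - (δ / k) ^ 2 • g₀ -
          colGram (fderiv ℝ (mollify ℓ u) x) (fderiv ℝ (mollify ℓ u) x)) - g₀‖ ≤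
          r₁ + C₃ * κ ^ 2 + ‖g₀‖ / k ^ 2 := by
  obtain ⟨B₁, hB₁, h₁⟩ := exists_norm_iteratedFDeriv_mollify_le_of_le 𝔼 (𝔼 →L[ℝ] 𝔽) m
  obtain ⟨B₂, hB₂, h₂⟩ :=
    exists_norm_iteratedFDeriv_mollify_le_of_le 𝔼 (Matrix (Fin n) (Fin n) ℝ) m
  obtain ⟨B₃, hB₃, h₃⟩ := exists_norm_iteratedFDeriv_mollify_bilin_sub_le (E := 𝔼)
    (gramL n (n + 1)) m
  refine ⟨B₁ * |M| + B₂ + B₃ + ‖g₀‖, B₃, ?_, hB₃, ?_⟩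
  · have : 0 ≤ B₁ * |M| := by positivity
    linarith [norm_nonneg g₀]
  intro Ω g r₁ κ d δ ℓ k u hg hu hr₁ hr₁1 hκ hκ1 hδ hℓ hk hM
  have hΩ : IsOpen (thickening (d - ℓ) Ω) := isOpen_thickening
  have hℓ' : 0 < ℓ⁻¹ := by positivity
  have hu1 : ContDiff ℝ 1 u := hu.contDiff.of_le (by exact_mod_cast le_top)
  have hDu : ContDiff ℝ ∞ (fderiv ℝ u) := hu.contDiff.fderiv_right (by simp)
  have hDu1 : ContDiff ℝ 1 (fderiv ℝ u) := hDu.of_le (by exact_mod_cast le_top)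
  have hDm : fderiv ℝ (mollify ℓ u) = mollify ℓ (fderiv ℝ u) := fderiv_mollify hu1
  have hDDm : fderiv ℝ (mollify ℓ (fderiv ℝ u)) = mollify ℓ (fderiv ℝ (fderiv ℝ u)) :=
    fderiv_mollify hDu1
  have hsub : ∀ x ∈ thickening (d - ℓ) Ω, closedBall x ℓ ⊆ thickening d Ω := fun x hx =>
    closedBall_subset_thickening hx
  have hosc : ∀ x ∈ thickening (d - ℓ) Ω, ∀ y ∈ closedBall x ℓ,
      ‖fderiv ℝ u y - fderiv ℝ u x‖ ≤ κ * δ := by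
    intro x hx y hy
    have h := (convex_closedBall x ℓ).norm_image_sub_le_of_norm_fderiv_le (𝕜 := ℝ)
      (f := fderiv ℝ u) (C := κ * (δ * ℓ⁻¹))
      (fun z _ => hDu1.differentiable (by simp) z)
      (fun z hz => hu.second z (hsub x hx hz)) (mem_closedBall_self hℓ.le) hy
    rw [mem_closedBall, dist_eq_norm] at hy
    calc _ ≤ κ * (δ * ℓ⁻¹) * ‖y - x‖ := h
      _ ≤ κ * (δ * ℓ⁻¹) * ℓ := by gcongr
      _ = κ * δ := by field_simp
  set f₁ : 𝔼 → Matrix (Fin n) (Fin n) ℝ := mollify ℓ fun y =>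
    g y - colGram (fderiv ℝ u y) (fderiv ℝ u y) - δ ^ 2 • g₀ with hf₁
  set f₂ : 𝔼 → Matrix (Fin n) (Fin n) ℝ := fun z =>
    mollify ℓ (fun y => gramL n (n + 1) (fderiv ℝ u y) (fderiv ℝ u y)) z -
      gramL n (n + 1) (mollify ℓ (fderiv ℝ u) z) (mollify ℓ (fderiv ℝ u) z) with hf₂
  have hGc : Continuous fun y => colGram (fderiv ℝ u y) (fderiv ℝ u y) :=
    continuous_gram_self.comp hDu.continuous
  have hGg : Continuous fun y => g y - colGram (fderiv ℝ u y) (fderiv ℝ u y) := hg.sub hGc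
  have hdc : Continuous fun y => g y - colGram (fderiv ℝ u y) (fderiv ℝ u y) - δ ^ 2 • g₀ :=
    (hg.sub hGc).sub continuous_const
  have hH : ∀ x, (δ ^ 2)⁻¹ • (mollify ℓ g x - (δ / k) ^ 2 • g₀ -
      colGram (fderiv ℝ (mollify ℓ u) x) (fderiv ℝ (mollify ℓ u) x)) =
      (δ ^ 2)⁻¹ • (f₁ x + f₂ x) + (1 - 1 / k ^ 2) • g₀ := by
    intro x
    have e1 : f₁ x = mollify ℓ g x - mollify ℓ (fun y => colGram (fderiv ℝ u y) (fderiv ℝ u y)) x -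
        δ ^ 2 • g₀ := by
      rw [hf₁, mollify_sub hGg continuous_const, mollify_sub hg hGc, mollify_const]
    rw [e1, hDm, hf₂]
    simp only [gramL_apply]
    have hk0 : k ≠ 0 := by positivity
    match_scalars <;> field_simp <;> ring
  have hs₁ : SymbolOn (thickening (d - ℓ) Ω) m (B₂ * (r₁ * δ ^ 2)) ℓ⁻¹ f₁ :=
    ⟨(contDiff_mollify hℓ.ne' hdc).contDiffOn, fun j hj x hx =>
      h₂ ℓ _ x _ hℓ hdc (fun y hy => hu.metric y (hsub x hx hy)) j hj⟩
  have hs₂ : SymbolOn (thickening (d - ℓ) Ω) m (B₃ * (κ * δ) ^ 2) ℓ⁻¹ f₂ := by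
    refine ⟨ContDiff.contDiffOn (ContDiff.sub (contDiff_mollify hℓ.ne' hGc) ?_),
      fun j hj x hx => h₃ ℓ _ x _ hℓ hDu.continuous (hosc x hx) j hj⟩
    have := contDiff_mollify hℓ.ne' hDu.continuous
    exact ((gramL n (n + 1)).contDiff.comp this).clm_apply this
  have hδ2 : |(δ ^ 2)⁻¹| = (δ ^ 2)⁻¹ := abs_of_pos (by positivity)
  have hk2 : |1 - 1 / k ^ 2| ≤ 1 := by
    have h1 : 1 / k ^ 2 ≤ 1 := by
      rw [div_le_one (by positivity)]; exact one_le_pow₀ hk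
    have h2 : 0 < 1 / k ^ 2 := by positivity
    rw [abs_of_nonneg (by linarith)]; linarith
  refine ⟨?_, ?_, fun x hx => ⟨?_, ?_, ?_, ?_, ?_⟩⟩
  · rw [hDm]
    refine ⟨(contDiff_mollify hℓ.ne' hDu.continuous).contDiffOn, fun j hj x hx => ?_⟩
    refine (h₁ ℓ (fderiv ℝ u) x M hℓ hDu.continuous (fun y hy => hM y (hsub x hx hy)) j hj).trans ?_
    gcongr
    have : B₁ * M ≤ B₁ * |M| := by gcongr; exact le_abs_self M
    linarith [norm_nonneg g₀]
  · simp only [hH]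
    have h := ((hs₁.add hΩ hs₂).const_smul hΩ (δ ^ 2)⁻¹).add hΩ
      ((symbolOn_const (thickening (d - ℓ) Ω) m g₀ hℓ'.le).const_smul hΩ (1 - 1 / k ^ 2))
    refine h.mono_const ?_ hℓ'.le
    have e1 : |(δ ^ 2)⁻¹| * (B₂ * (r₁ * δ ^ 2) + B₃ * (κ * δ) ^ 2) = B₂ * r₁ + B₃ * κ ^ 2 := by
      rw [hδ2]; field_simp
    rw [e1]
    have e2 : B₂ * r₁ ≤ B₂ := mul_le_of_le_one_right (by linarith) hr₁1
    have e3 : B₃ * κ ^ 2 ≤ B₃ := mul_le_of_le_one_right (by linarith) (by nlinarith)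
    have e4 : |1 - 1 / k ^ 2| * ‖g₀‖ ≤ ‖g₀‖ := mul_le_of_le_one_left (norm_nonneg _) hk2
    have e5 : 0 ≤ B₁ * |M| := by positivity
    linarith
  · refine norm_mollify_sub_le hℓ.le hu.contDiff.continuous fun y hy => ?_
    have h := (convex_closedBall x ℓ).norm_image_sub_le_of_norm_fderiv_le (𝕜 := ℝ)
      (f := u) (C := M) (fun z _ => hu1.differentiable (by simp) z)
      (fun z hz => hM z (hsub x hx hz)) (mem_closedBall_self hℓ.le) hy
    rw [mem_closedBall, dist_eq_norm] at hy
    have hM0 : 0 ≤ M := (norm_nonneg _).trans (hM x (hsub x hx (mem_closedBall_self hℓ.le)))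
    exact h.trans (by gcongr)
  · rw [hDm]
    exact norm_mollify_sub_le hℓ.le hDu.continuous (hosc x hx)
  · rw [hDm]
    exact norm_mollify_le hℓ.le fun y hy => hM y (hsub x hx hy)
  · rw [hDm, hDDm]
    exact norm_mollify_le hℓ.le fun y hy => hu.second y (hsub x hx hy)
  · rw [hH]
    have e1 : (δ ^ 2)⁻¹ • (f₁ x + f₂ x) + (1 - 1 / k ^ 2) • g₀ - g₀ =
        (δ ^ 2)⁻¹ • f₁ x + (δ ^ 2)⁻¹ • f₂ x - (1 / k ^ 2) • g₀ := by module
    have b1 : ‖f₁ x‖ ≤ r₁ * δ ^ 2 :=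
      norm_mollify_le hℓ.le fun y hy => hu.metric y (hsub x hx hy)
    have b2 := hs₂.norm_le hx
    have c1 : ‖(δ ^ 2)⁻¹ • f₁ x‖ ≤ r₁ := by
      rw [norm_smul, Real.norm_eq_abs, hδ2, inv_mul_le_iff₀ (by positivity), mul_comm]
      exact b1
    have c2 : ‖(δ ^ 2)⁻¹ • f₂ x‖ ≤ B₃ * κ ^ 2 := by
      rw [norm_smul, Real.norm_eq_abs, hδ2, inv_mul_le_iff₀ (by positivity)]
      exact b2.trans (by apply le_of_eq; ring)
    have c3 : ‖(1 / k ^ 2) • g₀‖ = ‖g₀‖ / k ^ 2 := by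
      rw [norm_smul, Real.norm_of_nonneg (by positivity)]; ring
    rw [e1]
    refine (norm_sub_le _ _).trans ?_
    have := norm_add_le ((δ ^ 2)⁻¹ • f₁ x) ((δ ^ 2)⁻¹ • f₂ x)
    linarith

set_option maxHeartbeats 1000000 in
/-- One stage: an approximate solution with amplitude `δ` is replaced by one with the smaller
amplitude `δ / k`, at the price of the larger frequency `A * k ^ (2 * N + 1) * freq`, where
`N = n * (n + 1) / 2` is the number of primitive metrics. Each of the `N` corrugations raises the
frequency by a factor proportional to `k ^ 2`, so that its error is a small part of `(δ / k) ^ 2`;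
the last factor `k` makes up for the smaller amplitude in the bound on the second derivative. -/
theorem exists_stage {g₀ : Matrix (Fin n) (Fin n) ℝ} (hg₀ : g₀.PosDef) :
    ∃ r₁ κ ρ C A kmin δs : ℝ, 0 < r₁ ∧ 0 < κ ∧ 0 < ρ ∧ 1 ≤ C ∧ 1 ≤ A ∧ 1 ≤ kmin ∧ 0 < δs ∧
      ∀ (Ω : Set 𝔼) (g : 𝔼 → Matrix (Fin n) (Fin n) ℝ) (d : ℝ), Bornology.IsBounded Ω →
      Continuous g → (∀ x, (g x).IsSymm) → (∀ x ∈ thickening d Ω, ‖g x - g₀‖ ≤ ρ) →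
      ∀ (u : 𝔼 → 𝔽) (δ freq k : ℝ), IsApprox Ω g g₀ r₁ κ u δ freq d → 0 < δ → kmin ≤ k →
      k * δ ≤ δs → 1 ≤ freq → 1 ≤ δ * freq → 2 / freq < d →
      (∀ x y, ‖x - y‖ ≤ 1 / freq → ‖g x - g y‖ ≤ r₁ / 4 * (δ / k) ^ 2) →
      ∃ u' : 𝔼 → 𝔽,
        IsApprox Ω g g₀ r₁ κ u' (δ / k) (A * k ^ (2 * (n * (n + 1) / 2) + 1) * freq)
          (d - 2 / freq) ∧
        ∀ x ∈ thickening (d - 2 / freq) Ω,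
          ‖u' x - u x‖ ≤ C * δ ∧ ‖fderiv ℝ u' x - fderiv ℝ u x‖ ≤ C * δ := by
  obtain ⟨ν, L, hL, hdec⟩ := exists_decomposition_sum_range hg₀
  set N := n * (n + 1) / 2 with hN
  obtain ⟨r₁, hr₁, hr₁1, hamp⟩ := exists_symbolOn_amplitude N L hL
  obtain ⟨ρd, hρd, hdet⟩ := exists_det_ne_zero_of_norm_sub_le hg₀
  set ρ₀ := min ρd 1 with hρ₀d
  have hρ₀ : 0 < ρ₀ := lt_min hρd one_pos
  have hρ₀1 : ρ₀ ≤ 1 := min_le_right _ _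
  have hdet' : ∀ A : Matrix (Fin n) (Fin n) ℝ, ‖A - g₀‖ ≤ ρ₀ → A.det ≠ 0 := fun A hA =>
    hdet A (hA.trans (min_le_left _ _))
  set G := ‖g₀‖ with hG
  have hG0 : 0 ≤ G := norm_nonneg _
  set M : ℝ := n * √(G + 1) with hM
  have hM0 : 0 ≤ M := by positivity
  obtain ⟨C₁, C₃, hC₁, hC₃, hmol⟩ := exists_mollified_approx g₀ (N + 1) M
  obtain ⟨Aa, hAa, hamp⟩ := hamp (N + 1) C₁
  set A₀ := max C₁ Aa with hA₀
  have hA₀1 : 1 ≤ A₀ := hC₁.trans (le_max_left _ _)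
  obtain ⟨Ci, δ₁, hCi, hδ₁, hδ₁1, hit⟩ := exists_corrugation_iterate hρ₀ hdet' hA₀1 ν N N le_rfl
  have hCi0 : 0 < Ci := one_pos.trans_le hCi
  have hC₃0 : 0 < C₃ := one_pos.trans_le hC₃
  -- `κ` bounds the oscillation of `fderiv ℝ u` at the scale of mollification, so that the
  -- commutator of the mollification and the metric is at most `r₁ / 2 * δ ^ 2`.
  set κ := min 1 (r₁ / (2 * C₃)) with hκd
  have hκ : 0 < κ := lt_min one_pos (by positivity)
  have hκ1 : κ ≤ 1 := min_le_left _ _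
  have hκr : C₃ * κ ^ 2 ≤ r₁ / 2 := by
    have h1 : κ ≤ r₁ / (2 * C₃) := min_le_right _ _
    rw [le_div_iff₀ (by positivity)] at h1
    have h2 : κ ^ 2 ≤ κ := pow_le_of_le_one hκ.le hκ1 two_ne_zero
    have h3 : C₃ * κ ^ 2 ≤ C₃ * κ := by gcongr
    linarith
  -- The factor `Ck * k ^ 2` between frequencies leaves a quarter of `r₁ * (δ / k) ^ 2` for the
  -- errors of the corrugations. The bound `δs` does the same for their part of order `δ ^ 4`, and
  -- keeps the maps immersed.
  set Ck := max 1 (4 * Ci / r₁) with hCkd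
  have hCk1 : 1 ≤ Ck := le_max_left _ _
  have hCkr : 4 * Ci ≤ Ck * r₁ := by
    have h1 : 4 * Ci / r₁ ≤ Ck := le_max_right _ _
    rwa [div_le_iff₀ hr₁] at h1
  have hA1 : 1 ≤ Ci * Ck ^ N / κ := by
    rw [le_div_iff₀ hκ, one_mul]
    have h1 : 1 ≤ Ck ^ N := one_le_pow₀ hCk1
    have h2 : 1 ≤ Ci * Ck ^ N := one_le_mul_of_one_le_of_one_le hCi h1
    linarith
  set δs := min (min δ₁ (ρ₀ / (8 * (G + 1)))) (min (ρ₀ / (8 * (n * M + 1))) (r₁ / (4 * Ci)))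
    with hδs
  have hδs0 : 0 < δs := by positivity
  have hs1 : δs ≤ δ₁ := (min_le_left _ _).trans (min_le_left _ _)
  have hs2 : δs * (8 * (G + 1)) ≤ ρ₀ := by
    rw [← le_div_iff₀ (by positivity)]; exact (min_le_left _ _).trans (min_le_right _ _)
  have hs3 : δs * (8 * (n * M + 1)) ≤ ρ₀ := by
    rw [← le_div_iff₀ (by positivity)]; exact (min_le_right _ _).trans (min_le_left _ _)
  have hs4 : δs * (4 * Ci) ≤ r₁ := by
    rw [← le_div_iff₀ (by positivity)]; exact (min_le_right _ _).trans (min_le_right _ _)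
  refine ⟨r₁, κ, ρ₀ / 8, Ci + M + 1, Ci * Ck ^ N / κ, max 1 (2 * G / r₁), δs, hr₁, hκ,
    by positivity, by linarith, hA1, le_max_left _ _, hδs0, ?_⟩
  intro Ω g d hΩb hgc hgs hgρ u δ freq k hu hδ hk hkδ hf hδf hd hosc
  have hk1 : 1 ≤ k := (le_max_left _ _).trans hk
  have hk0 : 0 < k := one_pos.trans_le hk1
  have hkG : G / k ^ 2 ≤ r₁ / 2 := by
    have h1 : 2 * G / r₁ ≤ k := (le_max_right _ _).trans hk
    rw [div_le_iff₀ hr₁] at h1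
    rw [div_le_iff₀ (by positivity)]
    have h2 : k * (r₁ / 2) ≤ k ^ 2 * (r₁ / 2) := by
      gcongr; exact le_self_pow₀ hk1 two_ne_zero
    linarith
  have hδδs : δ ≤ δs := (le_mul_of_one_le_left hδ.le hk1).trans hkδ
  have hδ1 : δ ≤ 1 := hδδs.trans (hs1.trans hδ₁1)
  have hδ2 : δ ^ 2 ≤ δ := pow_le_of_le_one hδ.le hδ1 two_ne_zero
  have hf0 : 0 < freq := one_pos.trans_le hf
  set ℓ := 1 / freq with hℓd
  have hℓ : 0 < ℓ := by positivity
  have hℓf : ℓ⁻¹ = freq := by rw [hℓd, one_div, inv_inv]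
  have hdℓ : d - 2 / freq = d - ℓ - ℓ := by rw [hℓd]; ring
  have hd' : 0 < d - ℓ - ℓ := by rw [← hdℓ]; linarith
  -- The Gram matrix of `u` is close to `g₀`.
  have hgram : ∀ x ∈ thickening d Ω,
      ‖colGram (fderiv ℝ u x) (fderiv ℝ u x) - g₀‖ ≤ ρ₀ / 8 + ρ₀ / 8 := by
    intro x hx
    have h1 := hu.metric x hx
    have h2 := hgρ x hx
    have e : colGram (fderiv ℝ u x) (fderiv ℝ u x) - g₀ = (g x - g₀) -
        (g x - colGram (fderiv ℝ u x) (fderiv ℝ u x) - δ ^ 2 • g₀) - δ ^ 2 • g₀ := by abel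
    have h3 : ‖δ ^ 2 • g₀‖ = δ ^ 2 * G := by rw [norm_smul, Real.norm_of_nonneg (by positivity)]
    rw [e]
    have h4 := norm_sub_le ((g x - g₀) -
      (g x - colGram (fderiv ℝ u x) (fderiv ℝ u x) - δ ^ 2 • g₀)) (δ ^ 2 • g₀)
    have h5 := norm_sub_le (g x - g₀)
      (g x - colGram (fderiv ℝ u x) (fderiv ℝ u x) - δ ^ 2 • g₀)
    have h6 : r₁ * δ ^ 2 ≤ δ := (mul_le_of_le_one_left (sq_nonneg _) hr₁1).trans hδ2
    have h7 : δ ^ 2 * G ≤ δ * G := by gcongr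
    have h8 : δ * (G + 1) ≤ δs * (G + 1) := by gcongr
    linarith
  have hMu : ∀ x ∈ thickening d Ω, ‖fderiv ℝ u x‖ ≤ M := by
    intro x hx
    refine (norm_le_of_gram _).trans ?_
    rw [hM]
    gcongr
    have h1 := hgram x hx
    have h2 := norm_le_norm_add_norm_sub' (colGram (fderiv ℝ u x) (fderiv ℝ u x)) g₀
    linarith
  have hu' : IsApprox Ω g g₀ r₁ κ u δ ℓ⁻¹ d := by rwa [hℓf]
  obtain ⟨hS₁, hS₂, hpt⟩ := hmol Ω g r₁ κ d δ ℓ k u hgc hu' hr₁.le hr₁1 hκ hκ1 hδ hℓ hk1 hMu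
  set w := mollify ℓ u with hw
  -- `H` is the rescaled metric to be added to that of `w`, leaving the defect `(δ / k) ^ 2 • g₀`.
  set H : 𝔼 → Matrix (Fin n) (Fin n) ℝ := fun x => (δ ^ 2)⁻¹ • (mollify ℓ g x -
        (δ / k) ^ 2 • g₀ - colGram (fderiv ℝ w x) (fderiv ℝ w x)) with hH
  set U := thickening (d - ℓ) Ω with hU
  have hUo : IsOpen U := isOpen_thickening
  have hUd : U ⊆ thickening d Ω := thickening_mono (by linarith) Ω
  have hH2 : ∀ x ∈ U, ‖H x - g₀‖ ≤ 2 * r₁ := by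
    intro x hx
    have := (hpt x hx).2.2.2.2
    linarith
  have hHs : ∀ x, (H x).IsSymm := by
    intro x
    have h0 : g₀.IsSymm := by
      have := hg₀.isHermitian
      rwa [Matrix.IsHermitian, Matrix.conjTranspose_eq_transpose_of_trivial] at this
    exact (((isSymm_mollify hgc hgs ℓ x).sub (h0.smul _)).sub (gram_transpose _)).smul _
  have hf' : (0 : ℝ) ≤ ℓ⁻¹ := by positivity
  have hamp' : ∀ j < N, SymbolOn U (N + 1) A₀ ℓ⁻¹ (fun x => √(L j (H x))) ∧
      ∀ x ∈ U, 0 ≤ L j (H x) := fun j hj =>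
    have h := hamp j hj U ℓ⁻¹ H hUo hf' hS₂ hH2
    ⟨h.1.mono_const (le_max_right _ _) hf', h.2⟩
  set K := Ck * k ^ 2 with hK
  have hK1 : 1 ≤ K := one_le_mul_of_one_le_of_one_le hCk1 (one_le_pow₀ hk1)
  have hwc : ContDiff ℝ ∞ w := contDiff_mollify hℓ.ne' hu.contDiff.continuous
  have hnM : (n : ℝ) * M * δ ≤ ρ₀ / 8 := by
    have h1 : δ * (n * M + 1) ≤ δs * (n * M + 1) := by gcongr
    linarith
  obtain ⟨v, hv, -, hvp⟩ := hit U w (fun j x => √(L j (H x))) δ ℓ⁻¹ K hUo hwc.contDiffOn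
    (hS₁.mono_const (le_max_left _ _) hf')
    (by
      intro x hx
      obtain ⟨-, h2, h3, -, -⟩ := hpt x hx
      have h4 := hgram x (hUd hx)
      have h5 := norm_gram_sub_gram_le (fderiv ℝ w x) (fderiv ℝ u x)
      have h6 : (n : ℝ) * ((‖fderiv ℝ w x‖ + ‖fderiv ℝ u x‖) * ‖fderiv ℝ w x - fderiv ℝ u x‖) ≤
          n * ((M + M) * δ) := by
        gcongr
        · exact hMu x (hUd hx)
        · exact h2.trans (mul_le_of_le_one_left hδ.le hκ1)
      have h7 := norm_sub_le_norm_sub_add_norm_sub (colGram (fderiv ℝ w x) (fderiv ℝ w x))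
        (colGram (fderiv ℝ u x) (fderiv ℝ u x)) g₀
      linarith)
    (by
      intro x hx
      refine (hpt x hx).2.2.2.1.trans ?_
      have : κ ≤ A₀ := hκ1.trans hA₀1
      gcongr)
    (fun j hj => (hamp' j hj).1) hδ (hδδs.trans hs1) (by rwa [hℓf]) hK1
  -- The map is globalized by a cutoff away from the final neighbourhood.
  have hsub : cthickening (d - ℓ - ℓ) Ω ⊆ U :=
    cthickening_subset_thickening' (by linarith) (by linarith) Ω
  have hcomp : IsCompact (cthickening (d - ℓ - ℓ) Ω) :=
    Metric.isCompact_of_isClosed_isBounded isClosed_cthickening hΩb.cthickening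
  obtain ⟨u', hu'c, -, hu'v⟩ := exists_contDiff_hasCompactSupport_eqOn (k := ⊤) hcomp hUo hsub hv
  have hloc : ∀ x ∈ thickening (d - ℓ - ℓ) Ω, u' =ᶠ[nhds x] v := fun x hx =>
    Filter.eventuallyEq_of_mem (isOpen_thickening.mem_nhds hx)
      (hu'v.mono (thickening_subset_cthickening _ _))
  have hTU : thickening (d - ℓ - ℓ) Ω ⊆ U := (thickening_subset_cthickening _ _).trans hsub
  have hTd : thickening (d - ℓ - ℓ) Ω ⊆ thickening d Ω := hTU.trans hUd
  rw [hdℓ]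
  refine ⟨u', ⟨hu'c, fun x hx => ?_, fun x hx => ?_⟩, fun x hx => ⟨?_, ?_⟩⟩
  · rw [(hloc x hx).fderiv_eq]
    have h1 := (hvp x (hTU hx)).2.2.2
    have hsum : ∑ j ∈ Finset.range N, (δ ^ 2 * √(L j (H x)) ^ 2) •
        vecMulVec (ν j : Fin n → ℝ) (ν j) = δ ^ 2 • H x := by
      conv_rhs => rw [← hdec (H x) (hHs x), Finset.smul_sum]
      refine Finset.sum_congr rfl fun j hj => ?_
      rw [Real.sq_sqrt ((hamp' j (Finset.mem_range.1 hj)).2 x (hTU hx)), smul_smul]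
    have hδH : δ ^ 2 • H x = mollify ℓ g x - (δ / k) ^ 2 • g₀ -
        colGram (fderiv ℝ w x) (fderiv ℝ w x) := by
      rw [hH]; simp only; rw [smul_inv_smul₀ (by positivity)]
    rw [hsum, hδH] at h1
    have h2 : ‖mollify ℓ g x - g x‖ ≤ r₁ / 4 * (δ / k) ^ 2 := by
      refine norm_mollify_sub_le hℓ.le hgc fun y hy => hosc y x ?_
      rwa [mem_closedBall, dist_eq_norm] at hy
    have e : g x - colGram (fderiv ℝ v x) (fderiv ℝ v x) - (δ / k) ^ 2 • g₀ =
        -(mollify ℓ g x - g x) - (colGram (fderiv ℝ v x) (fderiv ℝ v x) -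
          colGram (fderiv ℝ w x) (fderiv ℝ w x) - (mollify ℓ g x - (δ / k) ^ 2 • g₀ -
        colGram (fderiv ℝ w x) (fderiv ℝ w x))) := by abel
    rw [e]
    refine (norm_sub_le _ _).trans ?_
    rw [norm_neg]
    have h3 : Ci * (δ ^ 2 / K) ≤ r₁ / 4 * (δ / k) ^ 2 := by
      rw [hK, div_pow]
      have : Ci * (δ ^ 2 / (Ck * k ^ 2)) = Ci / Ck * (δ ^ 2 / k ^ 2) := by field_simp
      rw [this]
      refine mul_le_mul_of_nonneg_right ?_ (by positivity)
      rw [div_le_iff₀ (by positivity)]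
      linarith
    have h4 : Ci * δ ^ 4 ≤ r₁ / 4 * (δ / k) ^ 2 := by
      have h5 : (k * δ) ^ 2 ≤ k * δ := by
        have : k * δ ≤ 1 := hkδ.trans (hs1.trans hδ₁1)
        exact pow_le_of_le_one (by positivity) this two_ne_zero
      have h6 : Ci * (k * δ) ^ 2 ≤ r₁ / 4 := by
        have : Ci * (k * δ) ^ 2 ≤ Ci * δs := by gcongr; exact h5.trans hkδ
        linarith
      have h7 : Ci * δ ^ 4 = Ci * (k * δ) ^ 2 * (δ / k) ^ 2 := by field_simp
      rw [h7]
      exact mul_le_mul_of_nonneg_right h6 (by positivity)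
    have h5 : 0 ≤ r₁ * (δ / k) ^ 2 := by positivity
    linarith
  · rw [((hloc x hx).fderiv).fderiv_eq]
    refine (hvp x (hTU hx)).2.2.1.trans (le_of_eq ?_)
    rw [hK, hℓf, mul_pow, ← pow_mul]
    field_simp
    ring
  · rw [(hloc x hx).eq_of_nhds]
    have h1 := (hvp x (hTU hx)).1
    have h2 := (hpt x (hTU hx)).1
    have h3 : M * ℓ ≤ M * δ := by
      gcongr
      rw [hℓd, div_le_iff₀ hf0]; exact hδf
    have h4 := norm_sub_le_norm_sub_add_norm_sub (v x) (w x) (u x)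
    linarith
  · rw [(hloc x hx).fderiv_eq]
    have h1 := (hvp x (hTU hx)).2.1
    have h2 := (hpt x (hTU hx)).2.1
    have h4 := norm_sub_le_norm_sub_add_norm_sub (fderiv ℝ v x) (fderiv ℝ w x) (fderiv ℝ u x)
    have h5 : κ * δ ≤ δ := mul_le_of_le_one_left hδ.le hκ1
    have h6 : 0 ≤ M * δ := by positivity
    linarith

end Stage

/-! ### Passage to the limit -/

section Limit

open Metric Filter Topology

theorem norm_iteratedFDeriv_one_sub {E F : Type*} [NormedAddCommGroup E] [NormedSpace ℝ E]
    [NormedAddCommGroup F] [NormedSpace ℝ F] (f : E → F) (x y : E) :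
    ‖iteratedFDeriv ℝ 1 f x - iteratedFDeriv ℝ 1 f y‖ = ‖fderiv ℝ f x - fderiv ℝ f y‖ := by
  rw [← dist_eq_norm, ← dist_eq_norm, ← iteratedFDerivWithin_univ, ← fderivWithin_univ]
  exact dist_iteratedFDerivWithin_one f f uniqueDiffWithinAt_univ uniqueDiffWithinAt_univ

/-- A map of class `C^1` on a neighbourhood of the closure of `Ω` whose derivative is Hölder
continuous on `Ω` belongs to `C^{1,α}`. -/
theorem isCkHolder_one_of_contDiffOn {E F : Type*} [NormedAddCommGroup E] [NormedSpace ℝ E]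
    [NormedAddCommGroup F] [NormedSpace ℝ F] {Ω V : Set E} {f : E → F} {α : ℝ} (hV : IsOpen V)
    (hΩ : closure Ω ⊆ V) (hf : ContDiffOn ℝ 1 f V)
    (hH : ∃ H : ℝ, ∀ x ∈ Ω, ∀ y ∈ Ω, ‖fderiv ℝ f x - fderiv ℝ f y‖ ≤ H * ‖x - y‖ ^ α) :
    IsCkHolder 1 α Ω f := by
  refine ⟨hf.mono (subset_closure.trans hΩ), hf.continuousOn.mono hΩ, fun m hm =>
    ⟨iteratedFDeriv ℝ m f, ?_, fun _ _ => rfl⟩, ?_⟩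
  · refine ContinuousOn.mono ?_ hΩ
    have h := hf.continuousOn_iteratedFDerivWithin (m := m) (by exact_mod_cast hm) hV.uniqueDiffOn
    exact h.congr fun x hx => (iteratedFDerivWithin_of_isOpen m hV hx).symm
  · obtain ⟨H, hH⟩ := hH
    exact ⟨H, fun x hx y hy => by rw [norm_iteratedFDeriv_one_sub]; exact hH x hx y hy⟩

/-- A sequence with geometrically decaying increments converges, at the same rate. -/
theorem exists_tendsto_of_le_geometric {G : Type*} [NormedAddCommGroup G] [CompleteSpace G]
    {f : ℕ → G} {B r : ℝ} (hB : 0 ≤ B) (hr0 : 0 ≤ r) (hr : r ≤ 1 / 2)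
    (h : ∀ q, ‖f (q + 1) - f q‖ ≤ B * r ^ q) :
    ∃ a, Tendsto f atTop (𝓝 a) ∧ ∀ q, ‖a - f q‖ ≤ 2 * B * r ^ q := by
  have h3 : ∀ q, dist (f q) (f (q + 1)) ≤ B * r ^ q := fun q => by
    rw [dist_comm, dist_eq_norm]; exact h q
  obtain ⟨a, ha⟩ := cauchySeq_tendsto_of_complete
    (cauchySeq_of_le_geometric r B (by linarith) h3)
  refine ⟨a, ha, fun q => ?_⟩
  have h4 := dist_le_of_le_geometric_of_tendsto r B (by linarith) h3 ha q
  rw [← dist_eq_norm, dist_comm]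
  refine h4.trans ?_
  rw [div_le_iff₀ (by linarith)]
  have h5 : 0 ≤ B * r ^ q := by positivity
  nlinarith

/-- If the increments of a sequence of maps decay geometrically in `C^1` with ratio `1 / k`, while
the second derivatives grow with ratio `Λ / k`, then the limit has Hölder continuous derivatives
with every exponent `α` such that `Λ ^ α ≤ k`. -/
theorem exists_holder_limit {E F : Type*} [NormedAddCommGroup E] [NormedSpace ℝ E]
    [FiniteDimensional ℝ E] [NormedAddCommGroup F] [NormedSpace ℝ F] [CompleteSpace F]
    {Ω : Set E} (hΩ : Bornology.IsBounded Ω) {e C κ δ k freq Λ α : ℝ} {U : ℕ → E → F}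
    (hU : ∀ q, ContDiff ℝ 2 (U q)) (hC : 0 ≤ C) (hκ : 0 ≤ κ) (hδ : 0 < δ) (hk : 2 ≤ k)
    (hf : 0 < freq) (hΛ : 1 < Λ) (hα : 0 < α) (hΛα : Λ ^ α ≤ k) (he : 1 / freq ≤ e)
    (h0 : ∀ q, ∀ x ∈ thickening e Ω, ‖U (q + 1) x - U q x‖ ≤ C * (δ / k ^ q))
    (h1 : ∀ q, ∀ x ∈ thickening e Ω,
      ‖fderiv ℝ (U (q + 1)) x - fderiv ℝ (U q) x‖ ≤ C * (δ / k ^ q))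
    (h2 : ∀ q, ∀ x ∈ thickening e Ω,
      ‖fderiv ℝ (fderiv ℝ (U q)) x‖ ≤ κ * (δ / k ^ q * (freq * Λ ^ q))) :
    ∃ v : E → F, IsCkHolder 1 α Ω v ∧ ∀ x ∈ thickening e Ω,
      Tendsto (fun q => fderiv ℝ (U q) x) atTop (𝓝 (fderiv ℝ v x)) ∧
      ‖v x - U 0 x‖ ≤ 2 * (C * δ) ∧ ‖fderiv ℝ v x - fderiv ℝ (U 0) x‖ ≤ 2 * (C * δ) := by
  have hk0 : 0 < k := by linarith
  have he0 : 0 < e := lt_of_lt_of_le (by positivity) he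
  set V := thickening e Ω with hVd
  have hV : IsOpen V := isOpen_thickening
  set r := k⁻¹ with hr
  have hr0 : 0 < r := by positivity
  have hr1 : r ≤ 1 / 2 := by rw [hr, inv_le_comm₀ hk0 (by norm_num)]; linarith
  have hgeo : ∀ q : ℕ, C * (δ / k ^ q) = C * δ * r ^ q := fun q => by
    rw [hr, inv_pow]; ring
  have hCδ : 0 ≤ C * δ := by positivity
  have hex0 : ∀ x, ∃ a, x ∈ V → Tendsto (fun q => U q x) atTop (𝓝 a) ∧
      ∀ q, ‖a - U q x‖ ≤ 2 * (C * δ) * r ^ q := fun x => by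
    by_cases hx : x ∈ V
    · obtain ⟨a, ha⟩ := exists_tendsto_of_le_geometric hCδ hr0.le hr1 (f := fun q => U q x)
        fun q => (h0 q x hx).trans_eq (hgeo q)
      exact ⟨a, fun _ => ha⟩
    · exact ⟨0, fun h => absurd h hx⟩
  have hex1 : ∀ x, ∃ a, x ∈ V → Tendsto (fun q => fderiv ℝ (U q) x) atTop (𝓝 a) ∧
      ∀ q, ‖a - fderiv ℝ (U q) x‖ ≤ 2 * (C * δ) * r ^ q := fun x => by
    by_cases hx : x ∈ V
    · obtain ⟨a, ha⟩ := exists_tendsto_of_le_geometric hCδ hr0.le hr1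
        (f := fun q => fderiv ℝ (U q) x) fun q => (h1 q x hx).trans_eq (hgeo q)
      exact ⟨a, fun _ => ha⟩
    · exact ⟨0, fun h => absurd h hx⟩
  choose v hv using hex0
  choose w hw using hex1
  have hlim : Tendsto (fun q : ℕ => 2 * (C * δ) * r ^ q) atTop (𝓝 0) := by
    simpa using (tendsto_pow_atTop_nhds_zero_of_lt_one hr0.le (by linarith)).const_mul (2 * (C * δ))
  have hunif : TendstoUniformlyOn (fun q x => fderiv ℝ (U q) x) w atTop V := by
    rw [Metric.tendstoUniformlyOn_iff]
    intro ε hε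
    filter_upwards [hlim.eventually (gt_mem_nhds hε)] with q hq x hx
    rw [dist_eq_norm]
    exact ((hw x hx).2 q).trans_lt hq
  have hDc : ∀ q, Continuous (fderiv ℝ (U q)) := fun q => (hU q).continuous_fderiv (by simp)
  have hwc : ContinuousOn w V :=
    hunif.continuousOn (Eventually.of_forall fun q => (hDc q).continuousOn).frequently
  have hder : ∀ x ∈ V, HasFDerivAt v (w x) x := fun x hx =>
    hasFDerivAt_of_tendstoUniformlyOn hV hunif
      (fun q y _ => ((hU q).differentiable (by simp) y).hasFDerivAt) (fun y hy => (hv y hy).1) hx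
  have hvc : ContDiffOn ℝ 1 v V := by
    rw [show (1 : WithTop ℕ∞) = 0 + 1 from rfl, contDiffOn_succ_iff_fderiv_of_isOpen hV]
    exact ⟨fun x hx => (hder x hx).differentiableAt.differentiableWithinAt, by simp,
      contDiffOn_zero.2 <| hwc.congr fun x hx => (hder x hx).fderiv⟩
  have hΩV : Ω ⊆ V := self_subset_thickening he0 Ω
  refine ⟨v, isCkHolder_one_of_contDiffOn hV (closure_subset_thickening he0 Ω) hvc ?_,
    fun x hx => ⟨?_, ?_, ?_⟩⟩
  · have : ProperSpace E := FiniteDimensional.proper ℝ E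
    obtain ⟨B, hB⟩ := (hΩ.isCompact_closure).exists_bound_of_continuousOn (hDc 0).continuousOn
    have hw0 : ∀ x ∈ Ω, ‖w x‖ ≤ B + 2 * (C * δ) := fun x hx => by
      have h3 := (hw x (hΩV hx)).2 0
      have h4 := hB x (subset_closure hx)
      have h5 := norm_le_norm_add_norm_sub' (w x) (fderiv ℝ (U 0) x)
      simp only [pow_zero, mul_one] at h3
      linarith
    refine ⟨((4 * C + κ) * δ * k + 2 * (|B| + 2 * (C * δ))) * freq ^ α, fun x hx y hy => ?_⟩
    rw [(hder x (hΩV hx)).fderiv, (hder y (hΩV hy)).fderiv]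
    set s := ‖x - y‖ with hs
    have hB0 : B ≤ |B| := le_abs_self B
    rcases eq_or_lt_of_le (norm_nonneg (x - y)) with hxy | hxy
    · have : x = y := by rw [← sub_eq_zero, ← norm_eq_zero]; exact hxy.symm
      subst this
      simp only [sub_self, norm_zero]
      positivity
    rw [mul_assoc, ← Real.mul_rpow hf.le hxy.le]
    rcases le_or_gt 1 (freq * s) with hfs | hfs
    · have h3 : 1 ≤ (freq * s) ^ α := Real.one_le_rpow hfs hα.le
      have h4 := norm_sub_le (w x) (w y)
      have h5 := hw0 x hx
      have h6 := hw0 y hy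
      have h7 : 2 * (|B| + 2 * (C * δ)) ≤ (4 * C + κ) * δ * k + 2 * (|B| + 2 * (C * δ)) := by
        have : 0 ≤ (4 * C + κ) * δ * k := by positivity
        linarith
      calc ‖w x - w y‖ ≤ (4 * C + κ) * δ * k + 2 * (|B| + 2 * (C * δ)) := by linarith
        _ ≤ _ := le_mul_of_one_le_right (by positivity) h3
    · have hfs0 : 0 < freq * s := by positivity
      obtain ⟨q, hq1, hq2⟩ := exists_nat_pow_near (x := (freq * s)⁻¹) (y := Λ)
        ((one_le_inv₀ hfs0).2 hfs.le) hΛ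
      have hseg : closedBall x s ⊆ V := by
        intro z hz
        refine mem_thickening_iff.2 ⟨x, hx, lt_of_le_of_lt hz (lt_of_lt_of_le ?_ he)⟩
        rwa [lt_div_iff₀ hf, mul_comm]
      have hyx : y ∈ closedBall x s := by rw [mem_closedBall, dist_comm, dist_eq_norm]
      have h3 := (convex_closedBall x s).norm_image_sub_le_of_norm_fderiv_le (𝕜 := ℝ)
        (f := fderiv ℝ (U q))
        (fun z _ => ((hU q).fderiv_right (m := 1) (by norm_num)).differentiable (by simp) z)
        (fun z hz => h2 q z (hseg hz)) hyx (mem_closedBall_self hxy.le)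
      have h4 : κ * (δ / k ^ q * (freq * Λ ^ q)) * ‖x - y‖ ≤ κ * (δ * r ^ q) := by
        have h5 : Λ ^ q * (freq * s) ≤ 1 := by rwa [← le_div_iff₀ hfs0, one_div]
        calc _ = κ * (δ * r ^ q) * (Λ ^ q * (freq * s)) := by rw [hr, inv_pow]; ring
          _ ≤ κ * (δ * r ^ q) * 1 := by gcongr
          _ = _ := mul_one _
      have h5 : ‖w x - w y‖ ≤ (4 * C + κ) * δ * r ^ q := by
        have e : w x - w y = (w x - fderiv ℝ (U q) x) +
          (fderiv ℝ (U q) x - fderiv ℝ (U q) y) - (w y - fderiv ℝ (U q) y) := by abel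
        have h6 := (hw x (hΩV hx)).2 q
        have h7 := (hw y (hΩV hy)).2 q
        have h8 := norm_sub_le (w x - fderiv ℝ (U q) x + (fderiv ℝ (U q) x - fderiv ℝ (U q) y))
          (w y - fderiv ℝ (U q) y)
        have h9 := norm_add_le (w x - fderiv ℝ (U q) x) (fderiv ℝ (U q) x - fderiv ℝ (U q) y)
        rw [e]
        linarith
      have h6 : r ^ q ≤ k * (freq * s) ^ α := by
        have h7 : r ^ (q + 1) ≤ (freq * s) ^ α := by
          have h8 : ((freq * s) ^ α)⁻¹ ≤ k ^ (q + 1) := by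
            rw [← Real.inv_rpow hfs0.le]
            calc ((freq * s)⁻¹) ^ α ≤ (Λ ^ (q + 1)) ^ α :=
                  Real.rpow_le_rpow (by positivity) hq2.le hα.le
              _ = (Λ ^ α) ^ (q + 1) := by
                  rw [← Real.rpow_natCast, ← Real.rpow_natCast, ← Real.rpow_mul (by linarith),
                    ← Real.rpow_mul (by linarith), mul_comm]
              _ ≤ k ^ (q + 1) := by gcongr
          rw [hr, inv_pow]
          exact inv_le_of_inv_le₀ (by positivity) h8
        calc r ^ q = k * r ^ (q + 1) := by rw [hr, pow_succ]; field_simp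
          _ ≤ _ := by gcongr
      calc ‖w x - w y‖ ≤ (4 * C + κ) * δ * (k * (freq * s) ^ α) := by
            refine h5.trans ?_
            gcongr
        _ = (4 * C + κ) * δ * k * (freq * s) ^ α := by ring
        _ ≤ _ := by
            gcongr
            have : 0 ≤ 2 * (|B| + 2 * (C * δ)) := by positivity
            linarith
  · rw [(hder x hx).fderiv]; exact (hw x hx).1
  · simpa using (hv x hx).2 0
  · rw [(hder x hx).fderiv]; simpa using (hw x hx).2 0

/-- The choice of the ratio `k` of the amplitudes and the ratio `Λ` of the frequencies. The
frequencies have to grow by the factor `A * k ^ (2 * N + 1)` of a stage, and fast enough for the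
oscillation `Λ ^ (-β)` of the metric to beat the factor `k ^ (-2)` of the defect; the exponent `α`
allows no more than `Λ ^ α ≤ k`. These are compatible for large `k` when `α < 1 / (1 + 2 * N)` and
`α < β / 2`. -/
theorem exists_ratios {α β A k₀ : ℝ} {N : ℕ} (hαN : α < 1 / (1 + 2 * (N : ℝ)))
    (hβ : 0 < β) (hαβ : α < β / 2) (hA : 1 ≤ A) :
    ∃ k Λ : ℝ, k₀ ≤ k ∧ 2 ≤ k ∧ k ≤ Λ ∧ A * k ^ (2 * N + 1) ≤ Λ ∧ k ^ 2 ≤ Λ ^ β ∧ Λ ^ α ≤ k := by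
  set γ := 1 - α * (2 * N + 1) with hγ
  have hN : (0 : ℝ) < 1 + 2 * N := by positivity
  have hγ0 : 0 < γ := by
    rw [lt_div_iff₀ hN] at hαN
    rw [hγ]; linarith
  set k := max (max k₀ 2) ((A ^ α) ^ (1 / γ)) with hk
  have hk0 : k₀ ≤ k := (le_max_left _ _).trans (le_max_left _ _)
  have hk2 : 2 ≤ k := (le_max_right _ _).trans (le_max_left _ _)
  have hk3 : (A ^ α) ^ (1 / γ) ≤ k := le_max_right _ _
  have hkp : 0 < k := by linarith
  have hA0 : 0 < A := by linarith
  have hk4 : A ^ α ≤ k ^ γ := by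
    have h := Real.rpow_le_rpow (by positivity) hk3 hγ0.le
    rwa [← Real.rpow_mul (by positivity), one_div_mul_cancel hγ0.ne', Real.rpow_one] at h
  have h1 : (A * k ^ (2 * N + 1)) ^ α ≤ k := by
    rw [Real.mul_rpow hA0.le (by positivity), ← Real.rpow_natCast, ← Real.rpow_mul hkp.le]
    calc A ^ α * k ^ (((2 * N + 1 : ℕ) : ℝ) * α) ≤ k ^ γ * k ^ (((2 * N + 1 : ℕ) : ℝ) * α) := by
          gcongr
      _ = k := by
          rw [← Real.rpow_add hkp]
          push_cast
          rw [show γ + (2 * (N : ℝ) + 1) * α = 1 by rw [hγ]; ring, Real.rpow_one]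
  have h2 : (k ^ (2 / β)) ^ α ≤ k := by
    rw [← Real.rpow_mul hkp.le]
    conv_rhs => rw [← Real.rpow_one k]
    refine Real.rpow_le_rpow_of_exponent_le (by linarith) ?_
    rw [div_mul_eq_mul_div, div_le_one hβ]
    linarith
  refine ⟨k, max (A * k ^ (2 * N + 1)) (k ^ (2 / β)), hk0, hk2, ?_, le_max_left _ _, ?_, ?_⟩
  · refine le_trans ?_ (le_max_left _ _)
    calc k ≤ k ^ (2 * N + 1) := le_self_pow₀ (by linarith) (by omega)
      _ ≤ _ := le_mul_of_one_le_left (by positivity) hA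
  · calc k ^ 2 = (k ^ (2 / β)) ^ β := by
          rw [← Real.rpow_mul hkp.le, div_mul_cancel₀ _ hβ.ne', Real.rpow_two]
      _ ≤ _ := Real.rpow_le_rpow (by positivity) (le_max_right _ _) hβ.le
  · rcases max_cases (A * k ^ (2 * N + 1)) (k ^ (2 / β)) with h | h <;> rw [h.1]
    · exact h1
    · exact h2

end Limit

/-! ### Exact solutions near approximate ones -/

section Iteration

open Metric Filter Topology

variable {n : ℕ}

local notation "𝔼" => EuclideanSpace ℝ (Fin n)
local notation "𝔽" => EuclideanSpace ℝ (Fin (n + 1))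

theorem IsApprox.mono {Ω : Set 𝔼} {g : 𝔼 → Matrix (Fin n) (Fin n) ℝ}
    {g₀ : Matrix (Fin n) (Fin n) ℝ} {r₁ κ δ freq freq' d d' : ℝ} {u : 𝔼 → 𝔽}
    (h : IsApprox Ω g g₀ r₁ κ u δ freq d) (hκ : 0 ≤ κ) (hδ : 0 ≤ δ) (hf : freq ≤ freq')
    (hd : d' ≤ d) : IsApprox Ω g g₀ r₁ κ u δ freq' d' := by
  refine ⟨h.contDiff, fun x hx => h.metric x (thickening_mono hd Ω hx), fun x hx =>
    (h.second x (thickening_mono hd Ω hx)).trans ?_⟩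
  gcongr

/-- At high frequency the oscillation of a `β`-Hölder function at the scale `1 / freq` is small.
-/
theorem eventually_mul_one_div_rpow_le (H : ℝ) {β ε : ℝ} (hβ : 0 < β) (hε : 0 < ε) :
    ∀ᶠ freq : ℝ in atTop, H * (1 / freq) ^ β ≤ ε := by
  have h : Tendsto (fun t : ℝ => H * t ^ (-β)) atTop (𝓝 0) := by
    simpa using (tendsto_rpow_neg_atTop hβ).const_mul H
  filter_upwards [h.eventually (gt_mem_nhds hε), eventually_gt_atTop 0] with t ht ht0
  rw [one_div, Real.inv_rpow ht0.le, ← Real.rpow_neg ht0.le]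
  exact ht.le

/-- Dependent choice: a step preserving the invariants `P q` can be repeated indefinitely. -/
theorem exists_seq_of_step {X : Type*} {P : ℕ → X → Prop} {R : ℕ → X → X → Prop} {x₀ : X}
    (h0 : P 0 x₀) (h : ∀ q x, P q x → ∃ y, P (q + 1) y ∧ R q x y) :
    ∃ U : ℕ → X, U 0 = x₀ ∧ (∀ q, P q (U q)) ∧ ∀ q, R q (U q) (U (q + 1)) := by
  choose! f hf hR using h
  have hP : ∀ q, P q (Nat.rec x₀ f q) := fun q => by
    induction q with
    | zero => exact h0
    | succ q ih => exact hf q _ ih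
  exact ⟨fun q => Nat.rec x₀ f q, rfl, hP, fun q => hR q _ (hP q)⟩

/-- Near an approximate solution there is an exact one. Finitely many stages with a fixed ratio
first make the amplitude as small as the large ratio required by `α` demands; infinitely many
stages with that ratio then converge in `C^{1,α}`. -/
theorem exists_isometric_of_isApprox {g₀ : Matrix (Fin n) (Fin n) ℝ} (hg₀ : g₀.PosDef) :
    ∃ r₁ κ ρ C δs : ℝ, 0 < r₁ ∧ 0 < κ ∧ 0 < ρ ∧ 1 ≤ C ∧ 0 < δs ∧
      ∀ (Ω : Set 𝔼) (g : 𝔼 → Matrix (Fin n) (Fin n) ℝ) (d H β : ℝ), Bornology.IsBounded Ω →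
      Continuous g → (∀ x, (g x).IsSymm) → 0 ≤ H → (∀ x y, ‖g x - g y‖ ≤ H * ‖x - y‖ ^ β) →
      0 < β → 0 < d → (∀ x ∈ thickening d Ω, ‖g x - g₀‖ ≤ ρ) →
      ∀ (u : 𝔼 → 𝔽) (δ freq α : ℝ), IsApprox Ω g g₀ r₁ κ u δ freq d → 0 < δ → δ ≤ δs →
      0 < α → α < 1 / (1 + 2 * ((n * (n + 1) / 2 : ℕ) : ℝ)) → α < β / 2 →
      ∃ v : 𝔼 → 𝔽, IsCkHolder 1 α Ω v ∧ ∀ x ∈ Ω,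
        colGram (fderiv ℝ v x) (fderiv ℝ v x) = g x ∧
        ‖v x - u x‖ ≤ C * δ ∧ ‖fderiv ℝ v x - fderiv ℝ u x‖ ≤ C * δ := by
  obtain ⟨r₁, κ, ρ, C, A, kmin, δs, hr₁, hκ, hρ, hC, hA, hkmin, hδs, stage⟩ := exists_stage hg₀
  set N := n * (n + 1) / 2
  set k₁ := max kmin 2
  have hk₁ : kmin ≤ k₁ := le_max_left _ _
  have hk₁2 : 2 ≤ k₁ := le_max_right _ _
  have hk₁0 : 0 < k₁ := by linarith
  have hC0 : 0 < C := by linarith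
  refine ⟨r₁, κ, ρ, 4 * C, δs / k₁, hr₁, hκ, hρ, by linarith, by positivity, ?_⟩
  intro Ω g d H β hΩ hgc hgs hH hHol hβ hd hgρ u δ freq α hu hδ hδδs hα hαN hαβ
  rw [le_div_iff₀ hk₁0] at hδδs
  have hosc : ∀ freq ε : ℝ, 0 < freq → H * (1 / freq) ^ β ≤ ε →
      ∀ x y, ‖x - y‖ ≤ 1 / freq → ‖g x - g y‖ ≤ ε := fun freq ε hf hε x y hxy =>
    (hHol x y).trans (le_trans (by gcongr) hε)
  have hgρ' : ∀ d' ≤ d, ∀ x ∈ thickening d' Ω, ‖g x - g₀‖ ≤ ρ := fun d' hd' x hx =>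
    hgρ x (thickening_mono hd' Ω hx)
  have hdle : ∀ (e : ℝ) (q : ℕ), 0 < e → e / 2 + e / 2 / 2 ^ q ≤ e := fun e q he => by
    have : e / 2 / 2 ^ q ≤ e / 2 := div_le_self (by positivity) (one_le_pow₀ (by norm_num))
    linarith
  have hdsucc : ∀ (e : ℝ) (q : ℕ), e / 2 + e / 2 / 2 ^ (q + 1) =
      e / 2 + e / 2 / 2 ^ q - e / 4 / 2 ^ q := fun e q => by
    rw [pow_succ]; field_simp; ring
  have hdle' : ∀ (q : ℕ), δ / k₁ ^ q ≤ δ / 2 ^ q := fun q => by gcongr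
  -- Stages with the fixed ratio `k₁`. The frequency need not be controlled here, so that at each
  -- stage it may be raised as far as the hypotheses of the stage require.
  have phase : ∀ q : ℕ, ∃ (w : 𝔼 → 𝔽) (fr : ℝ),
      IsApprox Ω g g₀ r₁ κ w (δ / k₁ ^ q) fr (d / 2 + d / 2 / 2 ^ q) ∧
      ∀ x ∈ thickening (d / 2 + d / 2 / 2 ^ q) Ω, ‖w x - u x‖ ≤ C * (2 * δ - 2 * (δ / 2 ^ q)) ∧
        ‖fderiv ℝ w x - fderiv ℝ u x‖ ≤ C * (2 * δ - 2 * (δ / 2 ^ q)) := by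
    intro q
    induction q with
    | zero =>
      refine ⟨u, freq, ?_, fun x _ => by simp⟩
      simpa using hu
    | succ q ih =>
      obtain ⟨w, fr, hw, hwu⟩ := ih
      have hδq : 0 < δ / k₁ ^ q := by positivity
      have hδqδ : δ / k₁ ^ q ≤ δ := div_le_self hδ.le (one_le_pow₀ (by linarith))
      have hdq : 0 < d / 4 / 2 ^ q := by positivity
      obtain ⟨f, hf1, hf2, hf3, hf4, hf5⟩ := ((eventually_ge_atTop (1 : ℝ)).and
        ((eventually_ge_atTop fr).and ((eventually_ge_atTop (1 / (δ / k₁ ^ q))).and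
        ((eventually_ge_atTop (2 / (d / 4 / 2 ^ q))).and
        (eventually_mul_one_div_rpow_le H hβ
          (by positivity : 0 < r₁ / 4 * (δ / k₁ ^ q / k₁) ^ 2)))))).exists
      have hf0 : 0 < f := by linarith
      have hf4' : 2 / f ≤ d / 4 / 2 ^ q := by
        rw [div_le_iff₀ hdq] at hf4
        rw [div_le_iff₀ hf0]; linarith
      rw [div_le_iff₀ hδq] at hf3
      have hd4 : d / 4 / 2 ^ q ≤ d / 4 := div_le_self (by positivity) (one_le_pow₀ (by norm_num))
      have hd5 : 0 < d / 2 / 2 ^ q := by positivity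
      obtain ⟨w', hw', hww'⟩ := stage Ω g _ hΩ hgc hgs (hgρ' _ (hdle d q hd)) w (δ / k₁ ^ q) f k₁
        (hw.mono hκ.le hδq.le hf2 le_rfl) hδq hk₁ (by nlinarith) hf1 (by linarith) (by linarith)
        (hosc _ _ hf0 hf5)
      have hsub : d / 2 + d / 2 / 2 ^ (q + 1) ≤ d / 2 + d / 2 / 2 ^ q - 2 / f := by
        rw [hdsucc]; linarith
      have hδs' : δ / k₁ ^ q / k₁ = δ / k₁ ^ (q + 1) := by rw [pow_succ]; field_simp
      rw [hδs'] at hw'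
      have hδ2 : δ / 2 ^ (q + 1) = δ / 2 ^ q / 2 := by rw [pow_succ]; field_simp
      have hCq : C * (δ / k₁ ^ q) ≤ C * (δ / 2 ^ q) := by gcongr
      refine ⟨w', _, hw'.mono hκ.le (by positivity) le_rfl hsub, fun x hx => ?_⟩
      have hx1 := thickening_mono hsub Ω hx
      have hx2 : x ∈ thickening (d / 2 + d / 2 / 2 ^ q) Ω :=
        thickening_mono (by linarith [div_nonneg zero_le_two hf0.le]) Ω hx1
      have a1 := norm_sub_le_norm_sub_add_norm_sub (w' x) (w x) (u x)
      have a2 := norm_sub_le_norm_sub_add_norm_sub (fderiv ℝ w' x) (fderiv ℝ w x) (fderiv ℝ u x)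
      have a3 := hww' x hx1
      have a4 := hwu x hx2
      rw [hδ2]
      constructor <;> linarith [a3.1, a3.2, a4.1, a4.2]
  obtain ⟨k, Λ, hkk₁, hk2, hkΛ, hAΛ, hkβ, hΛα⟩ := exists_ratios (k₀ := k₁) hαN hβ hαβ hA
  have hk0 : 0 < k := by linarith
  have hΛ2 : 2 ≤ Λ := hk2.trans hkΛ
  have hΛ0 : 0 < Λ := by linarith
  obtain ⟨q₀, hq₀⟩ : ∃ q : ℕ, k * (δ / k₁ ^ q) ≤ δs := by
    have h : Tendsto (fun q : ℕ => k * δ * (k₁⁻¹) ^ q) atTop (𝓝 0) := by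
      simpa using (tendsto_pow_atTop_nhds_zero_of_lt_one (r := k₁⁻¹) (by positivity)
        (inv_lt_one_of_one_lt₀ (by linarith))).const_mul (k * δ)
    obtain ⟨q, hq⟩ := (h.eventually (gt_mem_nhds hδs)).exists
    refine ⟨q, le_of_eq_of_le ?_ hq.le⟩
    rw [inv_pow]; ring
  obtain ⟨u₁, fr, hu₁, hu₁u⟩ := phase q₀
  set δ' := δ / k₁ ^ q₀ with hδ'
  have hδ'0 : 0 < δ' := by positivity
  have hδ'δ : δ' ≤ δ := div_le_self hδ.le (one_le_pow₀ (by linarith))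
  set e := d / 2 with he
  have he0 : 0 < e := by positivity
  have hed : e ≤ e + e / 2 ^ q₀ := by
    have : 0 ≤ e / 2 ^ q₀ := by positivity
    linarith
  obtain ⟨f, hf1, hf2, hf3, hf4, hf5⟩ := ((eventually_ge_atTop (1 : ℝ)).and
    ((eventually_ge_atTop fr).and ((eventually_ge_atTop (1 / δ')).and
    ((eventually_ge_atTop (8 / e)).and (eventually_mul_one_div_rpow_le H hβ
      (by positivity : 0 < r₁ / 4 * (δ' / k) ^ 2)))))).exists
  have hf0 : 0 < f := by linarith
  rw [div_le_iff₀ hδ'0] at hf3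
  rw [div_le_iff₀ he0] at hf4
  -- Stages with the ratio `k`, during which the frequencies are exactly `f * Λ ^ q`.
  obtain ⟨U, hU0, hUP, hUR⟩ := exists_seq_of_step
    (P := fun (q : ℕ) (w : 𝔼 → 𝔽) =>
      IsApprox Ω g g₀ r₁ κ w (δ' / k ^ q) (f * Λ ^ q) (e / 2 + e / 2 / 2 ^ q))
    (R := fun (q : ℕ) (w w' : 𝔼 → 𝔽) => ∀ x ∈ thickening (e / 2) Ω,
      ‖w' x - w x‖ ≤ C * (δ' / k ^ q) ∧ ‖fderiv ℝ w' x - fderiv ℝ w x‖ ≤ C * (δ' / k ^ q))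
    (x₀ := u₁) (by simpa using hu₁.mono hκ.le hδ'0.le hf2 hed) (by
      intro q w hw
      have hkq : 1 ≤ k ^ q := one_le_pow₀ (by linarith)
      have hΛq : 1 ≤ Λ ^ q := one_le_pow₀ (by linarith)
      have hδq : 0 < δ' / k ^ q := by positivity
      have hf0' : 0 < f * Λ ^ q := by positivity
      have h2f : 2 / (f * Λ ^ q) ≤ e / 4 / 2 ^ q := by
        have h1 : (2 : ℝ) ^ q ≤ Λ ^ q := by gcongr
        have h2 : 2 / f ≤ e / 4 := by
          rw [div_le_iff₀ hf0]; linarith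
        rw [← div_div]
        gcongr
      have hd4 : e / 4 / 2 ^ q ≤ e / 4 := div_le_self (by positivity) (one_le_pow₀ (by norm_num))
      have hd5 : 0 < e / 2 / 2 ^ q := by positivity
      have hkΛq : k ^ q ≤ Λ ^ q := by gcongr
      have hsmall : H * (1 / (f * Λ ^ q)) ^ β ≤ r₁ / 4 * (δ' / k ^ q / k) ^ 2 := by
        have h1 : (1 / (f * Λ ^ q)) ^ β ≤ (1 / f) ^ β * ((k ^ q) ^ 2)⁻¹ := by
          rw [one_div, mul_inv, ← one_div, Real.mul_rpow (by positivity) (by positivity)]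
          gcongr
          rw [Real.inv_rpow (by positivity)]
          gcongr
          calc (k ^ q) ^ 2 = (k ^ 2) ^ q := by rw [← pow_mul, ← pow_mul, mul_comm]
            _ ≤ (Λ ^ β) ^ q := by gcongr
            _ = (Λ ^ q) ^ β := by
              rw [← Real.rpow_natCast, ← Real.rpow_natCast, ← Real.rpow_mul hΛ0.le,
                ← Real.rpow_mul hΛ0.le, mul_comm]
        calc H * (1 / (f * Λ ^ q)) ^ β ≤ H * ((1 / f) ^ β * ((k ^ q) ^ 2)⁻¹) := by gcongr
          _ = H * (1 / f) ^ β * ((k ^ q) ^ 2)⁻¹ := by ring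
          _ ≤ r₁ / 4 * (δ' / k) ^ 2 * ((k ^ q) ^ 2)⁻¹ := by gcongr
          _ = _ := by field_simp
      obtain ⟨w', hw', hww'⟩ := stage Ω g _ hΩ hgc hgs
        (hgρ' _ ((hdle e q he0).trans (by rw [he]; linarith))) w (δ' / k ^ q) (f * Λ ^ q) k
        hw hδq (hk₁.trans hkk₁)
        (le_trans (by gcongr; exact div_le_self hδ'0.le hkq) hq₀)
        (one_le_mul_of_one_le_of_one_le hf1 hΛq) (by
          rw [show δ' / k ^ q * (f * Λ ^ q) = f * δ' * (Λ ^ q / k ^ q) by ring]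
          exact one_le_mul_of_one_le_of_one_le hf3 ((one_le_div (by positivity)).2 hkΛq))
        (by linarith) (hosc _ _ hf0' hsmall)
      have hsub : e / 2 + e / 2 / 2 ^ (q + 1) ≤ e / 2 + e / 2 / 2 ^ q - 2 / (f * Λ ^ q) := by
        rw [hdsucc]; linarith
      have hδs' : δ' / k ^ q / k = δ' / k ^ (q + 1) := by rw [pow_succ]; field_simp
      rw [hδs'] at hw'
      refine ⟨w', hw'.mono hκ.le (by positivity) ?_ hsub, fun x hx => hww' x ?_⟩
      · calc A * k ^ (2 * N + 1) * (f * Λ ^ q) ≤ Λ * (f * Λ ^ q) := by gcongr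
          _ = f * Λ ^ (q + 1) := by ring
      · refine thickening_mono (le_trans ?_ hsub) Ω hx
        have : 0 ≤ e / 2 / 2 ^ (q + 1) := by positivity
        linarith)
  have hmem : ∀ q : ℕ, thickening (e / 2) Ω ⊆ thickening (e / 2 + e / 2 / 2 ^ q) Ω := fun q =>
    thickening_mono (by
      have : 0 ≤ e / 2 / 2 ^ q := by positivity
      linarith) Ω
  obtain ⟨v, hv, hvp⟩ := exists_holder_limit (e := e / 2) (U := U) hΩ
    (fun q => contDiff_infty.1 (hUP q).contDiff 2) hC0.le hκ.le hδ'0 hk2 hf0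
    (by linarith) hα hΛα (by rw [div_le_iff₀ hf0]; linarith)
    (fun q x hx => (hUR q x hx).1) (fun q x hx => (hUR q x hx).2)
    (fun q x hx => (hUP q).second x (hmem q hx))
  refine ⟨v, hv, fun x hx => ?_⟩
  have hxe : x ∈ thickening (e / 2) Ω := self_subset_thickening (by positivity) Ω hx
  obtain ⟨hlim, hv0, hv1⟩ := hvp x hxe
  rw [hU0] at hv0 hv1
  have hx2 : x ∈ thickening (e + e / 2 ^ q₀) Ω := self_subset_thickening (by positivity) Ω hx
  have a4 := hu₁u x hx2
  have hpos : 0 ≤ C * (2 * (δ / 2 ^ q₀)) := by positivity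
  have hCδ : C * δ' ≤ C * δ := by gcongr
  refine ⟨?_, ?_, ?_⟩
  · have hG : Tendsto (fun q => g x - colGram (fderiv ℝ (U q) x) (fderiv ℝ (U q) x)) atTop
        (𝓝 (g x - colGram (fderiv ℝ v x) (fderiv ℝ v x))) :=
      tendsto_const_nhds.sub ((continuous_gram_self.tendsto _).comp hlim)
    have hG0 : Tendsto (fun q => g x - colGram (fderiv ℝ (U q) x) (fderiv ℝ (U q) x)) atTop
        (𝓝 0) := by
      refine squeeze_zero_norm (a := fun q : ℕ => (r₁ + ‖g₀‖) * δ' ^ 2 * ((k⁻¹) ^ 2) ^ q)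
        (fun q => ?_) ?_
      · have h1 := (hUP q).metric x (hmem q hxe)
        have h2 := norm_le_norm_add_norm_sub' (g x - colGram (fderiv ℝ (U q) x) (fderiv ℝ (U q) x))
          ((δ' / k ^ q) ^ 2 • g₀)
        rw [norm_smul, Real.norm_of_nonneg (by positivity)] at h2
        calc _ ≤ (r₁ + ‖g₀‖) * (δ' / k ^ q) ^ 2 := by linarith
          _ = _ := by rw [← pow_mul, mul_comm 2 q, pow_mul, inv_pow]; ring
      · have hk1 : (k⁻¹) ^ 2 < 1 :=
          pow_lt_one₀ (by positivity) (inv_lt_one_of_one_lt₀ (by linarith)) two_ne_zero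
        simpa using (tendsto_pow_atTop_nhds_zero_of_lt_one (by positivity) hk1).const_mul
          ((r₁ + ‖g₀‖) * δ' ^ 2)
    exact (sub_eq_zero.1 (tendsto_nhds_unique hG hG0)).symm
  · have := norm_sub_le_norm_sub_add_norm_sub (v x) (u₁ x) (u x)
    linarith [a4.1]
  · have := norm_sub_le_norm_sub_add_norm_sub (fderiv ℝ v x) (fderiv ℝ u₁ x) (fderiv ℝ u x)
    linarith [a4.2]

end Iteration

/-! ### Domains with smooth boundary -/

section Domain

open Metric Filter Topology

variable {n : ℕ}

local notation "𝔼" => EuclideanSpace ℝ (Fin n)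

theorem exists_pos_forall_mem_le {ι : Type*} (t : Finset ι) (f : ι → ℝ) (hf : ∀ i, 0 < f i) :
    ∃ m : ℝ, 0 < m ∧ ∀ i ∈ t, m ≤ f i := by
  rcases t.eq_empty_or_nonempty with rfl | ht
  · exact ⟨1, one_pos, by simp⟩
  · exact ⟨t.inf' ht f, (Finset.lt_inf'_iff ht).2 fun i _ => hf i, fun i hi => Finset.inf'_le f hi⟩

/-- Near each point of the closure of `Ω` there is a direction pointing uniformly into `Ω`. At a
boundary point any direction along which the defining function decreases will do. -/
theorem HasSmoothBoundary.exists_local_transversal {Ω : Set 𝔼} (hs : HasSmoothBoundary Ω)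
    (hΩ : IsOpen Ω) {p : 𝔼} (hp : p ∈ closure Ω) :
    ∃ (R c : ℝ) (v : 𝔼), 0 < R ∧ 0 < c ∧ ∀ x ∈ closure Ω, x ∈ ball p R → ∀ t : ℝ, 0 < t → t ≤ R →
      ball (x + t • v) (c * t) ⊆ Ω := by
  by_cases hpΩ : p ∈ Ω
  · obtain ⟨ε, hε, hb⟩ := Metric.isOpen_iff.1 hΩ p hpΩ
    refine ⟨ε / 2, 1, 0, by positivity, one_pos, fun x _ hx t _ ht y hy => hb ?_⟩
    rw [smul_zero, add_zero, one_mul, mem_ball] at hy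
    rw [mem_ball] at hx ⊢
    have := dist_triangle y x p
    linarith
  · have hpf : p ∈ frontier Ω := by rw [hΩ.frontier_eq]; exact ⟨hp, hpΩ⟩
    obtain ⟨U, hU, hpU, ρ, hρ, hD, hΩU⟩ := hs p hpf
    set A := fderiv ℝ ρ p with hA
    obtain ⟨v, hv⟩ : ∃ v, A v = -1 := by
      obtain ⟨w, hw⟩ : ∃ w, A w ≠ 0 := by
        by_contra! h
        exact hD (ContinuousLinearMap.ext h)
      exact ⟨-(A w)⁻¹ • w, by simp [hw]⟩
    have hstrict : HasStrictFDerivAt ρ A p :=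
      (hρ.contDiffAt (hU.mem_nhds hpU)).hasStrictFDerivAt (by simp)
    have hV : 0 < 4 * (‖v‖ + 1) := by positivity
    have hW : 0 < 4 * (‖A‖ + 1) := by positivity
    obtain ⟨r₂, hr₂, hest⟩ := Metric.eventually_nhds_iff.1
      (hstrict.isLittleO.def (show 0 < 1 / (4 * (‖v‖ + 1)) by positivity))
    obtain ⟨r₃, hr₃, hUr⟩ := Metric.isOpen_iff.1 hU p hpU
    set r := min r₂ r₃
    have hr : 0 < r := lt_min hr₂ hr₃
    set c := min 1 (1 / (4 * (‖A‖ + 1)))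
    have hc : 0 < c := lt_min one_pos (by positivity)
    have hR : 0 < r / (3 + ‖v‖) := by positivity
    refine ⟨r / (3 + ‖v‖), c, v, hR, hc, fun x hx hxp t ht htR y hy => ?_⟩
    set R := r / (3 + ‖v‖) with hRd
    have hRr : R * (3 + ‖v‖) = r := by rw [hRd]; field_simp
    have hc1 : c ≤ 1 := min_le_left _ _
    have hcA : c * (4 * (‖A‖ + 1)) ≤ 1 := by
      rw [← le_div_iff₀ hW]; exact min_le_right _ _
    rw [mem_ball] at hxp hy
    have hyn : ‖y - (x + t • v)‖ ≤ c * t := by rw [← dist_eq_norm]; exact hy.le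
    have hct : c * t ≤ t := mul_le_of_le_one_left ht.le hc1
    have hyx : ‖y - x‖ ≤ t * ‖v‖ + c * t := by
      have e : y - x = t • v + (y - (x + t • v)) := by abel
      rw [e]
      refine (norm_add_le _ _).trans ?_
      rw [norm_smul, Real.norm_of_nonneg ht.le]
      linarith
    have hvR : t * ‖v‖ ≤ R * ‖v‖ := by gcongr
    have hvR0 : 0 ≤ R * ‖v‖ := by positivity
    have hyp : dist y p < r := by
      have h1 := dist_triangle y x p
      rw [dist_eq_norm y x] at h1
      linarith
    have hxr : dist x p < r := by linarith
    have hxU : x ∈ U := hUr (hxr.trans_le (min_le_right _ _))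
    have hyU : y ∈ U := hUr (hyp.trans_le (min_le_right _ _))
    have hx0 : ρ x ≤ 0 := by
      by_contra! h
      have hev : ∀ᶠ z in 𝓝 x, 0 < ρ z ∧ z ∈ U :=
        ((hρ.continuousOn.continuousAt (hU.mem_nhds hxU)).eventually (lt_mem_nhds h)).and
          (hU.mem_nhds hxU)
      obtain ⟨z, ⟨hz1, hz2⟩, hz3⟩ := mem_closure_iff_nhds.1 hx _ hev
      have : z ∈ {x ∈ U | ρ x < 0} := hΩU ▸ (⟨hz3, hz2⟩ : z ∈ Ω ∩ U)
      exact absurd this.2 (not_lt.2 hz1.le)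
    have hdist : dist (y, x) (p, p) < r₂ := by
      rw [Prod.dist_eq]
      exact max_lt (hyp.trans_le (min_le_left _ _)) (hxr.trans_le (min_le_left _ _))
    have h1 := hest hdist
    simp only at h1
    have h2 : A (y - x) = -t + A (y - (x + t • v)) := by
      have e : y - x = t • v + (y - (x + t • v)) := by abel
      conv_lhs => rw [e]
      rw [map_add, map_smul, hv, smul_eq_mul, mul_neg_one]
    have h3 : |A (y - (x + t • v))| ≤ t / 4 := by
      have h4 := A.le_opNorm (y - (x + t • v))
      rw [Real.norm_eq_abs] at h4
      have h5 : ‖A‖ * ‖y - (x + t • v)‖ ≤ ‖A‖ * (c * t) := by gcongr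
      have h6 : c * (4 * (‖A‖ + 1)) * t ≤ 1 * t := by gcongr
      have h7 : 0 ≤ c * t := by positivity
      linarith
    have h4 : 1 / (4 * (‖v‖ + 1)) * ‖y - x‖ ≤ t / 4 := by
      rw [div_mul_eq_mul_div, one_mul, div_le_iff₀ hV]
      linarith
    have h5 : |ρ y - ρ x - A (y - x)| ≤ t / 4 := by
      rw [← Real.norm_eq_abs]; exact h1.trans h4
    have h6 : ρ y < 0 := by
      have := (abs_le.1 h5).2
      have := (abs_le.1 h3).2
      linarith
    have : y ∈ Ω ∩ U := hΩU ▸ (⟨hyU, h6⟩ : y ∈ {x ∈ U | ρ x < 0})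
    exact this.1

/-- A smooth vector field pointing uniformly into `Ω`. -/
theorem HasSmoothBoundary.exists_transversal_field {Ω : Set 𝔼} (hs : HasSmoothBoundary Ω)
    (hΩ : IsOpen Ω) (hb : Bornology.IsBounded Ω) :
    ∃ (X : 𝔼 → 𝔼) (s₀ c : ℝ), ContDiff ℝ ∞ X ∧ HasCompactSupport X ∧ 0 < s₀ ∧ 0 < c ∧
      ∀ x ∈ closure Ω, ∀ s : ℝ, 0 < s → s ≤ s₀ → ball (x + s • X x) (c * s) ⊆ Ω := by
  have hloc : ∀ p : 𝔼, ∃ (R c : ℝ) (v : 𝔼), 0 < R ∧ 0 < c ∧ (p ∈ closure Ω →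
      ∀ x ∈ closure Ω, x ∈ ball p R → ∀ t : ℝ, 0 < t → t ≤ R →
        ball (x + t • v) (c * t) ⊆ Ω) := fun p => by
    by_cases hp : p ∈ closure Ω
    · obtain ⟨R, c, v, hR, hc, h⟩ := hs.exists_local_transversal hΩ hp
      exact ⟨R, c, v, hR, hc, fun _ => h⟩
    · exact ⟨1, 1, 0, one_pos, one_pos, fun h => absurd h hp⟩
  choose R c v hR hc h using hloc
  obtain ⟨t, ht, hcov⟩ := hb.isCompact_closure.elim_nhds_subcover (fun p => ball p (R p / 4))
    fun p _ => ball_mem_nhds p (by linarith [hR p])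
  let χ : ∀ p : 𝔼, ContDiffBump p := fun p =>
    ⟨R p / 4, R p / 2, by linarith [hR p], by linarith [hR p]⟩
  set V := ∑ p ∈ t, ‖v p‖
  have hV : 0 ≤ V := Finset.sum_nonneg fun _ _ => norm_nonneg _
  obtain ⟨c₀, hc₀, hc₀t⟩ := exists_pos_forall_mem_le t c hc
  obtain ⟨R₀, hR₀, hR₀t⟩ := exists_pos_forall_mem_le t R hR
  set s₀ := R₀ / (2 * (V + 1)) with hs₀d
  have hs₀ : 0 < s₀ := by positivity
  have hs₀R : s₀ * (2 * (V + 1)) = R₀ := by rw [hs₀d]; field_simp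
  refine ⟨fun x => ∑ p ∈ t, χ p x • v p, s₀, c₀, ?_, ?_, hs₀, hc₀, fun x hx s hs0 hss => ?_⟩
  · exact ContDiff.sum fun p _ => (χ p).contDiff.smul contDiff_const
  · have hsupp : ∀ T : Finset 𝔼, HasCompactSupport fun x => ∑ p ∈ T, χ p x • v p := by
      intro T
      induction T using Finset.induction_on with
      | empty => simp only [Finset.sum_empty]; exact HasCompactSupport.zero
      | insert p T hp ih =>
        simp only [Finset.sum_insert hp]
        exact ((χ p).hasCompactSupport.smul_right (f' := fun _ => v p)).add ih
    exact hsupp t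
  have hpart : ∀ T ⊆ t, ‖∑ p ∈ T, χ p x • v p‖ ≤ V := fun T hT => by
    refine (norm_sum_le _ _).trans ((Finset.sum_le_sum fun p _ => ?_).trans
      (Finset.sum_le_sum_of_subset_of_nonneg hT fun _ _ _ => norm_nonneg _))
    rw [norm_smul, Real.norm_of_nonneg (χ p).nonneg]
    exact mul_le_of_le_one_left (norm_nonneg _) (χ p).le_one
  have hsV : s * V < R₀ / 2 := by
    have : s * V ≤ s₀ * V := by gcongr
    linarith
  have hsR : s ≤ R₀ := by
    have : 0 ≤ s₀ * V := by positivity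
    linarith
  have hball : ∀ T ⊆ t, ∀ p ∈ t, x ∈ ball p (R p / 2) →
      x + s • ∑ p ∈ T, χ p x • v p ∈ ball p (R p) := fun T hT p hp hxp => by
    rw [mem_ball, dist_eq_norm] at hxp ⊢
    have e : x + s • ∑ p ∈ T, χ p x • v p - p = (x - p) + s • ∑ p ∈ T, χ p x • v p := by abel
    rw [e]
    have h1 := norm_add_le (x - p) (s • ∑ p ∈ T, χ p x • v p)
    have h2 : ‖s • ∑ p ∈ T, χ p x • v p‖ ≤ s * V := by
      rw [norm_smul, Real.norm_of_nonneg hs0.le]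
      have := hpart T hT
      gcongr
    have h3 := hR₀t p hp
    linarith
  -- Moving successively along the local directions never leaves the closure of `Ω`.
  have hstay : ∀ T ⊆ t, x + s • ∑ p ∈ T, χ p x • v p ∈ closure Ω := by
    intro T
    induction T using Finset.induction_on with
    | empty => simpa using hx
    | insert p T hp ih =>
      intro hT
      have hpt : p ∈ t := hT (Finset.mem_insert_self _ _)
      have hTt : T ⊆ t := (Finset.subset_insert _ _).trans hT
      rw [Finset.sum_insert hp]
      by_cases h0 : χ p x = 0
      · rw [h0, zero_smul, zero_add]; exact ih hTt
      · have hpos : 0 < χ p x := lt_of_le_of_ne (χ p).nonneg (Ne.symm h0)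
        have hxp : x ∈ ball p (R p / 2) := by
          have : x ∈ Function.support (χ p) := h0
          rwa [(χ p).support_eq] at this
        have hle : s * χ p x ≤ R p :=
          (mul_le_of_le_one_right hs0.le (χ p).le_one).trans (hsR.trans (hR₀t p hpt))
        have h1 := h p (ht p hpt) _ (ih hTt) (hball T hTt p hpt hxp) (s * χ p x) (by positivity) hle
        have h2 := h1 (mem_ball_self (mul_pos (hc p) (by positivity)))
        have e : x + s • (χ p x • v p + ∑ p ∈ T, χ p x • v p) =
            x + s • ∑ p ∈ T, χ p x • v p + (s * χ p x) • v p := by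
          rw [smul_add, mul_smul]; abel
        rw [e]
        exact subset_closure h2
  have hxc := hcov hx
  simp only [mem_iUnion] at hxc
  obtain ⟨j, hj, hxj⟩ := hxc
  have hχj : χ j x = 1 := (χ j).one_of_mem_closedBall (ball_subset_closedBall hxj)
  have hjt : t.erase j ⊆ t := Finset.erase_subset _ _
  have h1 := h j (ht j hj) _ (hstay _ hjt)
    (hball _ hjt j hj (ball_subset_ball (by linarith [hR j]) hxj)) s hs0 (hsR.trans (hR₀t j hj))
  have e : x + s • ∑ p ∈ t, χ p x • v p = x + s • ∑ p ∈ t.erase j, χ p x • v p + s • v j := by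
    rw [← Finset.add_sum_erase t _ hj, hχj, one_smul, smul_add]; abel
  rw [e]
  exact (ball_subset_ball (by have := hc₀t j hj; gcongr)).trans h1

/-- On a domain with smooth boundary a function with bounded derivative is Lipschitz at small
scales: nearby points are joined by a curve that first moves into the domain. -/
theorem HasSmoothBoundary.exists_lipschitz {Ω : Set 𝔼} (hs : HasSmoothBoundary Ω)
    (hΩ : IsOpen Ω) (hb : Bornology.IsBounded Ω) (F : Type*) [NormedAddCommGroup F]
    [NormedSpace ℝ F] :
    ∃ η C : ℝ, 0 < η ∧ 0 < C ∧ ∀ (f : 𝔼 → F) (M : ℝ), DifferentiableOn ℝ f Ω →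
      (∀ x ∈ Ω, ‖fderiv ℝ f x‖ ≤ M) → ∀ x ∈ Ω, ∀ y ∈ Ω, ‖x - y‖ ≤ η →
      ‖f x - f y‖ ≤ C * M * ‖x - y‖ := by
  obtain ⟨X, s₀, c, hX, hXc, hs₀, hc, hball⟩ := hs.exists_transversal_field hΩ hb
  obtain ⟨B, hB⟩ := hXc.exists_bound_of_continuous hX.continuous
  obtain ⟨L, hL⟩ := hX.lipschitzWith_of_hasCompactSupport hXc (by simp)
  have hB0 : 0 ≤ B := (norm_nonneg _).trans (hB 0)
  set η := min (s₀ * c / 2) (c / (4 * (L + 1))) with hηd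
  have hη : 0 < η := lt_min (by positivity) (by positivity)
  refine ⟨η, 2 / c * (2 * B + c), hη, by positivity, fun f M hf hM x hx y hy hxy => ?_⟩
  have hM0 : 0 ≤ M := (norm_nonneg _).trans (hM x hx)
  rcases eq_or_lt_of_le (norm_nonneg (x - y)) with h0 | h0
  · have : x = y := by rw [← sub_eq_zero, ← norm_eq_zero]; exact h0.symm
    simp [this]
  set s := 2 * ‖x - y‖ / c with hsd
  have hs0 : 0 < s := by positivity
  have hsc : s * c = 2 * ‖x - y‖ := by rw [hsd]; field_simp
  have hss : s ≤ s₀ := by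
    rw [hsd, div_le_iff₀ hc]
    have := hxy.trans (min_le_left _ _)
    linarith
  have hsL : s * L < 1 := by
    have h1 := hxy.trans (min_le_right _ _)
    rw [le_div_iff₀ (by positivity)] at h1
    have h2 : s * c * (L + 1) ≤ 1 / 2 * c := by rw [hsc]; linarith
    have h3 : s * (L + 1) ≤ 1 / 2 := by
      have : s * (L + 1) * c ≤ 1 / 2 * c := by linarith
      exact le_of_mul_le_mul_right this hc
    linarith
  have hseg : ∀ z ∈ Ω, ‖f (z + s • X z) - f z‖ ≤ M * (s * B) := by
    intro z hz
    have hsub : segment ℝ z (z + s • X z) ⊆ Ω := by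
      rw [segment_eq_image']
      rintro _ ⟨θ, ⟨hθ0, hθ1⟩, rfl⟩
      rcases eq_or_lt_of_le hθ0 with rfl | hθ
      · simpa using hz
      · have h1 := hball z (subset_closure hz) (θ * s) (by positivity)
          ((mul_le_of_le_one_left hs0.le hθ1).trans hss)
        have h2 := h1 (mem_ball_self (by positivity))
        simpa [smul_smul] using h2
    have h1 := (convex_segment z (z + s • X z)).norm_image_sub_le_of_norm_fderiv_le (𝕜 := ℝ)
      (f := f) (fun w hw => hf.differentiableAt (hΩ.mem_nhds (hsub hw)))
      (fun w hw => hM w (hsub hw))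
      (left_mem_segment ℝ _ _) (right_mem_segment ℝ _ _)
    refine h1.trans ?_
    rw [add_sub_cancel_left, norm_smul, Real.norm_of_nonneg hs0.le]
    have := hB z
    gcongr
  have hmid : ‖f (y + s • X y) - f (x + s • X x)‖ ≤ M * (c * s) := by
    have hsub := hball x (subset_closure hx) s hs0 hss
    have hd : ‖y + s • X y - (x + s • X x)‖ < c * s := by
      have e : y + s • X y - (x + s • X x) = (y - x) + s • (X y - X x) := by
        rw [smul_sub]; abel
      rw [e]
      have h1 := norm_add_le (y - x) (s • (X y - X x))
      rw [norm_smul, Real.norm_of_nonneg hs0.le] at h1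
      have h2 := hL.norm_sub_le y x
      have h3 : s * ‖X y - X x‖ ≤ s * (L * ‖y - x‖) := by gcongr
      rw [norm_sub_rev y x] at h1 h3
      have h4 : s * L * ‖x - y‖ < 1 * ‖x - y‖ := by gcongr
      linarith
    have h1 := (convex_ball (x + s • X x) (c * s)).norm_image_sub_le_of_norm_fderiv_le (𝕜 := ℝ)
      (f := f) (fun w hw => hf.differentiableAt (hΩ.mem_nhds (hsub hw)))
      (fun w hw => hM w (hsub hw))
      (mem_ball_self (by positivity)) (by rwa [mem_ball, dist_eq_norm])
    refine h1.trans ?_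
    gcongr
  have e : f x - f y = (f (y + s • X y) - f y) - (f (x + s • X x) - f x) -
    (f (y + s • X y) - f (x + s • X x)) := by abel
  rw [e]
  have h1 := norm_sub_le ((f (y + s • X y) - f y) - (f (x + s • X x) - f x))
    (f (y + s • X y) - f (x + s • X x))
  have h2 := norm_sub_le (f (y + s • X y) - f y) (f (x + s • X x) - f x)
  have h3 := hseg x hx
  have h4 := hseg y hy
  calc _ ≤ M * (s * B) + M * (s * B) + M * (c * s) := by linarith
    _ = 2 / c * (2 * B + c) * M * ‖x - y‖ := by rw [hsd]; field_simp; ring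

/-- A locally constant choice of reference points such that every function with bounded derivative
is close to its value at the reference point. (The domain may be disconnected, and the constant does
not depend on the function.) -/
theorem HasSmoothBoundary.exists_reference {Ω : Set 𝔼} (hs : HasSmoothBoundary Ω)
    (hΩ : IsOpen Ω) (hb : Bornology.IsBounded Ω) (F : Type*) [NormedAddCommGroup F]
    [NormedSpace ℝ F] :
    ∃ (rep : 𝔼 → 𝔼) (C : ℝ), 0 < C ∧ (∀ x ∈ Ω, ∀ᶠ y in 𝓝 x, rep y = rep x) ∧
      ∀ (f : 𝔼 → F) (M : ℝ), DifferentiableOn ℝ f Ω → (∀ x ∈ Ω, ‖fderiv ℝ f x‖ ≤ M) →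
      ∀ x ∈ Ω, ‖f x - f (rep x)‖ ≤ C * M := by
  -- Two points are equivalent if the differences of values are bounded by the derivative. Points at
  -- distance at most `η` are, so that there are finitely many classes, and they are open.
  obtain ⟨η, C, hη, hC, hlip⟩ := hs.exists_lipschitz hΩ hb F
  let r : Setoid Ω :=
    { r := fun x y => ∃ B : ℝ, ∀ (f : 𝔼 → F) (M : ℝ), DifferentiableOn ℝ f Ω →
        (∀ z ∈ Ω, ‖fderiv ℝ f z‖ ≤ M) → ‖f x - f y‖ ≤ B * M
      iseqv :=
        { refl := fun x => ⟨0, fun f M _ _ => by simp⟩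
          symm := fun {x y} ⟨B, hB⟩ => ⟨B, fun f M h1 h2 => by
            rw [norm_sub_rev]; exact hB f M h1 h2⟩
          trans := fun {x y z} ⟨B, hB⟩ ⟨B', hB'⟩ => ⟨B + B', fun f M h1 h2 => by
            have a1 := hB f M h1 h2
            have a2 := hB' f M h1 h2
            have a3 := norm_sub_le_norm_sub_add_norm_sub (f x) (f y) (f z)
            linarith⟩ } }
  have hclose : ∀ x y : Ω, ‖(x : 𝔼) - y‖ ≤ η → r x y := fun x y hxy =>
    ⟨C * η, fun f M h1 h2 => by
      have hM0 : 0 ≤ M := (norm_nonneg _).trans (h2 x x.2)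
      calc ‖f x - f y‖ ≤ C * M * ‖(x : 𝔼) - y‖ := hlip f M h1 h2 x x.2 y y.2 hxy
        _ ≤ C * M * η := by gcongr
        _ = _ := by ring⟩
  classical
  let rep : 𝔼 → 𝔼 := fun x => if h : x ∈ Ω then ((Quotient.mk r ⟨x, h⟩).out : Ω) else x
  have hrep : ∀ x (hx : x ∈ Ω), rep x = ((Quotient.mk r ⟨x, hx⟩).out : Ω) := fun x hx => by
    simp only [rep, dif_pos hx]
  have hrepeq : ∀ x ∈ Ω, ∀ y ∈ Ω, ‖x - y‖ ≤ η → rep x = rep y := fun x hx y hy hxy => by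
    rw [hrep x hx, hrep y hy, Quotient.sound (hclose ⟨x, hx⟩ ⟨y, hy⟩ hxy)]
  have hB : ∀ x : 𝔼, ∃ B : ℝ, x ∈ Ω → ∀ (f : 𝔼 → F) (M : ℝ), DifferentiableOn ℝ f Ω →
      (∀ z ∈ Ω, ‖fderiv ℝ f z‖ ≤ M) → ‖f x - f (rep x)‖ ≤ B * M := fun x => by
    by_cases hx : x ∈ Ω
    · obtain ⟨B, hB⟩ := Quotient.exact (Quotient.out_eq (Quotient.mk r ⟨x, hx⟩)).symm
      refine ⟨B, fun _ => ?_⟩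
      rw [hrep x hx]
      exact hB
    · exact ⟨0, fun h => absurd h hx⟩
  choose B hB using hB
  obtain ⟨t, htΩ, htf, hcov⟩ := totallyBounded_iff_subset.1
    (hb.isCompact_closure.totallyBounded.subset subset_closure) _ (dist_mem_uniformity hη)
  refine ⟨rep, C * η + ∑ p ∈ htf.toFinset, |B p|, ?_, fun x hx => ?_, fun f M h1 h2 x hx => ?_⟩
  · have : 0 ≤ ∑ p ∈ htf.toFinset, |B p| := Finset.sum_nonneg fun _ _ => abs_nonneg _
    positivity
  · filter_upwards [hΩ.mem_nhds hx, ball_mem_nhds x hη] with y hy hyx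
    exact hrepeq y hy x hx (by rw [← dist_eq_norm]; exact le_of_lt hyx)
  · have hM0 : 0 ≤ M := (norm_nonneg _).trans (h2 x hx)
    have hxc := hcov hx
    simp only [mem_iUnion] at hxc
    obtain ⟨p, hp, hxp⟩ := hxc
    have hxp' : ‖x - p‖ ≤ η := by rw [← dist_eq_norm]; exact le_of_lt hxp
    rw [hrepeq x hx p (htΩ hp) hxp']
    have a1 : ‖f x - f p‖ ≤ C * M * η :=
      (hlip f M h1 h2 x hx p (htΩ hp) hxp').trans (by gcongr)
    have a2 := hB p (htΩ hp) f M h1 h2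
    have a3 := norm_sub_le_norm_sub_add_norm_sub (f x) (f p) (f (rep p))
    have a4 : |B p| ≤ ∑ p ∈ htf.toFinset, |B p| :=
      Finset.single_le_sum (f := fun p => |B p|) (fun _ _ => abs_nonneg _)
        (htf.mem_toFinset.2 hp)
    have a5 : B p * M ≤ (∑ p ∈ htf.toFinset, |B p|) * M := by
      gcongr; exact (le_abs_self _).trans a4
    linarith

end Domain

/-! ### Hölder continuity and extension of the metric -/

section Extension

open Metric Filter Topology

variable {n : ℕ}

local notation "𝔼" => EuclideanSpace ℝ (Fin n)

/-- McShane's extension of a Hölder continuous function. -/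
theorem exists_holder_extension_real {E : Type*} [NormedAddCommGroup E] {s : Set E} {f : E → ℝ}
    {H β : ℝ} (hH : 0 ≤ H) (hβ : 0 < β) (hβ1 : β ≤ 1)
    (h : ∀ x ∈ s, ∀ y ∈ s, |f x - f y| ≤ H * ‖x - y‖ ^ β) :
    ∃ F : E → ℝ, (∀ x y, |F x - F y| ≤ H * ‖x - y‖ ^ β) ∧ ∀ x ∈ s, F x = f x := by
  let X := Snowflaking E β hβ hβ1
  have hl : LipschitzOnWith H.toNNReal (fun x : X => f (Snowflaking.ofSnowflaking x))
      {x : X | Snowflaking.ofSnowflaking x ∈ s} := by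
    refine LipschitzOnWith.of_dist_le_mul fun x hx y hy => ?_
    obtain ⟨x, rfl⟩ := Snowflaking.toSnowflaking.surjective x
    obtain ⟨y, rfl⟩ := Snowflaking.toSnowflaking.surjective y
    rw [Snowflaking.dist_toSnowflaking_toSnowflaking, Real.coe_toNNReal _ hH, Real.dist_eq,
      dist_eq_norm]
    exact h x hx y hy
  obtain ⟨F, hF, hFf⟩ := hl.extend_real
  refine ⟨fun x => F (Snowflaking.toSnowflaking x), fun x y => ?_, fun x hx => ?_⟩
  · have := hF.dist_le_mul (Snowflaking.toSnowflaking x) (Snowflaking.toSnowflaking y)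
    rwa [Snowflaking.dist_toSnowflaking_toSnowflaking, Real.coe_toNNReal _ hH, Real.dist_eq,
      dist_eq_norm] at this
  · exact (hFf (show Snowflaking.toSnowflaking x ∈ {x : X | Snowflaking.ofSnowflaking x ∈ s}
      from hx)).symm

theorem exists_holder_extension_matrix {s : Set 𝔼} {g : 𝔼 → Matrix (Fin n) (Fin n) ℝ}
    {H β : ℝ} (hH : 0 ≤ H) (hβ : 0 < β) (hβ1 : β ≤ 1) (hs : ∀ x ∈ s, (g x).IsSymm)
    (h : ∀ x ∈ s, ∀ y ∈ s, ‖g x - g y‖ ≤ H * ‖x - y‖ ^ β) :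
    ∃ G : 𝔼 → Matrix (Fin n) (Fin n) ℝ, (∀ x, (G x).IsSymm) ∧
      (∀ x y, ‖G x - G y‖ ≤ n * H * ‖x - y‖ ^ β) ∧ ∀ x ∈ s, G x = g x := by
  have hex : ∀ i j, ∃ F : 𝔼 → ℝ, (∀ x y, |F x - F y| ≤ H * ‖x - y‖ ^ β) ∧
      ∀ x ∈ s, F x = g x i j := fun i j =>
    exists_holder_extension_real hH hβ hβ1 fun x hx y hy =>
      (abs_entry_le_frobenius_norm (g x - g y) i j).trans (h x hx y hy)
  choose F hF hFg using hex
  refine ⟨fun x => Matrix.of fun i j => (F i j x + F j i x) / 2, fun x => ?_, fun x y => ?_,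
    fun x hx => ?_⟩
  · ext i j
    simp [add_comm]
  · rw [mul_assoc]
    refine frobenius_norm_le_of_entries fun i j => ?_
    have h1 := hF i j x y
    have h2 := hF j i x y
    have e : (F i j x + F j i x) / 2 - (F i j y + F j i y) / 2 =
      ((F i j x - F i j y) + (F j i x - F j i y)) / 2 := by ring
    simp only [Matrix.sub_apply, Matrix.of_apply]
    rw [e, abs_div, abs_two, div_le_iff₀ two_pos]
    exact (abs_add_le _ _).trans (by linarith)
  · ext i j
    have h1 := (hs x hx).apply i j
    simp only [Matrix.of_apply, hFg _ _ x hx]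
    linarith

theorem IsCkHolder.exists_bound {E F : Type*} [NormedAddCommGroup E] [NormedSpace ℝ E]
    [ProperSpace E] [NormedAddCommGroup F] [NormedSpace ℝ F] {k : ℕ} {θ : ℝ} {Ω : Set E}
    {f : E → F} (hf : IsCkHolder k θ Ω f) (hb : Bornology.IsBounded Ω) {m : ℕ} (hm : m ≤ k) :
    ∃ B : ℝ, 0 ≤ B ∧ ∀ x ∈ Ω, ‖iteratedFDeriv ℝ m f x‖ ≤ B := by
  obtain ⟨G, hG, hGf⟩ := hf.continuous_extension m hm
  obtain ⟨B, hB⟩ := hb.isCompact_closure.exists_bound_of_continuousOn hG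
  refine ⟨|B|, abs_nonneg B, fun x hx => ?_⟩
  rw [← hGf hx]
  exact (hB x (subset_closure hx)).trans (le_abs_self B)

theorem HasSmoothBoundary.exists_lipschitz_of_bounded {Ω : Set 𝔼} (hs : HasSmoothBoundary Ω)
    (hΩ : IsOpen Ω) (hb : Bornology.IsBounded Ω) {F : Type*} [NormedAddCommGroup F]
    [NormedSpace ℝ F] {f : 𝔼 → F} {B M : ℝ} (hf : DifferentiableOn ℝ f Ω)
    (hB0 : 0 ≤ B) (hM0 : 0 ≤ M) (hB : ∀ x ∈ Ω, ‖f x‖ ≤ B) (hM : ∀ x ∈ Ω, ‖fderiv ℝ f x‖ ≤ M) :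
    ∃ L : ℝ, 0 ≤ L ∧ ∀ x ∈ Ω, ∀ y ∈ Ω, ‖f x - f y‖ ≤ L * ‖x - y‖ := by
  obtain ⟨η, C, hη, hC, hlip⟩ := hs.exists_lipschitz hΩ hb F
  refine ⟨C * M + 2 * B / η, by positivity, fun x hx y hy => ?_⟩
  rw [add_mul]
  rcases le_or_gt ‖x - y‖ η with h | h
  · have := hlip f M hf hM x hx y hy h
    have : 0 ≤ 2 * B / η * ‖x - y‖ := by positivity
    linarith
  · have h1 := norm_sub_le (f x) (f y)
    have h2 : 2 * B ≤ 2 * B / η * ‖x - y‖ := by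
      rw [div_mul_eq_mul_div, le_div_iff₀ hη]
      gcongr
    have h3 : 0 ≤ C * M * ‖x - y‖ := by positivity
    linarith [hB x hx, hB y hy]

/-- A map of class `C^β` is Hölder continuous with exponent `min β 1`. -/
theorem HasSmoothBoundary.exists_holder {Ω : Set 𝔼} (hs : HasSmoothBoundary Ω)
    (hΩ : IsOpen Ω) (hb : Bornology.IsBounded Ω) {F : Type*} [NormedAddCommGroup F]
    [NormedSpace ℝ F] {f : 𝔼 → F} {β : ℝ} (hf : IsCHolder β Ω f) :
    ∃ H : ℝ, 0 ≤ H ∧ ∀ x ∈ Ω, ∀ y ∈ Ω, ‖f x - f y‖ ≤ H * ‖x - y‖ ^ min β 1 := by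
  rcases lt_or_ge β 1 with h1 | h1
  · obtain ⟨H, hH⟩ := hf.holder
    have h0 : ⌊β⌋₊ = 0 := Nat.floor_eq_zero.2 h1
    rw [h0] at hH
    refine ⟨|H|, abs_nonneg H, fun x hx y hy => ?_⟩
    have h2 := hH x hx y hy
    have h3 : ‖iteratedFDeriv ℝ 0 f x - iteratedFDeriv ℝ 0 f y‖ = ‖f x - f y‖ := by
      rw [← dist_eq_norm, ← dist_eq_norm, ← iteratedFDerivWithin_univ]
      exact dist_iteratedFDerivWithin_zero f univ x f univ y
    rw [h3] at h2
    rw [min_eq_left h1.le]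
    simp only [Nat.cast_zero, sub_zero] at h2
    refine h2.trans ?_
    gcongr
    exact le_abs_self H
  · have hfl : 1 ≤ ⌊β⌋₊ := Nat.one_le_floor_iff β |>.2 h1
    obtain ⟨B, hB0, hB⟩ := IsCkHolder.exists_bound hf hb (Nat.zero_le _)
    obtain ⟨M, hM0, hM⟩ := IsCkHolder.exists_bound hf hb hfl
    have hd : DifferentiableOn ℝ f Ω := hf.contDiffOn.differentiableOn (by
      have : ⌊β⌋₊ ≠ 0 := by omega
      exact_mod_cast this)
    obtain ⟨L, hL, h⟩ := hs.exists_lipschitz_of_bounded hΩ hb hd hB0 hM0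
      (fun x hx => by simpa using hB x hx) (fun x hx => by simpa using hM x hx)
    refine ⟨L, hL, fun x hx y hy => ?_⟩
    rw [min_eq_right h1, Real.rpow_one]
    exact h x hx y hy

/-- The first and second derivatives of a map of class `C^2` of the closure of `Ω` are bounded,
and its first derivative is Lipschitz continuous. -/
theorem HasSmoothBoundary.exists_lipschitz_fderiv {Ω : Set 𝔼} (hs : HasSmoothBoundary Ω)
    (hΩ : IsOpen Ω) (hb : Bornology.IsBounded Ω) {F : Type*} [NormedAddCommGroup F]
    [NormedSpace ℝ F] {u : 𝔼 → F} (hu : IsCkHolder 2 0 Ω u) :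
    ∃ B L : ℝ, 0 ≤ B ∧ 0 ≤ L ∧ (∀ x ∈ Ω, ‖fderiv ℝ u x‖ ≤ B) ∧
      ∀ x ∈ Ω, ∀ y ∈ Ω, ‖fderiv ℝ u x - fderiv ℝ u y‖ ≤ L * ‖x - y‖ := by
  obtain ⟨B, hB0, hB⟩ := hu.exists_bound hb one_le_two
  obtain ⟨M, hM0, hM⟩ := hu.exists_bound hb le_rfl
  have hd : DifferentiableOn ℝ (fderiv ℝ u) Ω :=
    (hu.contDiffOn.fderiv_of_isOpen (m := 1) hΩ (by norm_num)).differentiableOn (by simp)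
  have hB' : ∀ x ∈ Ω, ‖fderiv ℝ u x‖ ≤ B := fun x hx => by simpa using hB x hx
  obtain ⟨L, hL, h⟩ := hs.exists_lipschitz_of_bounded hΩ hb hd hB0 hM0 hB' (fun x hx => by
    rw [← norm_iteratedFDeriv_one, norm_iteratedFDeriv_fderiv]
    exact hM x hx)
  exact ⟨B, L, hB0, hL, hB', h⟩

theorem HasSmoothBoundary.isCkHolder_one {Ω : Set 𝔼} (hs : HasSmoothBoundary Ω)
    (hΩ : IsOpen Ω) (hb : Bornology.IsBounded Ω) {F : Type*} [NormedAddCommGroup F]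
    [NormedSpace ℝ F] {u : 𝔼 → F} (hu : IsCkHolder 2 0 Ω u) {α : ℝ} (hα : 0 < α) (hα1 : α ≤ 1) :
    IsCkHolder 1 α Ω u := by
  refine ⟨hu.contDiffOn.of_le (by norm_num), hu.continuousOn,
    fun m hm => hu.continuous_extension m (by omega), ?_⟩
  obtain ⟨B, L, hB0, hL, hB, h⟩ := hs.exists_lipschitz_fderiv hΩ hb hu
  refine ⟨L + 2 * B, fun x hx y hy => ?_⟩
  rw [norm_iteratedFDeriv_one_sub, add_mul]
  have hp : 0 ≤ ‖x - y‖ ^ α := by positivity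
  rcases le_or_gt ‖x - y‖ 1 with h1 | h1
  · rcases eq_or_lt_of_le (norm_nonneg (x - y)) with h0 | h0
    · have := h x hx y hy
      rw [← h0] at this ⊢
      rw [Real.zero_rpow hα.ne']
      linarith
    · have h2 : ‖x - y‖ ≤ ‖x - y‖ ^ α := by
        conv_lhs => rw [← Real.rpow_one ‖x - y‖]
        exact Real.rpow_le_rpow_of_exponent_ge h0 h1 hα1
      have h3 : L * ‖x - y‖ ≤ L * ‖x - y‖ ^ α := by gcongr
      have h4 : 0 ≤ 2 * B * ‖x - y‖ ^ α := by positivity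
      linarith [h x hx y hy]
  · have h2 : 1 ≤ ‖x - y‖ ^ α := Real.one_le_rpow h1.le hα.le
    have h3 := norm_sub_le (fderiv ℝ u x) (fderiv ℝ u y)
    have h4 : 2 * B * 1 ≤ 2 * B * ‖x - y‖ ^ α := by gcongr
    have h5 : 0 ≤ L * ‖x - y‖ ^ α := by positivity
    linarith [hB x hx, hB y hy]

end Extension

/-! ### The initial approximate solution -/

section Initial

open Metric Filter Topology

variable {n : ℕ}

local notation "𝔼" => EuclideanSpace ℝ (Fin n)
local notation "𝔽" => EuclideanSpace ℝ (Fin (n + 1))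

/-- A `C^1` map on `Ω` is approximated in `C^1` by smooth maps, up to the boundary: its composition
with a diffeomorphism moving the closure of `Ω` into `Ω` is defined near the closure and can be
mollified. -/
theorem HasSmoothBoundary.exists_smooth_approx {Ω : Set 𝔼} (hs : HasSmoothBoundary Ω)
    (hΩ : IsOpen Ω) (hb : Bornology.IsBounded Ω) {F : Type} [NormedAddCommGroup F]
    [NormedSpace ℝ F] [CompleteSpace F] {w : 𝔼 → F} {M L₀ L η : ℝ}
    (hw : ContDiffOn ℝ 1 w Ω) (hη : 0 < η) (hM0 : 0 ≤ M) (hL₀ : 0 ≤ L₀) (hL : 0 ≤ L)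
    (hM : ∀ x ∈ Ω, ‖fderiv ℝ w x‖ ≤ M)
    (h0 : ∀ x ∈ Ω, ∀ y ∈ Ω, ‖x - y‖ ≤ η → ‖w x - w y‖ ≤ L₀ * ‖x - y‖)
    (h1 : ∀ x ∈ Ω, ∀ y ∈ Ω, ‖x - y‖ ≤ η → ‖fderiv ℝ w x - fderiv ℝ w y‖ ≤ L * ‖x - y‖)
    {ε : ℝ} (hε : 0 < ε) :
    ∃ (W : 𝔼 → F) (d : ℝ), 0 < d ∧ ContDiff ℝ ∞ W ∧ ∀ x ∈ Ω, ∀ y ∈ ball x d,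
      ‖W y - w x‖ ≤ ε ∧ ‖fderiv ℝ W y - fderiv ℝ w x‖ ≤ ε := by
  obtain ⟨X, s₀, c, hX, hXc, hs₀, hc, hball⟩ := hs.exists_transversal_field hΩ hb
  obtain ⟨B, hB⟩ := hXc.exists_bound_of_continuous hX.continuous
  obtain ⟨B', hB'⟩ := (hXc.fderiv (𝕜 := ℝ)).exists_bound_of_continuous
    (hX.continuous_fderiv (by simp))
  obtain ⟨K, hK⟩ := hX.lipschitzWith_of_hasCompactSupport hXc (by simp)
  have hB0 : 0 ≤ B := (norm_nonneg _).trans (hB 0)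
  have hB'0 : 0 ≤ B' := (norm_nonneg _).trans (hB' 0)
  -- `e` bounds the displacement of points, `t` is the time for which they move along `X`.
  set e := min η (ε / (4 * (L₀ + L + 1))) with hed
  have he : 0 < e := lt_min hη (by positivity)
  have heε : (L₀ + L + 1) * e ≤ ε / 4 := by
    have : e ≤ ε / (4 * (L₀ + L + 1)) := min_le_right _ _
    rw [le_div_iff₀ (by positivity)] at this
    linarith
  set t := min s₀ (min (e / (2 * (B + 1))) (ε / (4 * (M * B' + 1)))) with htd
  have ht : 0 < t := lt_min hs₀ (lt_min (by positivity) (by positivity))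
  have hts : t ≤ s₀ := min_le_left _ _
  have htB : t * B ≤ e / 2 := by
    have : t ≤ e / (2 * (B + 1)) := (min_le_right _ _).trans (min_le_left _ _)
    rw [le_div_iff₀ (by positivity)] at this
    linarith
  have htM : M * (t * B') ≤ ε / 4 := by
    have : t ≤ ε / (4 * (M * B' + 1)) := (min_le_right _ _).trans (min_le_right _ _)
    rw [le_div_iff₀ (by positivity)] at this
    linarith
  set d := min (e / 2) (c * t / (2 * (1 + t * K))) with hdd
  have hd : 0 < d := lt_min (by positivity) (by positivity)
  have hde : d ≤ e / 2 := min_le_left _ _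
  have hdc : (1 + t * K) * d < c * t := by
    have : d ≤ c * t / (2 * (1 + t * K)) := min_le_right _ _
    rw [le_div_iff₀ (by positivity)] at this
    have : 0 < c * t := by positivity
    linarith
  set ψ : 𝔼 → 𝔼 := fun x => x + t • X x with hψ
  have hψc : ContDiff ℝ ∞ ψ := contDiff_id.add (hX.const_smul t)
  have hψd : ∀ x, HasFDerivAt ψ (ContinuousLinearMap.id ℝ 𝔼 + t • fderiv ℝ X x) x := fun x =>
    (hasFDerivAt_id x).add ((hX.differentiable (by simp) x).hasFDerivAt.const_smul t)
  have hψΩ : ∀ x ∈ Ω, ∀ y ∈ ball x d, ψ y ∈ Ω := by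
    intro x hx y hy
    refine hball x (subset_closure hx) t ht hts ?_
    rw [mem_ball, dist_eq_norm] at hy ⊢
    have e1 : ψ y - (x + t • X x) = (y - x) + t • (X y - X x) := by
      simp only [hψ, smul_sub]; abel
    rw [e1]
    have h2 := norm_add_le (y - x) (t • (X y - X x))
    rw [norm_smul, Real.norm_of_nonneg ht.le] at h2
    have h3 := hK.norm_sub_le y x
    have h4 : t * ‖X y - X x‖ ≤ t * (K * ‖y - x‖) := by gcongr
    have h5 : (1 + t * K) * ‖y - x‖ ≤ (1 + t * K) * d := by gcongr
    linarith
  have hψx : ∀ x, ∀ y ∈ ball x d, ‖ψ y - x‖ ≤ e := by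
    intro x y hy
    rw [mem_ball, dist_eq_norm] at hy
    have e1 : ψ y - x = (y - x) + t • X y := by simp only [hψ]; abel
    rw [e1]
    have h2 := norm_add_le (y - x) (t • X y)
    rw [norm_smul, Real.norm_of_nonneg ht.le] at h2
    have h4 : t * ‖X y‖ ≤ t * B := by gcongr; exact hB y
    linarith
  have hclose : ∀ x ∈ Ω, ∀ y ∈ ball x d, ‖w (ψ y) - w x‖ ≤ ε / 4 ∧
      ‖fderiv ℝ (w ∘ ψ) y - fderiv ℝ w x‖ ≤ ε / 4 + ε / 4 := by
    intro x hx y hy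
    have h2 := hψΩ x hx y hy
    have h3 := hψx x y hy
    have h3' : ‖ψ y - x‖ ≤ η := h3.trans (min_le_left _ _)
    have h4 : L₀ * ‖ψ y - x‖ ≤ L₀ * e := by gcongr
    have h5 : L * ‖ψ y - x‖ ≤ L * e := by gcongr
    have h6 : 0 ≤ L₀ * e := by positivity
    have h7 : 0 ≤ L * e := by positivity
    refine ⟨by linarith [h0 _ h2 x hx h3'], ?_⟩
    have hdw : DifferentiableAt ℝ w (ψ y) :=
      (hw.differentiableOn (by simp)).differentiableAt (hΩ.mem_nhds h2)
    rw [(hdw.hasFDerivAt.comp y (hψd y)).fderiv]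
    have e1 : fderiv ℝ w (ψ y) ∘L (ContinuousLinearMap.id ℝ 𝔼 + t • fderiv ℝ X y) - fderiv ℝ w x =
        (fderiv ℝ w (ψ y) - fderiv ℝ w x) + fderiv ℝ w (ψ y) ∘L (t • fderiv ℝ X y) := by
      rw [ContinuousLinearMap.comp_add, ContinuousLinearMap.comp_id]; abel
    rw [e1]
    refine (norm_add_le _ _).trans (add_le_add ?_ ?_)
    · linarith [h1 _ h2 x hx h3']
    · refine ((ContinuousLinearMap.opNorm_comp_le _ _).trans ?_).trans htM
      rw [norm_smul, Real.norm_of_nonneg ht.le]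
      have := hM _ h2
      have := hB' y
      gcongr
  have hTo : IsOpen (thickening d Ω) := isOpen_thickening
  have hsub : cthickening (d / 2) Ω ⊆ thickening d Ω :=
    cthickening_subset_thickening' hd (by linarith) Ω
  have hTψ : MapsTo ψ (thickening d Ω) Ω := fun y hy => by
    obtain ⟨x, hx, hxy⟩ := mem_thickening_iff.1 hy
    exact hψΩ x hx y hxy
  have hcomp : IsCompact (cthickening (d / 2) Ω) :=
    Metric.isCompact_of_isClosed_isBounded isClosed_cthickening hb.cthickening
  obtain ⟨w₁, hw₁, hw₁c, hw₁e⟩ := exists_contDiff_hasCompactSupport_eqOn (k := 1) hcomp hTo hsub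
    (f := w ∘ ψ) (hw.comp (hψc.of_le (by exact_mod_cast le_top)).contDiffOn hTψ)
  have hw₁' : ContDiff ℝ 1 w₁ := hw₁
  have hD₁ : Continuous (fderiv ℝ w₁) := hw₁'.continuous_fderiv (by simp)
  have hu0 : UniformContinuous w₁ := hw₁c.uniformContinuous_of_continuous hw₁'.continuous
  have hu1 : UniformContinuous (fderiv ℝ w₁) :=
    (hw₁c.fderiv (𝕜 := ℝ)).uniformContinuous_of_continuous hD₁
  obtain ⟨ℓ₀, hℓ₀, hu0⟩ := Metric.uniformContinuous_iff.1 hu0 (ε / 4) (by positivity)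
  obtain ⟨ℓ₁, hℓ₁, hu1⟩ := Metric.uniformContinuous_iff.1 hu1 (ε / 4) (by positivity)
  set ℓ := min ℓ₀ ℓ₁ / 2 with hℓd
  have hℓ : 0 < ℓ := by have := lt_min hℓ₀ hℓ₁; positivity
  have hℓ0 : ℓ < ℓ₀ := by have := min_le_left ℓ₀ ℓ₁; linarith
  have hℓ1 : ℓ < ℓ₁ := by have := min_le_right ℓ₀ ℓ₁; linarith
  refine ⟨mollify ℓ w₁, d / 2, by positivity, contDiff_mollify hℓ.ne' hw₁'.continuous,
    fun x hx y hy => ?_⟩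
  have hyd : y ∈ ball x d := ball_subset_ball (by linarith) hy
  have hyT : thickening (d / 2) Ω ∈ 𝓝 y :=
    isOpen_thickening.mem_nhds (mem_thickening_iff.2 ⟨x, hx, hy⟩)
  have hev : w₁ =ᶠ[𝓝 y] w ∘ ψ := by
    filter_upwards [hyT] with z hz
    exact hw₁e (thickening_subset_cthickening _ _ hz)
  obtain ⟨a0, a1⟩ := hclose x hx y hyd
  have b0 : ‖mollify ℓ w₁ y - w₁ y‖ ≤ ε / 4 := norm_mollify_sub_le hℓ.le hw₁'.continuous
    fun z hz => by
      rw [← dist_eq_norm]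
      exact (hu0 (lt_of_le_of_lt hz hℓ0)).le
  have b1 : ‖mollify ℓ (fderiv ℝ w₁) y - fderiv ℝ w₁ y‖ ≤ ε / 4 :=
    norm_mollify_sub_le hℓ.le hD₁ fun z hz => by
      rw [← dist_eq_norm]
      exact (hu1 (lt_of_le_of_lt hz hℓ1)).le
  rw [hev.eq_of_nhds] at b0
  rw [hev.fderiv_eq] at b1
  rw [fderiv_mollify hw₁']
  constructor
  · have := norm_sub_le_norm_sub_add_norm_sub (mollify ℓ w₁ y) ((w ∘ ψ) y) (w x)
    simp only [Function.comp_apply] at this b0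
    linarith
  · have := norm_sub_le_norm_sub_add_norm_sub (mollify ℓ (fderiv ℝ w₁) y) (fderiv ℝ (w ∘ ψ) y)
      (fderiv ℝ w x)
    linarith

theorem ContDiff.exists_norm_fderiv_fderiv_le {E F : Type*} [NormedAddCommGroup E]
    [NormedSpace ℝ E] [NormedAddCommGroup F] [NormedSpace ℝ F] {f : E → F} (hf : ContDiff ℝ ∞ f)
    {K : Set E} (hK : IsCompact K) : ∃ B, ∀ x ∈ K, ‖fderiv ℝ (fderiv ℝ f) x‖ ≤ B :=
  hK.exists_bound_of_continuousOn
    ((hf.fderiv_right (m := ∞) (by simp)).continuous_fderiv (by simp)).continuousOn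

/-- A `C^1` map on `Ω` whose metric is short by `δ ^ 2 * g₀`, up to `r₁ / 2 * δ ^ 2`, is close to an
approximate solution defined on a neighbourhood of `Ω`. -/
theorem HasSmoothBoundary.exists_isApprox {Ω : Set 𝔼} (hs : HasSmoothBoundary Ω)
    (hΩ : IsOpen Ω) (hb : Bornology.IsBounded Ω) {g : 𝔼 → Matrix (Fin n) (Fin n) ℝ}
    (hg : UniformContinuous g) (g₀ : Matrix (Fin n) (Fin n) ℝ) {w : 𝔼 → 𝔽} {M L₀ L η r₁ κ δ : ℝ}
    (hw : ContDiffOn ℝ 1 w Ω) (hη : 0 < η) (hM0 : 0 ≤ M) (hL₀ : 0 ≤ L₀) (hL : 0 ≤ L)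
    (hM : ∀ x ∈ Ω, ‖fderiv ℝ w x‖ ≤ M)
    (h0 : ∀ x ∈ Ω, ∀ y ∈ Ω, ‖x - y‖ ≤ η → ‖w x - w y‖ ≤ L₀ * ‖x - y‖)
    (h1 : ∀ x ∈ Ω, ∀ y ∈ Ω, ‖x - y‖ ≤ η → ‖fderiv ℝ w x - fderiv ℝ w y‖ ≤ L * ‖x - y‖)
    (hr₁ : 0 < r₁) (hκ : 0 < κ) (hδ : 0 < δ)
    (hmet : ∀ x ∈ Ω, ‖g x - colGram (fderiv ℝ w x) (fderiv ℝ w x) - δ ^ 2 • g₀‖ ≤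
      r₁ / 2 * δ ^ 2) :
    ∃ (W : 𝔼 → 𝔽) (freq d : ℝ), 0 < d ∧ IsApprox Ω g g₀ r₁ κ W δ freq d ∧
      ∀ x ∈ Ω, ‖W x - w x‖ ≤ δ ∧ ‖fderiv ℝ W x - fderiv ℝ w x‖ ≤ δ := by
  set ε := min (min 1 δ) (r₁ * δ ^ 2 / (2 * (1 + n * (2 * M + 1)))) with hεd
  have hε : 0 < ε := lt_min (lt_min one_pos hδ) (by positivity)
  have hε1 : ε ≤ 1 := (min_le_left _ _).trans (min_le_left _ _)
  have hεδ : ε ≤ δ := (min_le_left _ _).trans (min_le_right _ _)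
  have hεr : ε * (1 + n * (2 * M + 1)) ≤ r₁ / 2 * δ ^ 2 := by
    have : ε ≤ r₁ * δ ^ 2 / (2 * (1 + n * (2 * M + 1))) := min_le_right _ _
    rw [le_div_iff₀ (by positivity)] at this
    linarith
  obtain ⟨W, d₀, hd₀, hW, hWw⟩ := hs.exists_smooth_approx hΩ hb hw hη hM0 hL₀ hL hM h0 h1 hε
  obtain ⟨d₁, hd₁, hgd⟩ := Metric.uniformContinuous_iff.1 hg ε hε
  set d := min d₀ d₁
  have hd : 0 < d := lt_min hd₀ hd₁
  have hcomp : IsCompact (cthickening d Ω) :=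
    Metric.isCompact_of_isClosed_isBounded isClosed_cthickening hb.cthickening
  obtain ⟨B, hB⟩ : ∃ B, ∀ x ∈ cthickening d Ω, ‖fderiv ℝ (fderiv ℝ W) x‖ ≤ B :=
    hW.exists_norm_fderiv_fderiv_le hcomp
  refine ⟨W, B / (κ * δ), d, hd, ⟨hW, fun y hy => ?_, fun y hy => ?_⟩, fun x hx => ?_⟩
  · obtain ⟨x, hx, hyx⟩ := mem_thickening_iff.1 hy
    have a1 := (hWw x hx y (lt_of_lt_of_le hyx (min_le_left _ _))).2
    have a2 : ‖g y - g x‖ ≤ ε := by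
      rw [← dist_eq_norm]; exact (hgd (lt_of_lt_of_le hyx (min_le_right _ _))).le
    have a3 := norm_gram_sub_gram_le (fderiv ℝ W y) (fderiv ℝ w x)
    have a4 := hM x hx
    have a5 : ‖fderiv ℝ W y‖ ≤ M + 1 := by
      have := norm_le_norm_add_norm_sub' (fderiv ℝ W y) (fderiv ℝ w x)
      linarith
    have a6 : (n : ℝ) * ((‖fderiv ℝ W y‖ + ‖fderiv ℝ w x‖) * ‖fderiv ℝ W y - fderiv ℝ w x‖) ≤
        n * ((M + 1 + M) * ε) := by gcongr
    have e : g y - colGram (fderiv ℝ W y) (fderiv ℝ W y) - δ ^ 2 • g₀ =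
        (g x - colGram (fderiv ℝ w x) (fderiv ℝ w x) - δ ^ 2 • g₀) + (g y - g x) -
        (colGram (fderiv ℝ W y) (fderiv ℝ W y) - colGram (fderiv ℝ w x) (fderiv ℝ w x)) := by abel
    rw [e]
    have a7 := norm_sub_le
      ((g x - colGram (fderiv ℝ w x) (fderiv ℝ w x) - δ ^ 2 • g₀) + (g y - g x))
      (colGram (fderiv ℝ W y) (fderiv ℝ W y) - colGram (fderiv ℝ w x) (fderiv ℝ w x))
    have a8 := norm_add_le (g x - colGram (fderiv ℝ w x) (fderiv ℝ w x) - δ ^ 2 • g₀) (g y - g x)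
    linarith [hmet x hx]
  · refine (hB y (thickening_subset_cthickening _ _ hy)).trans (le_of_eq ?_)
    field_simp
  · have := hWw x hx x (mem_ball_self hd₀)
    exact ⟨this.1.trans hεδ, this.2.trans hεδ⟩

end Initial

/-! ### Local existence -/

section Existence

open Metric Filter Topology

variable {n : ℕ}

local notation "𝔼" => EuclideanSpace ℝ (Fin n)
local notation "𝔽" => EuclideanSpace ℝ (Fin (n + 1))

theorem norm_le_of_normC0_le {E F : Type*} [NormedAddCommGroup F] {Ω : Set E} {f : E → F} {c : ℝ}
    (hc : 0 ≤ c) (h : normC0 Ω f ≤ ENNReal.ofReal c) : ∀ x ∈ Ω, ‖f x‖ ≤ c := fun x hx => by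
  have h1 : ‖f x‖ₑ ≤ ENNReal.ofReal c := (le_iSup₂ (f := fun x _ => ‖f x‖ₑ) x hx).trans h
  rwa [← ofReal_norm, ENNReal.ofReal_le_ofReal_iff hc] at h1

theorem normC1_le {F : Type*} [NormedAddCommGroup F] [NormedSpace ℝ F] {Ω : Set 𝔼} {f : 𝔼 → F}
    {c : ℝ} (h0 : ∀ x ∈ Ω, ‖f x‖ ≤ c) (h1 : ∀ x ∈ Ω, ‖fderiv ℝ f x‖ ≤ c) :
    normC1 Ω f ≤ ENNReal.ofReal ((1 + n) * c) := by
  refine iSup₂_le fun x hx => ?_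
  have hc : 0 ≤ c := (norm_nonneg _).trans (h0 x hx)
  have h2 : ∀ i : Fin n, ‖partialD i f x‖ₑ ≤ ENNReal.ofReal c := fun i => by
    rw [← ofReal_norm]
    refine ENNReal.ofReal_le_ofReal (le_trans ?_ (h1 x hx))
    simpa [partialD] using (fderiv ℝ f x).le_opNorm (EuclideanSpace.single i (1 : ℝ))
  calc ‖f x‖ₑ + ∑ i : Fin n, ‖partialD i f x‖ₑ
      ≤ ENNReal.ofReal c + ∑ _i : Fin n, ENNReal.ofReal c := by
        refine add_le_add ?_ (Finset.sum_le_sum fun i _ => h2 i)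
        rw [← ofReal_norm]
        exact ENNReal.ofReal_le_ofReal (h0 x hx)
    _ = ENNReal.ofReal ((1 + n) * c) := by
        rw [Finset.sum_const, Finset.card_univ, Fintype.card_fin, nsmul_eq_mul, add_mul, one_mul,
          ENNReal.ofReal_add hc (by positivity), ENNReal.ofReal_mul (by positivity),
          ENNReal.ofReal_natCast]

theorem uniformContinuous_of_holder {E F : Type*} [NormedAddCommGroup E] [NormedAddCommGroup F]
    {f : E → F} {H β : ℝ} (hβ : 0 < β) (h : ∀ x y, ‖f x - f y‖ ≤ H * ‖x - y‖ ^ β) :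
    UniformContinuous f := by
  have hf : HolderWith H.toNNReal β.toNNReal f := fun x y => by
    rw [edist_eq_enorm_sub, edist_eq_enorm_sub, ← ofReal_norm, ← ofReal_norm,
      Real.coe_toNNReal _ hβ.le, ENNReal.ofReal_rpow_of_nonneg (norm_nonneg _) hβ.le]
    refine (ENNReal.ofReal_le_ofReal (h x y)).trans (le_of_eq ?_)
    rw [ENNReal.ofReal_mul' (by positivity)]
    rfl
  exact hf.uniformContinuous (by simpa using hβ)

theorem norm_smul_sub_smul_le {V : Type*} [NormedAddCommGroup V] [NormedSpace ℝ V] {c : ℝ}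
    (hc : ‖c‖ ≤ 1) (a b : V) : ‖c • a - c • b‖ ≤ ‖a - b‖ := by
  rw [← smul_sub, norm_smul]
  exact mul_le_of_le_one_left (norm_nonneg _) hc

/-- Shrinking `u` towards a locally constant map makes its metric short by a multiple of `g₀` that
dominates the original error `e ≤ θ * r₁ / 4`. -/
theorem norm_metric_defect_le {g₀ g G : Matrix (Fin n) (Fin n) ℝ} {r₁ r θ e : ℝ}
    (hr₁ : r ≤ r₁ / 4) (hg : ‖g - g₀‖ ≤ r) (hG : ‖G - g‖ ≤ e) (hθ0 : 0 ≤ θ) (hθ1 : θ ≤ 1)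
    (hθ : θ * (‖g₀‖ + r) ≤ r₁ / 4) (he : e ≤ r₁ / 4 * θ) :
    ‖g - (1 - θ) ^ 2 • G - (2 * θ) • g₀‖ ≤ r₁ / 2 * (2 * θ) := by
  have hid : g - (1 - θ) ^ 2 • G - (2 * θ) • g₀ =
      (2 * θ) • (g - g₀) - (θ ^ 2) • g - (1 - θ) ^ 2 • (G - g) := by module
  have h1 : ‖(2 * θ) • (g - g₀)‖ ≤ 2 * θ * (r₁ / 4) := by
    rw [norm_smul, Real.norm_of_nonneg (by positivity)]
    gcongr
    exact hg.trans hr₁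
  have h2 : ‖(θ ^ 2) • g‖ ≤ θ * (r₁ / 4) := by
    rw [norm_smul, Real.norm_of_nonneg (by positivity), pow_two, mul_assoc]
    have : ‖g‖ ≤ ‖g₀‖ + r := by
      have := norm_le_norm_add_norm_sub' g g₀
      linarith
    refine mul_le_mul_of_nonneg_left (le_trans ?_ hθ) hθ0
    gcongr
  have h3 : ‖(1 - θ) ^ 2 • (G - g)‖ ≤ r₁ / 4 * θ := by
    rw [norm_smul, Real.norm_of_nonneg (by positivity)]
    refine (mul_le_of_le_one_left (norm_nonneg _) ?_).trans (hG.trans he)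
    exact pow_le_one₀ (by linarith) (by linarith)
  rw [hid]
  have h4 := norm_sub_le ((2 * θ) • (g - g₀) - (θ ^ 2) • g) ((1 - θ) ^ 2 • (G - g))
  have h5 := norm_sub_le ((2 * θ) • (g - g₀)) ((θ ^ 2) • g)
  linarith

theorem colGram_smul_self (c : ℝ) (P : 𝔼 →L[ℝ] 𝔽) :
    colGram (c • P) (c • P) = c ^ 2 • colGram P P := by
  ext i j
  simp [colGram, inner_smul_left, inner_smul_right, pow_two, mul_assoc]

end Existence

section

open Metric Filter Topology

set_option maxHeartbeats 1000000 in
theorem theorem1p1 (n : ℕ) (g₀ : Matrix (Fin n) (Fin n) ℝ) (hg₀ : g₀.PosDef) :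
    ∃ r : ℝ, 0 < r ∧
      ∀ (Ω : Set (EuclideanSpace ℝ (Fin n))), IsOpen Ω → Bornology.IsBounded Ω →
        HasSmoothBoundary Ω →
      ∀ (β : ℝ), 0 < β →
      ∀ (g : EuclideanSpace ℝ (Fin n) → Matrix (Fin n) (Fin n) ℝ),
        (∀ x ∈ closure Ω, (g x).PosDef) → IsCHolder β Ω g →
        normC0 Ω (fun x => g x - g₀) ≤ ENNReal.ofReal r →
      ∃ δ₀ : ℝ, 0 < δ₀ ∧ ∃ C : ℝ, 0 < C ∧
        ∀ (u : EuclideanSpace ℝ (Fin n) → EuclideanSpace ℝ (Fin (n + 1))) (α : ℝ),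
          IsCkHolder 2 0 Ω u →
          normC0 Ω (fun x => pullbackMetric u x - g x) ≤ ENNReal.ofReal (δ₀ ^ 2) →
          0 < α → α < min (1 / (1 + 2 * ((n : ℝ) * ((n : ℝ) + 1) / 2))) (β / 2) →
          ∃ v : EuclideanSpace ℝ (Fin n) → EuclideanSpace ℝ (Fin (n + 1)),
            IsCkHolder 1 α Ω v ∧
            (∀ x ∈ Ω, pullbackMetric v x = g x) ∧
            normC1 Ω (fun x => v x - u x) ≤
              ENNReal.ofReal C *
                normC0 Ω (fun x => pullbackMetric u x - g x) ^ (1 / 2 : ℝ) := by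
  obtain ⟨r₁, κ, ρ, C₀, δs, hr₁, hκ, hρ, hC₀, hδs, hmain⟩ := exists_isometric_of_isApprox hg₀
  set r := min (ρ / 2) (r₁ / 4)
  have hr : 0 < r := lt_min (by positivity) (by positivity)
  refine ⟨r, hr, fun Ω hΩ hb hs β hβ g hgpos hgβ hgr => ?_⟩
  set G₀ := ‖g₀‖
  have hG₀ : 0 ≤ G₀ := norm_nonneg _
  have hgr' : ∀ x ∈ Ω, ‖g x - g₀‖ ≤ r := norm_le_of_normC0_le hr.le hgr
  have hgs : ∀ x ∈ Ω, (g x).IsSymm := fun x hx => by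
    have := (hgpos x (subset_closure hx)).isHermitian
    rwa [Matrix.IsHermitian, Matrix.conjTranspose_eq_transpose_of_trivial] at this
  set β' := min β 1
  have hβ' : 0 < β' := lt_min hβ one_pos
  obtain ⟨H, hH, hHg⟩ := hs.exists_holder hΩ hb hgβ
  obtain ⟨g', hg's, hg'H, hg'g⟩ := exists_holder_extension_matrix hH hβ' (min_le_right _ _) hgs hHg
  set H' : ℝ := n * H
  have hH' : 0 ≤ H' := by positivity
  have hg'u : UniformContinuous g' := uniformContinuous_of_holder hβ' hg'H
  obtain ⟨d₁, hd₁, hgd⟩ := Metric.uniformContinuous_iff.1 hg'u (ρ / 2) (by positivity)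
  have hg'ρ : ∀ x ∈ thickening d₁ Ω, ‖g' x - g₀‖ ≤ ρ := fun y hy => by
    obtain ⟨x, hx, hyx⟩ := mem_thickening_iff.1 hy
    have h1 := hgd hyx
    rw [dist_eq_norm, hg'g x hx] at h1
    have h2 := hgr' x hx
    have h3 : r ≤ ρ / 2 := min_le_left _ _
    have h4 := norm_sub_le_norm_sub_add_norm_sub (g' y) (g x) g₀
    linarith
  obtain ⟨rep, CR, hCR, hrep, hrepf⟩ := hs.exists_reference hΩ hb (EuclideanSpace ℝ (Fin (n + 1)))
  -- `u` is shrunk by the factor `1 - K * ε ^ 2` when the defect of its metric is `ε ^ 2`.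
  set K := 4 / r₁ with hK
  have hK0 : 0 < K := by positivity
  set M : ℝ := n * √(G₀ + r + 1) with hM
  have hM0 : 0 ≤ M := by positivity
  set S := √(2 * K) with hS
  have hS0 : 0 < S := by positivity
  have hS2 : S ^ 2 = 2 * K := Real.sq_sqrt (by positivity)
  set δ₀ := min (min 1 (δs / S)) (min (1 / (K + 1)) (r₁ / (4 * (K * (G₀ + r) + 1)))) with hδ₀d
  have hδ₀ : 0 < δ₀ := by positivity
  have hδ₀1 : δ₀ ≤ 1 := (min_le_left _ _).trans (min_le_left _ _)
  have hδ₀S : δ₀ * S ≤ δs := by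
    rw [← le_div_iff₀ hS0]; exact (min_le_left _ _).trans (min_le_right _ _)
  have hδ₀K : K * δ₀ ≤ 1 := by
    have : δ₀ ≤ 1 / (K + 1) := (min_le_right _ _).trans (min_le_left _ _)
    rw [le_div_iff₀ (by positivity)] at this
    linarith
  have hδ₀r : K * δ₀ * (G₀ + r) ≤ r₁ / 4 := by
    have : δ₀ ≤ r₁ / (4 * (K * (G₀ + r) + 1)) := (min_le_right _ _).trans (min_le_right _ _)
    rw [le_div_iff₀ (by positivity)] at this
    linarith
  set C := (C₀ + 1) * S + K * (CR + 1) * M with hC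
  have hC0 : 0 < C := by positivity
  refine ⟨δ₀, hδ₀, (1 + n) * C, by positivity, fun u α hu hue hα hαlt => ?_⟩
  have hα1 : α < 1 / (1 + 2 * ((n * (n + 1) / 2 : ℕ) : ℝ)) := by
    have h2 : 2 ∣ n * (n + 1) := (Nat.even_mul_succ_self n).two_dvd
    rw [Nat.cast_div h2 (by norm_num)]
    push_cast
    exact hαlt.trans_le (min_le_left _ _)
  have hα1' : α < 1 := hα1.trans_le (by
    rw [div_le_one (by positivity)]
    have : (0 : ℝ) ≤ ((n * (n + 1) / 2 : ℕ) : ℝ) := by positivity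
    linarith)
  set N0 := normC0 Ω (fun x => pullbackMetric u x - g x) with hN0
  have hN0t : N0 ≠ ⊤ := ne_top_of_le_ne_top ENNReal.ofReal_ne_top hue
  set e := N0.toReal with he
  have hN0e : N0 = ENNReal.ofReal e := (ENNReal.ofReal_toReal hN0t).symm
  have he0 : 0 ≤ e := ENNReal.toReal_nonneg
  have heδ : e ≤ δ₀ ^ 2 := by
    rw [hN0e, ENNReal.ofReal_le_ofReal_iff (by positivity)] at hue
    exact hue
  have hpt : ∀ x ∈ Ω, ‖colGram (fderiv ℝ u x) (fderiv ℝ u x) - g x‖ ≤ e :=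
    norm_le_of_normC0_le he0 hN0e.le
  rcases eq_or_lt_of_le he0 with h0 | hepos
  -- An exact solution needs no correction.
  · refine ⟨u, hs.isCkHolder_one hΩ hb hu hα hα1'.le, fun x hx => ?_, ?_⟩
    · have := hpt x hx
      rw [← h0] at this
      rw [pullbackMetric_eq_gram]
      exact sub_eq_zero.1 (norm_le_zero_iff.1 this)
    · have : normC1 Ω (fun x => u x - u x) ≤ ENNReal.ofReal ((1 + n) * 0) :=
        normC1_le (fun x _ => by simp) (fun x _ => by simp)
      refine this.trans ?_
      simp
  -- As the defect is positive, `n ≥ 1`, and then `α < 1 / 2`: the exponent may be replaced by `β'`.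
  have hαβ : α < β' / 2 := by
    have h1 : α < β / 2 := hαlt.trans_le (min_le_right _ _)
    rcases Nat.eq_zero_or_pos n with rfl | hn
    · exfalso
      have : N0 = 0 := by
        rw [hN0, normC0]
        simp only [ENNReal.iSup_eq_zero]
        intro x _
        rw [Subsingleton.elim (pullbackMetric u x - g x) 0]
        simp
      rw [he, this] at hepos
      simp at hepos
    · have h2 : (1 : ℝ) ≤ ((n * (n + 1) / 2 : ℕ) : ℝ) := by
        have : 1 ≤ n * (n + 1) / 2 := by
          rw [Nat.le_div_iff_mul_le two_pos]; nlinarith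
        exact_mod_cast this
      have h3 : α < 1 / 2 := hα1.trans_le (by
        rw [div_le_div_iff₀ (by positivity) two_pos]; linarith)
      rcases min_cases β 1 with h | h
      · rw [show β' = β from h.1]; exact h1
      · rw [show β' = 1 from h.1]; exact h3
  set ε := √e with hε
  have hε0 : 0 < ε := Real.sqrt_pos.2 hepos
  have hε2 : ε ^ 2 = e := Real.sq_sqrt he0
  have hεδ : ε ≤ δ₀ := Real.sqrt_le_iff.2 ⟨hδ₀.le, heδ⟩
  set θ := K * e with hθ
  have hθ0 : 0 < θ := by positivity
  have heδ' : e ≤ δ₀ := heδ.trans (pow_le_of_le_one hδ₀.le hδ₀1 two_ne_zero)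
  have hθ1 : θ ≤ 1 := le_trans (by rw [hθ]; gcongr) hδ₀K
  obtain ⟨B, L, hB0, hL0, hB, hL⟩ := hs.exists_lipschitz_fderiv hΩ hb hu
  have hMu : ∀ x ∈ Ω, ‖fderiv ℝ u x‖ ≤ M := fun x hx => by
    refine (norm_le_of_gram _).trans ?_
    rw [hM]
    gcongr
    have h1 := hpt x hx
    have h2 := hgr' x hx
    have h3 := norm_le_norm_add_norm_sub' (colGram (fderiv ℝ u x) (fderiv ℝ u x)) (g x)
    have h4 := norm_le_norm_add_norm_sub' (g x) g₀
    linarith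
  have hud : DifferentiableOn ℝ u Ω := hu.contDiffOn.differentiableOn (by simp)
  -- The map `u` shrunk towards its values at the reference points, with `(1 - θ) ^ 2` times the
  -- metric.
  set w : EuclideanSpace ℝ (Fin n) → EuclideanSpace ℝ (Fin (n + 1)) := fun x =>
    (1 - θ) • u x + θ • u (rep x) with hw
  have hwloc : ∀ x ∈ Ω, w =ᶠ[𝓝 x] fun y => (1 - θ) • u y + θ • u (rep x) := fun x hx => by
    filter_upwards [hrep x hx] with y hy
    simp only [hw, hy]
  have hDw : ∀ x ∈ Ω, fderiv ℝ w x = (1 - θ) • fderiv ℝ u x := fun x hx => by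
    rw [(hwloc x hx).fderiv_eq, fderiv_add_const]
    exact fderiv_const_smul (hud.differentiableAt (hΩ.mem_nhds hx)) (1 - θ)
  have hwc : ContDiffOn ℝ 1 w Ω := fun x hx => by
    have h1 : ContDiffAt ℝ 1 u x :=
      (hu.contDiffOn.contDiffAt (hΩ.mem_nhds hx)).of_le (by norm_num)
    exact (((h1.const_smul (1 - θ)).add contDiffAt_const).congr_of_eventuallyEq
      (hwloc x hx)).contDiffWithinAt
  have h1θ : ‖1 - θ‖ ≤ 1 := by
    rw [Real.norm_of_nonneg (by linarith)]; linarith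
  have hMw : ∀ x ∈ Ω, ‖fderiv ℝ w x‖ ≤ M := fun x hx => by
    rw [hDw x hx, norm_smul]
    exact (mul_le_of_le_one_left (norm_nonneg _) h1θ).trans (hMu x hx)
  obtain ⟨η, Cl, hη, hCl, hlip⟩ := hs.exists_lipschitz hΩ hb (EuclideanSpace ℝ (Fin (n + 1)))
  set δ := S * ε with hδ
  have hδ0 : 0 < δ := by positivity
  have hδ2 : δ ^ 2 = 2 * θ := by rw [hδ, mul_pow, hS2, hε2, hθ]; ring
  have hδδs : δ ≤ δs := le_trans (by rw [hδ, mul_comm]; gcongr) hδ₀S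
  obtain ⟨W, freq, d, hd, hW, hWw⟩ := hs.exists_isApprox hΩ hb hg'u g₀ (w := w) (M := M)
    (L₀ := Cl * M) (L := L) (η := η) (r₁ := r₁) (κ := κ) (δ := δ) hwc hη hM0 (by positivity) hL0 hMw
    (hlip w M (hwc.differentiableOn (by simp)) hMw) (fun x hx y hy _ => by
      rw [hDw x hx, hDw y hy]
      exact (norm_smul_sub_smul_le h1θ _ _).trans (hL x hx y hy)) hr₁ hκ hδ0
    (fun x hx => by
      rw [hDw x hx, colGram_smul_self, hδ2, hg'g x hx]
      refine norm_metric_defect_le (min_le_right _ _) (hgr' x hx) (hpt x hx) hθ0.le hθ1 ?_ ?_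
      · refine le_trans ?_ hδ₀r
        rw [hθ]
        gcongr
      · rw [hθ, hK]
        apply le_of_eq
        field_simp)
  have hd2 : 0 < min d d₁ := lt_min hd hd₁
  obtain ⟨v, hv, hvp⟩ := hmain Ω g' (min d d₁) H' β' hb hg'u.continuous hg's hH' hg'H hβ' hd2
    (fun x hx => hg'ρ x (thickening_mono (min_le_right _ _) Ω hx)) W δ freq α
    (hW.mono hκ.le hδ0.le le_rfl (min_le_left _ _)) hδ0 hδδs hα hα1 hαβ
  have hθε : θ ≤ K * ε := by
    rw [hθ, ← hε2]
    have : ε ^ 2 ≤ ε := pow_le_of_le_one hε0.le (hεδ.trans hδ₀1) two_ne_zero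
    gcongr
  have hexp : C * ε = C₀ * δ + δ + K * ε * (CR * M) + K * ε * M := by
    rw [hC, hδ]; ring
  have hKM : 0 ≤ K * ε * M := by positivity
  have hKCM : 0 ≤ K * ε * (CR * M) := by positivity
  refine ⟨v, hv, fun x hx => ?_, ?_⟩
  · rw [pullbackMetric_eq_gram, (hvp x hx).1, hg'g x hx]
  · have hle : normC1 Ω (fun x => v x - u x) ≤ ENNReal.ofReal ((1 + n) * (C * ε)) := by
      refine normC1_le (fun x hx => ?_) (fun x hx => ?_)
      · have a1 := (hvp x hx).2.1
        have a2 := (hWw x hx).1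
        have a3 : ‖w x - u x‖ ≤ K * ε * (CR * M) := by
          have e1 : w x - u x = -(θ • (u x - u (rep x))) := by rw [hw]; module
          rw [e1, norm_neg, norm_smul, Real.norm_of_nonneg hθ0.le]
          have := hrepf u M hud hMu x hx
          gcongr
        have a4 := norm_sub_le_norm_sub_add_norm_sub (v x) (W x) (u x)
        have a5 := norm_sub_le_norm_sub_add_norm_sub (W x) (w x) (u x)
        linarith
      · have hvd : DifferentiableAt ℝ v x :=
          (hv.contDiffOn.differentiableOn (by simp)).differentiableAt (hΩ.mem_nhds hx)
        rw [fderiv_fun_sub hvd (hud.differentiableAt (hΩ.mem_nhds hx))]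
        have a1 := (hvp x hx).2.2
        have a2 := (hWw x hx).2
        have a3 : ‖fderiv ℝ w x - fderiv ℝ u x‖ ≤ K * ε * M := by
          have e1 : fderiv ℝ w x - fderiv ℝ u x = -(θ • fderiv ℝ u x) := by
            rw [hDw x hx]; module
          rw [e1, norm_neg, norm_smul, Real.norm_of_nonneg hθ0.le]
          have := hMu x hx
          gcongr
        have a4 := norm_sub_le_norm_sub_add_norm_sub (fderiv ℝ v x) (fderiv ℝ W x) (fderiv ℝ u x)
        have a5 := norm_sub_le_norm_sub_add_norm_sub (fderiv ℝ W x) (fderiv ℝ w x) (fderiv ℝ u x)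
        linarith
    refine hle.trans (le_of_eq ?_)
    rw [hN0e, ENNReal.ofReal_rpow_of_nonneg he0 (by norm_num), ← Real.sqrt_eq_rpow,
      ← ENNReal.ofReal_mul (by positivity), mul_assoc]

end
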